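/- **Model.** There are $n$ parties, numbered $0,\dots,n-1$, with local clocks and authenticated point-to-point channels between every pair (including a channel from each party to itself); a fixed bound $\Delta>0$ is known to all. A set of at most $f$ parties is faulty (Byzantine): these behave arbitrarily, with no computational restriction; no cryptography and no setup besides the authenticated channels is used. All other (nonfaulty) parties run the protocol. There is a time GST, unknown to the parties, such that every nonfaulty party starts at the latest at GST, every message between nonfaulty parties sent at time $t$ arrives at the latest at time $\max(t,\mathrm{GST})+\Delta$, and from GST on all clocks run in step with real time; before GST delays (finite) and clocks are arbitrary. Local computation takes no time, each received message is processed atomically, and only finitely many events happen in bounded time. A *Byzantine Agreement protocol in partial synchrony resilient to $f$ Byzantine parties* is a protocol such that in every such execution (for every faulty set, behaviour of the faulty parties, message scheduling, clocks, GST and inputs): * **Termination.** All nonfaulty parties eventually decide on a value and terminate. * **Correctness.** If two nonfaulty parties decide on $val$ and $val'$, then $val=val'$. * **Validity.** If all parties are nonfaulty and have the same input $val$, then every party that decides, decides on $val$. **Protocol IT-HS**, with parameters $n,f,\Delta$; code of party $i$ with input $x_i$ (from an arbitrary set of values). Variables, with initial values: $lock=key3=key2=key1=0$; $lock\_val=key3\_val=key2\_val=key1\_val=x_i$;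 $prev\_key2=prev\_key1=-1$; $view=1$; arrays $highest\_request[j]=highest\_abort[j]=0$. The primary of view $v$ is the party $v \bmod n$. "Send to all" includes the sender. "*Send upon join*" a message $m$ (fixed at the time of the call) in view $v$ means: to each party $j$, send $m$ as soon as $highest\_request[j]=v$ while the sender is in view $v$. Records of received messages and pending actions of a view are dropped when the view is left, and messages tagged with a view other than the current one are ignored, except $request$ and $abort$. *At the start of each view* (initially and whenever $view$ changes): send $\langle request,view\rangle$ to all; as soon as $highest\_request[primary]=view$, send $\langle suggest,key3,key3\_val,key2,key2\_val,prev\_key2,view\rangle$ to the primary; send upon join $\langle proof,key1,key1\_val,prev\_key1,view\rangle$; and when $11\Delta$ has passed on the local clock in this view, send $\langle abort,view\rangle$ to all. *Primary of the view.* On the first $\langle suggest,k3,v3,k2,v2,pk2,view\rangle$ from $j$: if $pk2<k2<view$, add $(k2,v2,pk2)$ to the multiset $key2\_proofs$; if $k3=0$, add $(k3,v3)$ to the multiset $suggestions$; otherwise, if $k3<view$, add it as soon as at least $f+1$ elements $(k,v,pk)$ of $key2\_proofs$ satisfy $k3\le pk$ or ($k3\le k$ and $v3=v$). Once $|suggestions|\ge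 n-f$, choose some $(k,v)\in suggestions$ with $k$ maximal and send upon join $\langle propose,k,v,view\rangle$ (once per view). *All parties, in the current view.* On the first $\langle proof,k1,v1,pk1,view\rangle$ from $j$: if $view>k1>pk1$, add $(k1,v1,pk1)$ to the multiset $proofs$. On the first $\langle propose,key,val,view\rangle$ from the primary: if $lock=0$ or $val=lock\_val$, send upon join $\langle echo,val,view\rangle$; otherwise, if $view>key\ge lock$, do so as soon as at least $f+1$ elements $(k,v,pk)$ of $proofs$ satisfy $lock\le pk$ or ($lock\le k$ and $v\ne lock\_val$), where $lock,lock\_val$ are the values held when the proposal was processed. On $\langle echo,val,view\rangle$ from $n-f$ parties with the same $val$: send upon join $\langle key1,val,view\rangle$; if $key1\_val\ne val$, set $prev\_key1\leftarrow key1$, $key1\_val\leftarrow val$; then set $key1\leftarrow view$. On $\langle key1,val,view\rangle$ from $n-f$ parties with the same $val$: send upon join $\langle key2,val,view\rangle$; if $key2\_val\ne val$, set $prev\_key2\leftarrow key2$, $key2\_val\leftarrow val$; then set $key2\leftarrow view$. On $\langle key2,val,view\rangle$ from $n-f$ parties with the same $val$: send upon join $\langle key3,val,view\rangle$ and set $key3\leftarrow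 view$, $key3\_val\leftarrow val$. On $\langle key3,val,view\rangle$ from $n-f$ parties with the same $val$: send upon join $\langle lock,val,view\rangle$ and set $lock\leftarrow view$, $lock\_val\leftarrow val$. On $\langle lock,val,view\rangle$ from $n-f$ parties with the same $val$: send $\langle done,val\rangle$ to all, unless a $done$ message was sent before. *All parties, in every view.* On $\langle request,v\rangle$ from $j$: $highest\_request[j]\leftarrow\max(highest\_request[j],v)$. On $\langle done,val\rangle$ from $f+1$ parties with the same $val$: send $\langle done,val\rangle$ to all, unless a $done$ message was sent before. On $\langle done,val\rangle$ from $n-f$ parties with the same $val$: decide $val$ and terminate. On $\langle abort,v\rangle$ from $j$ with $highest\_abort[j]<v$: set $highest\_abort[j]\leftarrow v$; let $u$ be the $(f+1)$-th largest entry of $highest\_abort$; if $u>highest\_abort[i]$, send $\langle abort,u\rangle$ to all and set $highest\_abort[i]\leftarrow u$; then let $w$ be the $(n-f)$-th largest entry; if $w\ge view$, set $view\leftarrow w+1$. **Theorem.** For all $n,f$ with $f<n/3$ and all $\Delta>0$, IT-HS is a Byzantine Agreement protocol in partial synchrony resilient to $f$ Byzantine parties. -/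

import Mathlib

universe u

/-! ### Byzantine Agreement in the partially synchronous model -/

namespace PartialSync

/-- The messages a party sends in one atomic step: for every recipient, a list of messages. -/
abbrev Outbox (n : ℕ) (M : Type u) : Type u := Fin n → List M

/-- A protocol for `n` parties with inputs and outputs in `V`, over authenticated point-to-point
channels. Every party is a state machine with a local clock and (at most) one pending alarm. The
`ℝ` arguments are the reading of the party's own local clock at the moment of the step. Transitions
return the set of allowed outcomes (new state and messages sent), so a protocol may leave choices
open; every resolution of the choices is then considered. -/
structure Protocol (n : ℕ) (V : Type u) where
  State : Type u
  Msg : Type u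
  /-- code run by party `i` with the given input when it starts -/
  start : Fin n → V → ℝ → Set (State × Outbox n Msg)
  /-- `receive i now j m s`: party `i` in state `s` receives the message `m` from party `j` -/
  receive : Fin n → ℝ → Fin n → Msg → State → Set (State × Outbox n Msg)
  /-- local clock reading at which the pending alarm, if any, goes off -/
  deadline : State → Option ℝ
  /-- code run by party `i` when its alarm goes off -/
  timeout : Fin n → ℝ → State → Set (State × Outbox n Msg)
  /-- the value decided on, if the party has decided (and thereby terminated) -/
  decision : State → Option V

/-- Events of an execution. Behaviour of faulty parties needs no events of its own: what they do
is visible only through the messages `recv i j m` that nonfaulty parties `i` get from faulty `j`. -/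
inductive Event (n : ℕ) (M : Type u) : Type u
  | start (i : Fin n)
  | recv (i j : Fin n) (m : M)
  | timeout (i : Fin n)
  | idle

/-- The party that takes a step in an event. -/
def Event.party {n : ℕ} {M : Type u} : Event n M → Option (Fin n)
  | .start i => some i
  | .recv i _ _ => some i
  | .timeout i => some i
  | .idle => none

/-- `LocalStep P i x now e s s' o`: in event `e`, the party `i` with input `x` and local clock
reading `now` moves from `s` to `s'` and sends `o`, following the protocol. The state is `none`
before the party has started. A party that has decided has terminated: it ignores all messages,
its alarm is off and it sends nothing any more. -/
inductive LocalStep {n : ℕ} {V : Type u} (P : Protocol n V) (i : Fin n) (x : V) (now : ℝ) :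
    Event n P.Msg → Option P.State → Option P.State → Outbox n P.Msg → Prop
  | start {s' : P.State} {o : Outbox n P.Msg} (h : (s', o) ∈ P.start i x now) :
      LocalStep P i x now (.start i) none (some s') o
  | recv {j : Fin n} {m : P.Msg} {s s' : P.State} {o : Outbox n P.Msg}
      (hs : P.decision s = none) (h : (s', o) ∈ P.receive i now j m s) :
      LocalStep P i x now (.recv i j m) (some s) (some s') o
  | timeout {s s' : P.State} {o : Outbox n P.Msg} {d : ℝ}
      (hs : P.decision s = none) (hd : P.deadline s = some d) (hnow : d ≤ now)
      (h : (s', o) ∈ P.timeout i now s) :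
      LocalStep P i x now (.timeout i) (some s) (some s') o
  | terminated {j : Fin n} {m : P.Msg} {s : P.State} (hs : P.decision s ≠ none) :
      LocalStep P i x now (.recv i j m) (some s) (some s) (fun _ => [])
  | other {e : Event n P.Msg} {s : Option P.State} (he : e.party ≠ some i) :
      LocalStep P i x now e s s (fun _ => [])

/-- An execution of `P` in the partially synchronous model with message delay bound `Δ`, in which
the parties outside `faulty` follow the protocol with the given inputs, while the parties in
`faulty` behave arbitrarily. Steps are indexed by `ℕ`; step `k` happens at real time `time k` and
leads from `state k` to `state (k + 1)`. Message delays, the order of events, `GST`, the clocks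
before `GST` and all messages of faulty parties are arbitrary, and may depend on everything. -/
structure Execution {n : ℕ} {V : Type u} (P : Protocol n V) (faulty : Finset (Fin n)) (Δ : ℝ)
    (input : Fin n → V) where
  /-- the global stabilization time -/
  GST : ℝ
  /-- `clock i t` is the reading of the local clock of party `i` at real time `t` -/
  clock : Fin n → ℝ → ℝ
  time : ℕ → ℝ
  event : ℕ → Event n P.Msg
  state : ℕ → Fin n → Option P.State
  /-- `sent k i j`: the messages that party `i` sends to party `j` in step `k` -/
  sent : ℕ → Fin n → Outbox n P.Msg
  /-- From `GST` on the clocks run in step with real time. (They are arbitrary before; that they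
  show the same reading afterwards is not needed.) -/
  clock_sync : ∀ i s t, GST ≤ s → s ≤ t → clock i t - clock i s = t - s
  time_mono : Monotone time
  /-- only finitely many steps happen in bounded time -/
  time_unbounded : ∀ T : ℝ, ∃ k, T < time k
  state_zero : ∀ i, i ∉ faulty → state 0 i = none
  /-- nonfaulty parties follow the protocol -/
  step : ∀ k i, i ∉ faulty → LocalStep P i (input i) (clock i (time k)) (event k)
    (state k i) (state (k + 1) i) (sent k i)
  /-- all nonfaulty parties participate -/
  starts : ∀ i, i ∉ faulty → ∃ k, event k = .start i ∧ time k ≤ GST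
  /-- channels are authenticated: what arrives in the name of a nonfaulty party was sent by it -/
  authentic : ∀ k i j m, i ∉ faulty → j ∉ faulty → event k = .recv i j m →
    ∃ k' < k, m ∈ sent k' j i
  /-- every message between nonfaulty parties arrives, no later than `Δ` after both its sending
  and `GST` -/
  delivery : ∀ k i j m, i ∉ faulty → j ∉ faulty → m ∈ sent k i j →
    ∃ k' > k, event k' = .recv j i m ∧ time k' ≤ max (time k) GST + Δ
  /-- alarms are never overdue: time does not pass a moment at which the local clock has reached
  the deadline of a pending alarm without the alarm going off -/
  punctual : ∀ k i s d, i ∉ faulty → state (k + 1) i = some s → P.decision s = none →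
    P.deadline s = some d → ∀ t, time k ≤ t → t < time (k + 1) → clock i t < d

namespace Execution

variable {n : ℕ} {V : Type u} {P : Protocol n V} {faulty : Finset (Fin n)} {Δ : ℝ}
  {input : Fin n → V}

/-- Party `i` decides on `v` (and terminates) at some point of the execution. -/
def Decides (E : Execution P faulty Δ input) (i : Fin n) (v : V) : Prop :=
  ∃ k s, E.state k i = some s ∧ P.decision s = some v

/-- All nonfaulty parties eventually decide on a value and terminate. -/
def Termination (E : Execution P faulty Δ input) : Prop :=
  ∀ i, i ∉ faulty → ∃ v, E.Decides i v

/-- No two nonfaulty parties decide on different values. -/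
def Correctness (E : Execution P faulty Δ input) : Prop :=
  ∀ i j v w, i ∉ faulty → j ∉ faulty → E.Decides i v → E.Decides j w → v = w

/-- If all parties are nonfaulty and have the same input, no other value is decided on. -/
def Validity (E : Execution P faulty Δ input) : Prop :=
  faulty = ∅ → ∀ v, (∀ i, input i = v) → ∀ i w, E.Decides i w → w = v

end Execution

/-- `P` is a Byzantine Agreement protocol in partial synchrony with delay bound `Δ`, resilient to
`f` Byzantine parties. -/
def IsByzantineAgreement {n : ℕ} {V : Type u} (P : Protocol n V) (f : ℕ) (Δ : ℝ) : Prop :=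
  ∀ faulty : Finset (Fin n), faulty.card ≤ f → ∀ input : Fin n → V,
    ∀ E : Execution P faulty Δ input, E.Termination ∧ E.Correctness ∧ E.Validity

end PartialSync

/-! ### The protocol IT-HS -/

namespace ITHS

open PartialSync

/-- The five all-to-all voting rounds of a view. -/
inductive Phase : Type
  | echo | key1 | key2 | key3 | lock
  deriving DecidableEq

/-- A triple `(key, val, prev)` such as `(key1, key1_val, prev_key1)`: the last view in which the
key was set, its value, and the last view in which it was set to a different value. -/
structure KeyRecord (V : Type u) : Type u where
  key : ℤ
  val : V
  prev : ℤ

/-- Set the key to `v` in view `view`. -/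
def KeyRecord.set {V : Type u} [DecidableEq V] (r : KeyRecord V) (view : ℕ) (v : V) :
    KeyRecord V :=
  if r.val ≠ v then ⟨view, v, r.key⟩ else ⟨view, r.val, r.prev⟩

inductive Msg (V : Type u) : Type u
  | request (view : ℕ)
  | suggest (k3 : ℤ) (v3 : V) (key2 : KeyRecord V) (view : ℕ)
  | proof (key1 : KeyRecord V) (view : ℕ)
  | propose (key : ℤ) (val : V) (view : ℕ)
  | vote (ph : Phase) (val : V) (view : ℕ)
  | done (val : V)
  | abort (view : ℕ)

structure State (n : ℕ) (V : Type u) : Type u where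
  lock : ℤ
  lockVal : V
  key3 : ℤ
  key3Val : V
  key2 : KeyRecord V
  key1 : KeyRecord V
  view : ℕ
  highestRequest : Fin n → ℕ
  highestAbort : Fin n → ℕ
  /-- the parties from which `done` has been received with a given value -/
  doneFrom : V → Finset (Fin n)
  /-- whether a `done` message has been sent -/
  doneSent : Bool
  decided : Option V
  /-- local clock reading at which the view times out; `none` once it has done so -/
  timer : Option ℝ
  /-- messages for which `sendAllUponJoin` has been called (this and the remaining fields concern
  the current view only and are reset when a view starts) -/
  joinMsgs : List (Msg V)
  /-- the first `suggest` message received from each party: `(k3, v3)` and the `key2` record -/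
  suggestFrom : Fin n → Option ((ℤ × V) × KeyRecord V)
  /-- whether a `propose` message has been sent -/
  proposed : Bool
  /-- the first `proof` message received from each party -/
  proofFrom : Fin n → Option (KeyRecord V)
  /-- whether a `propose` message has been received from the primary -/
  proposalSeen : Bool
  /-- a proposed value that is waiting for the lock to be opened, together with the lock
  `(lock, lock_val)` that the party held when it processed the proposal -/
  pending : Option (V × ℤ × V)
  /-- the parties from which a vote of the given phase and value has been received -/
  voteFrom : Phase → V → Finset (Fin n)

/-- The primary of a view; parties are numbered from `0`. -/
def IsPrimary {n : ℕ} (j : Fin n) (view : ℕ) : Prop := (j : ℕ) = view % n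

instance {n : ℕ} (j : Fin n) (view : ℕ) : Decidable (IsPrimary j view) :=
  inferInstanceAs (Decidable ((j : ℕ) = view % n))

/-- The `k`-th largest entry of an array, counted with multiplicity (`1 ≤ k ≤ n`). -/
def kthLargest {n : ℕ} (k : ℕ) (a : Fin n → ℕ) : ℕ :=
  (Finset.univ.filter fun j => k ≤ (Finset.univ.filter fun l => a j ≤ a l).card).sup a

/-- `accept_key`, where `proofs` holds at most one triple per party. -/
def acceptKey {n : ℕ} {V : Type u} [DecidableEq V] (f : ℕ) (key : ℤ) (value : V)
    (proofs : Fin n → Option (KeyRecord V)) : Prop :=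
  f + 1 ≤ (Finset.univ.filter fun j =>
    ∃ r ∈ proofs j, key ≤ r.prev ∨ (key ≤ r.key ∧ value = r.val)).card

instance {n : ℕ} {V : Type u} [DecidableEq V] (f : ℕ) (key : ℤ) (value : V)
    (proofs : Fin n → Option (KeyRecord V)) : Decidable (acceptKey f key value proofs) :=
  inferInstanceAs (Decidable (_ ≤ _))

/-- `open_lock`, where `proofs` holds at most one triple per party. -/
def openLock {n : ℕ} {V : Type u} [DecidableEq V] (f : ℕ) (lock : ℤ) (lockVal : V)
    (proofs : Fin n → Option (KeyRecord V)) : Prop :=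
  f + 1 ≤ (Finset.univ.filter fun j =>
    ∃ r ∈ proofs j, lock ≤ r.prev ∨ (lock ≤ r.key ∧ r.val ≠ lockVal)).card

instance {n : ℕ} {V : Type u} [DecidableEq V] (f : ℕ) (lock : ℤ) (lockVal : V)
    (proofs : Fin n → Option (KeyRecord V)) : Decidable (openLock f lock lockVal proofs) :=
  inferInstanceAs (Decidable (_ ≤ _))

section

variable {n : ℕ} {V : Type u}

/-- Send a message to every party (the sender included). -/
def sendAll (m : Msg V) : Outbox n (Msg V) := fun _ => [m]

def sendNone : Outbox n (Msg V) := fun _ => []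

/-- `send_all_upon_join`: send `m` now to the parties known to have joined the view; it is sent to
each other party as soon as that party's `request` arrives (see `onRequest`). -/
def sendAllUponJoin (m : Msg V) (s : State n V) : State n V × Outbox n (Msg V) :=
  ({ s with joinMsgs := s.joinMsgs ++ [m] },
    fun j => if s.highestRequest j = s.view then [m] else [])

/-- The `suggest` message of a party in its current state. -/
def suggestMsg (s : State n V) : Msg V := .suggest s.key3 s.key3Val s.key2 s.view

/-- Start view `v`: free the memory of the previous view, set the alarm `11 Δ` ahead, send
`request` to all, send `proof` (with the current `key1` fields) upon join, and send `suggest` to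
the primary if it is known to have joined. -/
noncomputable def enterView (Δ now : ℝ) (v : ℕ) (s : State n V) : State n V × Outbox n (Msg V) :=
  let s₁ : State n V := { s with
    view := v, timer := some (now + 11 * Δ), joinMsgs := [], suggestFrom := fun _ => none,
    proposed := false, proofFrom := fun _ => none, proposalSeen := false, pending := none,
    voteFrom := fun _ _ => ∅ }
  let r := sendAllUponJoin (.proof s₁.key1 v) s₁
  (r.1, fun j => .request v ::
    ((if s₁.highestRequest j = v ∧ IsPrimary j v then [suggestMsg s₁] else []) ++ r.2 j))

/-- Initial state (with input `x`), before the first view, which is view `1`, is entered. -/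
def initState (x : V) : State n V where
  lock := 0
  lockVal := x
  key3 := 0
  key3Val := x
  key2 := ⟨0, x, -1⟩
  key1 := ⟨0, x, -1⟩
  view := 1
  highestRequest := fun _ => 0
  highestAbort := fun _ => 0
  doneFrom := fun _ => ∅
  doneSent := false
  decided := none
  timer := none
  joinMsgs := []
  suggestFrom := fun _ => none
  proposed := false
  proofFrom := fun _ => none
  proposalSeen := false
  pending := none
  voteFrom := fun _ _ => ∅

/-- A `request` message for view `v` from `j`. If it shows that `j` has joined the current view,
the messages waiting for that are sent to `j`, and `suggest` is sent if `j` is the primary. -/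
def onRequest (j : Fin n) (v : ℕ) (s : State n V) : State n V × Outbox n (Msg V) :=
  if s.highestRequest j < v then
    ({ s with highestRequest := Function.update s.highestRequest j v },
      fun l => if l = j ∧ v = s.view then
          (if IsPrimary j v then [suggestMsg s] else []) ++ s.joinMsgs
        else [])
  else (s, sendNone)

/-- An `abort` message for view `v` from `j`, received by `i`. -/
noncomputable def onAbort (f : ℕ) (Δ now : ℝ) (i j : Fin n) (v : ℕ) (s : State n V) :
    State n V × Outbox n (Msg V) :=
  if s.highestAbort j < v then
    let a₁ := Function.update s.highestAbort j v
    let u := kthLargest (f + 1) a₁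
    let a₂ := if a₁ i < u then Function.update a₁ i u else a₁
    let o₂ : Outbox n (Msg V) := if a₁ i < u then sendAll (.abort u) else sendNone
    let s₂ : State n V := { s with highestAbort := a₂ }
    let w := kthLargest (n - f) a₂
    if s.view ≤ w then
      let r := enterView Δ now (w + 1) s₂
      (r.1, fun l => o₂ l ++ r.2 l)
    else (s₂, o₂)
  else (s, sendNone)

variable [DecidableEq V]

/-- Send `done` for `val` to all parties unless a `done` message has been sent before. -/
def sendDone (val : V) (s : State n V) : State n V × Outbox n (Msg V) :=
  if s.doneSent then (s, sendNone) else ({ s with doneSent := true }, sendAll (.done val))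

/-- A `done` message from `j`: echo it at `f + 1` such messages, decide at `n - f`. -/
def onDone (f : ℕ) (j : Fin n) (val : V) (s : State n V) : State n V × Outbox n (Msg V) :=
  if j ∈ s.doneFrom val then (s, sendNone)
  else
    let d := insert j (s.doneFrom val)
    let s₁ : State n V := { s with doneFrom := Function.update s.doneFrom val d }
    let r := if d.card = f + 1 then sendDone val s₁ else (s₁, sendNone)
    (if d.card = n - f then { r.1 with decided := some val } else r.1, r.2)

/-- The set `key2_proofs` of a primary. -/
def key2Proofs (s : State n V) (j : Fin n) : Option (KeyRecord V) :=
  match s.suggestFrom j with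
  | some (_, r) => if r.prev < r.key ∧ r.key < s.view then some r else none
  | none => none

/-- The multiset `suggestions` of a primary, indexed by the parties that made them. -/
def suggestions (f : ℕ) (s : State n V) (j : Fin n) : Option (ℤ × V) :=
  match s.suggestFrom j with
  | some ((k, v), _) =>
    if k = 0 ∨ (k < s.view ∧ acceptKey f k v (key2Proofs s)) then some (k, v) else none
  | none => none

/-- A rule that picks some suggestion whose key is maximal. -/
def IsPick (pick : (Fin n → Option (ℤ × V)) → ℤ × V) : Prop :=
  ∀ S : Fin n → Option (ℤ × V), (∃ j, S j ≠ none) →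
    (∃ j, S j = some (pick S)) ∧ ∀ j kv, S j = some kv → kv.1 ≤ (pick S).1

/-- A `suggest` message from `j` in the current view; only the primary reacts, and only to the
first one from `j`. -/
def onSuggest (f : ℕ) (pick : (Fin n → Option (ℤ × V)) → ℤ × V) (i j : Fin n) (k3 : ℤ) (v3 : V)
    (r : KeyRecord V) (s : State n V) : State n V × Outbox n (Msg V) :=
  if IsPrimary i s.view ∧ s.suggestFrom j = none then
    let s₁ : State n V :=
      { s with suggestFrom := Function.update s.suggestFrom j (some ((k3, v3), r)) }
    let S := suggestions f s₁
    if s₁.proposed = false ∧ n - f ≤ (Finset.univ.filter fun l => (S l).isSome).card then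
      sendAllUponJoin (.propose (pick S).1 (pick S).2 s.view) { s₁ with proposed := true }
    else (s₁, sendNone)
  else (s, sendNone)

/-- The set `proofs` of a party. -/
def proofs (s : State n V) (j : Fin n) : Option (KeyRecord V) :=
  match s.proofFrom j with
  | some r => if r.prev < r.key ∧ r.key < s.view then some r else none
  | none => none

/-- Echo the pending proposal if the lock can be opened. -/
def tryOpen (f : ℕ) (s : State n V) : State n V × Outbox n (Msg V) :=
  match s.pending with
  | some (val, lock, lockVal) =>
    if openLock f lock lockVal (proofs s) then
      sendAllUponJoin (.vote .echo val s.view) { s with pending := none }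
    else (s, sendNone)
  | none => (s, sendNone)

/-- A `proof` message from `j` in the current view; only the first one from `j` counts. -/
def onProof (f : ℕ) (j : Fin n) (r : KeyRecord V) (s : State n V) :
    State n V × Outbox n (Msg V) :=
  if s.proofFrom j = none then
    tryOpen f { s with proofFrom := Function.update s.proofFrom j (some r) }
  else (s, sendNone)

/-- A `propose` message from `j` in the current view; only the first one from the primary
counts. -/
def onPropose (f : ℕ) (j : Fin n) (key : ℤ) (val : V) (s : State n V) :
    State n V × Outbox n (Msg V) :=
  if IsPrimary j s.view ∧ s.proposalSeen = false then
    let s₁ : State n V := { s with proposalSeen := true }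
    if s.lock = 0 ∨ val = s.lockVal then sendAllUponJoin (.vote .echo val s.view) s₁
    else if s.lock ≤ key ∧ key < s.view then
      tryOpen f { s₁ with pending := some (val, s.lock, s.lockVal) }
    else (s₁, sendNone)
  else (s, sendNone)

/-- What a party does upon `n - f` votes of a phase for the same value in the current view. -/
def onQuorum (ph : Phase) (val : V) (s : State n V) : State n V × Outbox n (Msg V) :=
  match ph with
  | .echo => sendAllUponJoin (.vote .key1 val s.view) { s with key1 := s.key1.set s.view val }
  | .key1 => sendAllUponJoin (.vote .key2 val s.view) { s with key2 := s.key2.set s.view val }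
  | .key2 => sendAllUponJoin (.vote .key3 val s.view) { s with key3 := s.view, key3Val := val }
  | .key3 => sendAllUponJoin (.vote .lock val s.view) { s with lock := s.view, lockVal := val }
  | .lock => sendDone val s

/-- An `echo`, `key1`, `key2`, `key3` or `lock` message from `j` in the current view. -/
def onVote (f : ℕ) (j : Fin n) (ph : Phase) (val : V) (s : State n V) :
    State n V × Outbox n (Msg V) :=
  if j ∈ s.voteFrom ph val then (s, sendNone)
  else
    let d := insert j (s.voteFrom ph val)
    let s₁ : State n V := { s with
      voteFrom := Function.update s.voteFrom ph (Function.update (s.voteFrom ph) val d) }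
    if d.card = n - f then onQuorum ph val s₁ else (s₁, sendNone)

/-- Party `i` in state `s` receives `m` from `j`. Messages that belong to a view other than the
current one are ignored, except `request`, `abort` and `done`. -/
noncomputable def onReceive (f : ℕ) (Δ : ℝ) (pick : (Fin n → Option (ℤ × V)) → ℤ × V) (i : Fin n)
    (now : ℝ) (j : Fin n) (m : Msg V) (s : State n V) : State n V × Outbox n (Msg V) :=
  match m with
  | .request v => onRequest j v s
  | .abort v => onAbort f Δ now i j v s
  | .done val => onDone f j val s
  | .suggest k3 v3 r v => if v = s.view then onSuggest f pick i j k3 v3 r s else (s, sendNone)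
  | .proof r v => if v = s.view then onProof f j r s else (s, sendNone)
  | .propose key val v => if v = s.view then onPropose f j key val s else (s, sendNone)
  | .vote ph val v => if v = s.view then onVote f j ph val s else (s, sendNone)

end

/-- The protocol IT-HS for `n` parties, with resilience parameter `f` and delay bound `Δ`. -/
noncomputable def protocol (n f : ℕ) (Δ : ℝ) (V : Type u) [DecidableEq V] : Protocol n V where
  State := State n V
  Msg := Msg V
  start := fun _ x now => {enterView Δ now 1 (initState x)}
  receive := fun i now j m s => {r | ∃ pick, IsPick pick ∧ r = onReceive f Δ pick i now j m s}
  deadline := fun s => s.timer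
  timeout := fun _ _ s => {({ s with timer := none }, sendAll (.abort s.view))}
  decision := fun s => s.decided

end ITHS

set_option linter.unusedSectionVars false

/-! Safety rests on quorum intersection. As `3 * f < n`, any `n - f` parties include `f + 1`
nonfaulty ones, and they meet every set of `f + 1` parties. A nonfaulty party echoes at most one
value per view, and each later vote is backed by a quorum of the phase before, so all quorums of a
view, whatever their phases, are for the same value (`Quorum.unique`). Suppose that a lock quorum
for `val` forms in view `v`. Then `f + 1` nonfaulty parties have locked `val`, and they echo no
other value in later views (`echo_of_locked`): by induction over steps, all quorums of views from
`v` on are for `val`, so a `key1` record of a nonfaulty party can show neither another value set in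
view `v` or later nor a `prev` of at least `v`. But the `f + 1` proofs that open a lock include one
from a nonfaulty party. Every `done` message of a nonfaulty party goes back to a lock quorum, so
`lock_quorum_unique` gives correctness. For validity, a value is followed backwards from an echo to
the proposal, to a suggestion and to the `key3Val` of its sender, which is an input or was echoed
earlier.

For termination, suppose first that no nonfaulty party decides. Alarms, the amplification of aborts
at `f + 1` and the change of view at `n - f` drive the parties through ever higher views
(`exists_view_ge`). Hence there is a view with a nonfaulty primary that is first reached at some
time `t₀` after stabilization (`exists_entered`). No nonfaulty party sends an abort for this or a
later view before `t₀ + 11 * Δ`, and the timetable fits: all nonfaulty parties are in the view by `2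
* Δ` after `t₀`, know this of each other by `3 * Δ`, the primary proposes by `4 * Δ`, all echo by `5
* Δ`, and the five rounds of votes are received by `10 * Δ`. Then all send `done`, for the same
value, and decide.

Two points of this timetable need the keys. A suggested `key3` is backed by `f + 1` nonfaulty voters
for `key2`, whose records make the primary accept it (`suggestion_accepted`). An accepted proposal
against a lock is backed by a nonfaulty `key2` record of a value other than the locked one, hence by
`f + 1` nonfaulty voters for `key1`, whose proofs open the lock (`lock_openable`). The field `prev`
keeps such evidence alive when a key is overwritten (`Dominates`).

If, on the other hand, some nonfaulty party decides, the `done` messages that it received make all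
others send `done` too (`not_undecided_of_decided`). -/

namespace ITHS

open PartialSync

variable {n : ℕ} {V : Type u} [DecidableEq V]

/-! ### The code as a transition relation -/

/-- How the array `a` of highest aborts changes to `a'` when `i` receives `abort v` from `j`, and
the abort messages `o` sent. -/
inductive AbortUpdate (f : ℕ) (i j : Fin n) (v : ℕ) (a : Fin n → ℕ) :
    (Fin n → ℕ) → Outbox n (Msg V) → Prop
  | keep (h : kthLargest (f + 1) (Function.update a j v) ≤ Function.update a j v i) :
      AbortUpdate f i j v a (Function.update a j v) sendNone
  | raise (u : ℕ) (hu : u = kthLargest (f + 1) (Function.update a j v))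
      (h : Function.update a j v i < u) :
      AbortUpdate f i j v a (Function.update (Function.update a j v) i u) (sendAll (.abort u))

/-- The message `m` from `j` has no effect on party `i` in state `s`. -/
def Stale (i j : Fin n) (s : State n V) : Msg V → Prop
  | .request v => v ≤ s.highestRequest j
  | .abort v => v ≤ s.highestAbort j
  | .done val => j ∈ s.doneFrom val
  | .suggest _ _ _ v => v ≠ s.view ∨ ¬ IsPrimary i s.view ∨ s.suggestFrom j ≠ none
  | .proof _ v => v ≠ s.view ∨ s.proofFrom j ≠ none
  | .propose _ _ v => v ≠ s.view ∨ ¬ IsPrimary j s.view ∨ s.proposalSeen = true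
  | .vote ph val v => v ≠ s.view ∨ j ∈ s.voteFrom ph val

/-- Send `m` to all parties that have joined the view of `s`. -/
def sendJoined (s : State n V) (m : Msg V) : Outbox n (Msg V) :=
  fun l => if s.highestRequest l = s.view then [m] else []

/-- The record of votes after a vote of phase `ph` for `val` from `j`. -/
def addVote (s : State n V) (ph : Phase) (val : V) (j : Fin n) : Phase → V → Finset (Fin n) :=
  Function.update s.voteFrom ph
    (Function.update (s.voteFrom ph) val (insert j (s.voteFrom ph val)))

/-- The possible effects of a received message, one constructor for each branch of the code. -/
inductive Act (f : ℕ) (Δ now : ℝ) (i j : Fin n) (s : State n V) :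
    Msg V → State n V → Outbox n (Msg V) → Prop
  | stale {m : Msg V} (h : Stale i j s m) : Act f Δ now i j s m s sendNone
  | request {v : ℕ} (h : s.highestRequest j < v) :
      Act f Δ now i j s (.request v)
        { s with highestRequest := Function.update s.highestRequest j v }
        (fun l => if l = j ∧ v = s.view then
          (if IsPrimary j v then [suggestMsg s] else []) ++ s.joinMsgs else [])
  | abortStay {v : ℕ} {a : Fin n → ℕ} {o : Outbox n (Msg V)} (h : s.highestAbort j < v)
      (ha : AbortUpdate f i j v s.highestAbort a o) (hw : kthLargest (n - f) a < s.view) :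
      Act f Δ now i j s (.abort v) { s with highestAbort := a } o
  | abortEnter {v : ℕ} {a : Fin n → ℕ} {o : Outbox n (Msg V)} (h : s.highestAbort j < v)
      (ha : AbortUpdate f i j v s.highestAbort a o) (hw : s.view ≤ kthLargest (n - f) a) :
      Act f Δ now i j s (.abort v)
        (enterView Δ now (kthLargest (n - f) a + 1) { s with highestAbort := a }).1
        (fun l => o l ++
          (enterView Δ now (kthLargest (n - f) a + 1) { s with highestAbort := a }).2 l)
  | done {val : V} {d : Finset (Fin n)} {b : Bool} {o : Outbox n (Msg V)}
      (h : j ∉ s.doneFrom val) (hd : d = insert j (s.doneFrom val))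
      (ho : (d.card = f + 1 ∧ s.doneSent = false ∧ b = true ∧ o = sendAll (.done val)) ∨
        ((d.card = f + 1 → s.doneSent = true) ∧ b = s.doneSent ∧ o = sendNone)) :
      Act f Δ now i j s (.done val)
        { s with
          doneFrom := Function.update s.doneFrom val d, doneSent := b,
          decided := if d.card = n - f then some val else s.decided } o
  | suggest {k3 : ℤ} {v3 : V} {r : KeyRecord V} {s₁ : State n V}
      (hi : IsPrimary i s.view) (h : s.suggestFrom j = none)
      (h₁ : s₁ = { s with
        suggestFrom := Function.update s.suggestFrom j (some ((k3, v3), r)) })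
      (hq : s.proposed = false →
        (Finset.univ.filter fun l => (suggestions f s₁ l).isSome).card < n - f) :
      Act f Δ now i j s (.suggest k3 v3 r s.view)
        { s with suggestFrom := Function.update s.suggestFrom j (some ((k3, v3), r)) } sendNone
  | propose {k3 : ℤ} {v3 : V} {r : KeyRecord V} {s₁ : State n V} {key : ℤ} {val : V}
      (hi : IsPrimary i s.view) (h : s.suggestFrom j = none)
      (h₁ : s₁ = { s with
        suggestFrom := Function.update s.suggestFrom j (some ((k3, v3), r)) })
      (hp : s.proposed = false)
      (hq : n - f ≤ (Finset.univ.filter fun l => (suggestions f s₁ l).isSome).card)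
      (hpick : ∃ l, suggestions f s₁ l = some (key, val))
      (hmax : ∀ l kv, suggestions f s₁ l = some kv → kv.1 ≤ key) :
      Act f Δ now i j s (.suggest k3 v3 r s.view)
        { s with
          suggestFrom := Function.update s.suggestFrom j (some ((k3, v3), r)),
          proposed := true, joinMsgs := s.joinMsgs ++ [.propose key val s.view] }
        (sendJoined s (.propose key val s.view))
  | proof {r : KeyRecord V} {s₁ : State n V} (h : s.proofFrom j = none)
      (h₁ : s₁ = { s with proofFrom := Function.update s.proofFrom j (some r) })
      (hq : ∀ val l lv, s.pending = some (val, l, lv) → ¬ openLock f l lv (proofs s₁)) :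
      Act f Δ now i j s (.proof r s.view)
        { s with proofFrom := Function.update s.proofFrom j (some r) } sendNone
  | proofOpen {r : KeyRecord V} {s₁ : State n V} {val : V} {l : ℤ} {lv : V}
      (h : s.proofFrom j = none)
      (h₁ : s₁ = { s with proofFrom := Function.update s.proofFrom j (some r) })
      (hp : s.pending = some (val, l, lv)) (hq : openLock f l lv (proofs s₁)) :
      Act f Δ now i j s (.proof r s.view)
        { s with
          proofFrom := Function.update s.proofFrom j (some r), pending := none,
          joinMsgs := s.joinMsgs ++ [.vote .echo val s.view] }
        (sendJoined s (.vote .echo val s.view))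
  | proposeEcho {key : ℤ} {val : V} (hj : IsPrimary j s.view) (h : s.proposalSeen = false)
      (hl : s.lock = 0 ∨ val = s.lockVal) :
      Act f Δ now i j s (.propose key val s.view)
        { s with
          proposalSeen := true, joinMsgs := s.joinMsgs ++ [.vote .echo val s.view] }
        (sendJoined s (.vote .echo val s.view))
  | proposeOpen {key : ℤ} {val : V} (hj : IsPrimary j s.view) (h : s.proposalSeen = false)
      (hl : s.lock ≠ 0) (hv : val ≠ s.lockVal) (hk : s.lock ≤ key) (hk' : key < s.view)
      (hq : openLock f s.lock s.lockVal (proofs s)) :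
      Act f Δ now i j s (.propose key val s.view)
        { s with
          proposalSeen := true, pending := none,
          joinMsgs := s.joinMsgs ++ [.vote .echo val s.view] }
        (sendJoined s (.vote .echo val s.view))
  | proposeWait {key : ℤ} {val : V} (hj : IsPrimary j s.view) (h : s.proposalSeen = false)
      (hl : s.lock ≠ 0) (hv : val ≠ s.lockVal) (hk : s.lock ≤ key) (hk' : key < s.view)
      (hq : ¬ openLock f s.lock s.lockVal (proofs s)) :
      Act f Δ now i j s (.propose key val s.view)
        { s with proposalSeen := true, pending := some (val, s.lock, s.lockVal) } sendNone
  | proposeReject {key : ℤ} {val : V} (hj : IsPrimary j s.view) (h : s.proposalSeen = false)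
      (hl : s.lock ≠ 0) (hv : val ≠ s.lockVal) (hk : ¬ (s.lock ≤ key ∧ key < s.view)) :
      Act f Δ now i j s (.propose key val s.view) { s with proposalSeen := true } sendNone
  | vote {ph : Phase} {val : V} (h : j ∉ s.voteFrom ph val)
      (hc : (insert j (s.voteFrom ph val)).card ≠ n - f) :
      Act f Δ now i j s (.vote ph val s.view)
        { s with voteFrom := addVote s ph val j } sendNone
  | quorumEcho {val : V} (h : j ∉ s.voteFrom .echo val)
      (hc : (insert j (s.voteFrom .echo val)).card = n - f) :
      Act f Δ now i j s (.vote .echo val s.view)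
        { s with
          voteFrom := addVote s .echo val j, key1 := s.key1.set s.view val,
          joinMsgs := s.joinMsgs ++ [.vote .key1 val s.view] }
        (sendJoined s (.vote .key1 val s.view))
  | quorumKey1 {val : V} (h : j ∉ s.voteFrom .key1 val)
      (hc : (insert j (s.voteFrom .key1 val)).card = n - f) :
      Act f Δ now i j s (.vote .key1 val s.view)
        { s with
          voteFrom := addVote s .key1 val j, key2 := s.key2.set s.view val,
          joinMsgs := s.joinMsgs ++ [.vote .key2 val s.view] }
        (sendJoined s (.vote .key2 val s.view))
  | quorumKey2 {val : V} (h : j ∉ s.voteFrom .key2 val)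
      (hc : (insert j (s.voteFrom .key2 val)).card = n - f) :
      Act f Δ now i j s (.vote .key2 val s.view)
        { s with
          voteFrom := addVote s .key2 val j, key3 := s.view, key3Val := val,
          joinMsgs := s.joinMsgs ++ [.vote .key3 val s.view] }
        (sendJoined s (.vote .key3 val s.view))
  | quorumKey3 {val : V} (h : j ∉ s.voteFrom .key3 val)
      (hc : (insert j (s.voteFrom .key3 val)).card = n - f) :
      Act f Δ now i j s (.vote .key3 val s.view)
        { s with
          voteFrom := addVote s .key3 val j, lock := s.view, lockVal := val,
          joinMsgs := s.joinMsgs ++ [.vote .lock val s.view] }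
        (sendJoined s (.vote .lock val s.view))
  | quorumLock {val : V} {o : Outbox n (Msg V)} (h : j ∉ s.voteFrom .lock val)
      (hc : (insert j (s.voteFrom .lock val)).card = n - f)
      (ho : (s.doneSent = false ∧ o = sendAll (.done val)) ∨
        (s.doneSent = true ∧ o = sendNone)) :
      Act f Δ now i j s (.vote .lock val s.view)
        { s with voteFrom := addVote s .lock val j, doneSent := true } o

theorem tryOpen_of_none {f : ℕ} {s : State n V} (h : s.pending = none) :
    tryOpen f s = (s, sendNone) := by
  simp [tryOpen, h]

theorem tryOpen_of_some {f : ℕ} {s : State n V} {val : V} {l : ℤ} {lv : V}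
    (h : s.pending = some (val, l, lv)) :
    tryOpen f s = if openLock f l lv (proofs s) then
      sendAllUponJoin (.vote .echo val s.view) { s with pending := none } else (s, sendNone) := by
  simp [tryOpen, h]

/-- All later arguments are case analyses over `Act`, so the code for received messages is taken
apart only here. The bound on `f` makes `n - f` positive, so that a primary about to propose has a
suggestion to pick. -/
theorem Act.of_onReceive {f : ℕ} (hf : 3 * f < n) {Δ now : ℝ} {i j : Fin n} {m : Msg V}
    {s : State n V} {pick : (Fin n → Option (ℤ × V)) → ℤ × V} (hpick : IsPick pick) :
    Act f Δ now i j s m (onReceive f Δ pick i now j m s).1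
      (onReceive f Δ pick i now j m s).2 := by
  cases m with
  | request v =>
    simp only [onReceive, onRequest]
    by_cases h : s.highestRequest j < v
    · rw [if_pos h]
      exact .request h
    · rw [if_neg h]
      exact .stale (not_lt.1 h)
  | suggest k3 v3 r v =>
    simp only [onReceive, onSuggest]
    split_ifs with hv h hq
    · subst hv
      obtain ⟨hp, hq⟩ := hq
      obtain ⟨⟨l, hl⟩, hmax⟩ := hpick (suggestions f { s with
        suggestFrom := Function.update s.suggestFrom j (some ((k3, v3), r)) }) (by
          have : 0 < n - f := by omega
          obtain ⟨l, hl⟩ := Finset.card_pos.1 (this.trans_le hq)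
          refine ⟨l, fun h0 => ?_⟩
          simp [h0] at hl)
      exact .propose h.1 h.2 rfl hp hq ⟨l, hl⟩ hmax
    · subst hv
      refine .suggest h.1 h.2 rfl fun hp => ?_
      by_contra hc
      exact hq ⟨hp, not_lt.1 hc⟩
    · exact .stale (by simp only [Stale]; tauto)
    · exact .stale (by simp only [Stale]; tauto)
  | proof r v =>
    simp only [onReceive, onProof]
    split_ifs with hv h
    · subst hv
      obtain hp | ⟨val, l, lv, hp⟩ : s.pending = none ∨ ∃ val l lv, s.pending = some (val, l, lv) := by
        rcases s.pending with _ | ⟨val, l, lv⟩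
        · exact .inl rfl
        · exact .inr ⟨_, _, _, rfl⟩
      · rw [tryOpen_of_none (by exact hp)]
        exact .proof h rfl (by simp [hp])
      · rw [tryOpen_of_some (by exact hp)]
        split_ifs with ho
        · exact .proofOpen h rfl hp ho
        · refine .proof h rfl fun val' l' lv' h' => ?_
          rw [hp] at h'
          cases h'
          exact ho
    · exact .stale (by simp only [Stale]; tauto)
    · exact .stale (by simp only [Stale]; tauto)
  | propose key val v =>
    simp only [onReceive, onPropose]
    split_ifs with hv h hl hk
    · subst hv
      exact .proposeEcho h.1 h.2 hl
    · subst hv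
      push Not at hl
      simp only [tryOpen]
      split_ifs with ho
      · exact .proposeOpen h.1 h.2 hl.1 hl.2 hk.1 hk.2 ho
      · exact .proposeWait h.1 h.2 hl.1 hl.2 hk.1 hk.2 ho
    · subst hv
      push Not at hl
      exact .proposeReject h.1 h.2 hl.1 hl.2 hk
    · exact .stale (by simp only [Stale]; rw [not_and_or, Bool.not_eq_false] at h; tauto)
    · exact .stale (by simp only [Stale]; tauto)
  | vote ph val v =>
    simp only [onReceive, onVote]
    split_ifs with hv h hc
    · exact .stale (by simp only [Stale]; tauto)
    · subst hv
      cases ph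
      · exact .quorumEcho h hc
      · exact .quorumKey1 h hc
      · exact .quorumKey2 h hc
      · exact .quorumKey3 h hc
      · simp only [onQuorum, sendDone]
        split_ifs with hd
        -- If `done` was sent before, the code leaves the flag alone while `quorumLock` writes
        -- `true`; both agree because of `hd`.
        · have := Act.quorumLock (Δ := Δ) (now := now) (i := i) h hc (.inr ⟨hd, rfl⟩)
          rw [← hd] at this
          exact this
        · exact .quorumLock h hc (.inl ⟨by simpa using hd, rfl⟩)
    · subst hv
      exact .vote h hc
    · exact .stale (by simp only [Stale]; tauto)
  | done val =>
    simp only [onReceive, onDone, sendDone]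
    by_cases h : j ∈ s.doneFrom val
    · rw [if_pos h]
      exact .stale h
    · have key := fun b o ho => Act.done (Δ := Δ) (now := now) (i := i) (b := b) (o := o)
        (f := f) h rfl ho
      rw [if_neg h]
      by_cases hc : (insert j (s.doneFrom val)).card = f + 1
      · by_cases hd : s.doneSent = true
        · have := key _ _ (.inr ⟨fun _ => hd, rfl, rfl⟩)
          by_cases hn : (insert j (s.doneFrom val)).card = n - f
          · simpa only [if_pos hc, if_pos hd, if_pos hn] using this
          · simpa only [if_pos hc, if_pos hd, if_neg hn] using this
        · have := key _ _ (.inl ⟨hc, by simpa using hd, rfl, rfl⟩)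
          by_cases hn : (insert j (s.doneFrom val)).card = n - f
          · simpa only [if_pos hc, if_neg hd, if_pos hn] using this
          · simpa only [if_pos hc, if_neg hd, if_neg hn] using this
      · have := key _ _ (.inr ⟨fun h => absurd h hc, rfl, rfl⟩)
        by_cases hn : (insert j (s.doneFrom val)).card = n - f
        · simpa only [if_neg hc, if_pos hn] using this
        · simpa only [if_neg hc, if_neg hn] using this
  | abort v =>
    simp only [onReceive, onAbort]
    by_cases h : s.highestAbort j < v
    · rw [if_pos h]
      by_cases hu : Function.update s.highestAbort j v i <
          kthLargest (f + 1) (Function.update s.highestAbort j v)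
      · simp only [if_pos hu]
        split_ifs with hw
        · exact .abortEnter h (.raise _ rfl hu) hw
        · exact .abortStay h (.raise _ rfl hu) (not_le.1 hw)
      · simp only [if_neg hu]
        split_ifs with hw
        · exact .abortEnter h (.keep (not_lt.1 hu)) hw
        · exact .abortStay h (.keep (not_lt.1 hu)) (not_le.1 hw)
    · rw [if_neg h]
      exact .stale (not_lt.1 h)

/-! ### Steps and runs -/

/-- A step of party `i` with input `x` at local clock reading `now`. -/
inductive Step (f : ℕ) (Δ : ℝ) (i : Fin n) (x : V) (now : ℝ) :
    Event n (Msg V) → Option (State n V) → Option (State n V) → Outbox n (Msg V) → Prop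
  | start : Step f Δ i x now (.start i) none (some (enterView Δ now 1 (initState x)).1)
      (enterView Δ now 1 (initState x)).2
  | recv {j : Fin n} {m : Msg V} {s s' : State n V} {o : Outbox n (Msg V)}
      (hs : s.decided = none) (h : Act f Δ now i j s m s' o) :
      Step f Δ i x now (.recv i j m) (some s) (some s') o
  | timeout {s : State n V} {d : ℝ} (hs : s.decided = none) (hd : s.timer = some d)
      (hnow : d ≤ now) :
      Step f Δ i x now (.timeout i) (some s) (some { s with timer := none })
        (sendAll (.abort s.view))
  | terminated {j : Fin n} {m : Msg V} {s : State n V} (hs : s.decided ≠ none) :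
      Step f Δ i x now (.recv i j m) (some s) (some s) sendNone
  | other {e : Event n (Msg V)} {s : Option (State n V)} (he : e.party ≠ some i) :
      Step f Δ i x now e s s sendNone

variable (n V) in
/-- An execution of IT-HS with at most `f < n / 3` faulty parties, with the steps of the nonfaulty
parties spelled out. -/
structure Run (f : ℕ) (Δ : ℝ) where
  hf : 3 * f < n
  hΔ : 0 < Δ
  faulty : Finset (Fin n)
  card_faulty : faulty.card ≤ f
  input : Fin n → V
  GST : ℝ
  clock : Fin n → ℝ → ℝ
  time : ℕ → ℝ
  event : ℕ → Event n (Msg V)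
  state : ℕ → Fin n → Option (State n V)
  sent : ℕ → Fin n → Outbox n (Msg V)
  clock_sync : ∀ i s t, GST ≤ s → s ≤ t → clock i t - clock i s = t - s
  time_mono : Monotone time
  time_unbounded : ∀ T : ℝ, ∃ k, T < time k
  state_zero : ∀ i, i ∉ faulty → state 0 i = none
  step : ∀ k i, i ∉ faulty → Step f Δ i (input i) (clock i (time k)) (event k)
    (state k i) (state (k + 1) i) (sent k i)
  starts : ∀ i, i ∉ faulty → ∃ k, event k = .start i ∧ time k ≤ GST
  authentic : ∀ k i j m, i ∉ faulty → j ∉ faulty → event k = .recv i j m →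
    ∃ k' < k, m ∈ sent k' j i
  delivery : ∀ k i j m, i ∉ faulty → j ∉ faulty → m ∈ sent k i j →
    ∃ k' > k, event k' = .recv j i m ∧ time k' ≤ max (time k) GST + Δ
  punctual : ∀ k i s d, i ∉ faulty → state (k + 1) i = some s → s.decided = none →
    s.timer = some d → ∀ t, time k ≤ t → t < time (k + 1) → clock i t < d

/-- The run given by an execution of the protocol. -/
def Run.ofExecution {f : ℕ} {Δ : ℝ} (hf : 3 * f < n) (hΔ : 0 < Δ) {faulty : Finset (Fin n)}
    (hfaulty : faulty.card ≤ f) {input : Fin n → V}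
    (E : Execution (protocol n f Δ V) faulty Δ input) : Run n V f Δ where
  hf := hf
  hΔ := hΔ
  faulty := faulty
  card_faulty := hfaulty
  input := input
  GST := E.GST
  clock := E.clock
  time := E.time
  event := E.event
  state := E.state
  sent := E.sent
  clock_sync := E.clock_sync
  time_mono := E.time_mono
  time_unbounded := E.time_unbounded
  state_zero := E.state_zero
  step := by
    intro k i hi
    have h := E.step k i hi
    generalize E.event k = e at h ⊢
    generalize E.state k i = s at h ⊢
    generalize E.state (k + 1) i = s' at h ⊢
    generalize E.sent k i = o at h ⊢
    cases h with
    | start h =>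
      obtain ⟨rfl, rfl⟩ := Prod.mk.inj (Set.mem_singleton_iff.1 h)
      exact .start
    | recv hs h =>
      obtain ⟨pick, hp, h⟩ := h
      obtain ⟨rfl, rfl⟩ := Prod.mk.inj h
      exact .recv hs (.of_onReceive hf hp)
    | timeout hs hd hnow h =>
      obtain ⟨rfl, rfl⟩ := Prod.mk.inj (Set.mem_singleton_iff.1 h)
      exact .timeout hs hd hnow
    | terminated hs => exact .terminated hs
    | other he => exact .other he
  starts := E.starts
  authentic := E.authentic
  delivery := E.delivery
  punctual := E.punctual

/-! ### Order statistics -/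

/-- The supremum is attained at an entry with at least `k` entries above or equal to it; conversely,
if `k` entries reach `x`, the smallest of those that do qualifies. All thresholds on aborts become
statements about cardinalities in this way. -/
theorem le_kthLargest_iff {k : ℕ} (hk : 1 ≤ k) (hkn : k ≤ n) (a : Fin n → ℕ) (x : ℕ) :
    x ≤ kthLargest k a ↔ k ≤ (Finset.univ.filter fun l => x ≤ a l).card := by
  constructor
  · intro h
    rcases Nat.eq_zero_or_pos x with rfl | hx
    · simpa using hkn
    · obtain ⟨j, hj, hxj⟩ := (Finset.le_sup_iff (by simpa using hx)).1 h
      refine (Finset.mem_filter.1 hj).2.trans (Finset.card_le_card fun l hl => ?_)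
      simp only [Finset.mem_filter, Finset.mem_univ, true_and] at hl ⊢
      omega
  · intro h
    have hne : (Finset.univ.filter fun l => x ≤ a l).Nonempty :=
      Finset.card_pos.1 (by omega)
    obtain ⟨j, hj, hmin⟩ := Finset.exists_min_image _ a hne
    have hxj := (Finset.mem_filter.1 hj).2
    refine hxj.trans (Finset.le_sup (f := a) ?_)
    simp only [Finset.mem_filter, Finset.mem_univ, true_and]
    refine h.trans (Finset.card_le_card fun l hl => ?_)
    simpa using hmin l hl

theorem AbortUpdate.le {f : ℕ} {i j : Fin n} {v : ℕ} {a a' : Fin n → ℕ} {o : Outbox n (Msg V)}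
    (h : AbortUpdate f i j v a a' o) (hv : a j < v) (l : Fin n) : a l ≤ a' l := by
  cases h with
  | keep h =>
    rw [Function.update_apply]
    split_ifs with hl
    · subst hl; omega
    · rfl
  | raise u hu h =>
    rw [Function.update_apply] at h ⊢
    split_ifs with hl
    · subst hl
      split_ifs at h with hl
      · subst hl; omega
      · omega
    · rw [Function.update_apply]
      split_ifs with hl
      · subst hl; omega
      · rfl

/-- One raise is enough: for `x > u` the raised entry does not count, so `f + 1` entries reaching
`x` would have been there before and would have made `u` at least `x`. -/
theorem AbortUpdate.le_self {f : ℕ} (hf : 3 * f < n) {i j : Fin n} {v : ℕ} {a a' : Fin n → ℕ}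
    {o : Outbox n (Msg V)} (h : AbortUpdate f i j v a a' o) (x : ℕ)
    (hx : f + 1 ≤ (Finset.univ.filter fun l => x ≤ a' l).card) : x ≤ a' i := by
  cases h with
  | keep h => exact ((le_kthLargest_iff (by omega) (by omega) _ _).2 hx).trans h
  | raise u hu h =>
    rw [Function.update_self]
    by_contra hxu
    refine hxu (hu ▸ (le_kthLargest_iff (by omega) (by omega) _ _).2 (hx.trans ?_))
    refine Finset.card_le_card fun l hl => ?_
    simp only [Finset.mem_filter, Finset.mem_univ, true_and] at hl ⊢
    rw [Function.update_apply] at hl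
    split_ifs at hl
    · omega
    · exact hl

/-! ### Monotonicity of states -/

/-- `s'` may be a later state than `s` of the same party. -/
structure State.Le (s s' : State n V) : Prop where
  view : s.view ≤ s'.view
  request : ∀ j, s.highestRequest j ≤ s'.highestRequest j
  abort : ∀ j, s.highestAbort j ≤ s'.highestAbort j
  doneFrom : ∀ val, s.doneFrom val ⊆ s'.doneFrom val
  doneSent : s.doneSent = true → s'.doneSent = true
  join : s.view = s'.view → ∀ m ∈ s.joinMsgs, m ∈ s'.joinMsgs
  vote : s.view = s'.view → ∀ ph val, s.voteFrom ph val ⊆ s'.voteFrom ph val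
  suggest : s.view = s'.view → ∀ j x, s.suggestFrom j = some x → s'.suggestFrom j = some x
  proof : s.view = s'.view → ∀ j x, s.proofFrom j = some x → s'.proofFrom j = some x
  proposed : s.view = s'.view → s.proposed = true → s'.proposed = true
  proposalSeen : s.view = s'.view → s.proposalSeen = true → s'.proposalSeen = true

theorem State.Le.refl (s : State n V) : s.Le s := by
  constructor <;> simp

/-- The clauses on the fields of a view assume equal views; as views do not decrease, equality at
both ends forces it in the middle. -/
theorem State.Le.trans {s₁ s₂ s₃ : State n V} (h : s₁.Le s₂) (h' : s₂.Le s₃) : s₁.Le s₃ := by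
  have hv := h.view
  have hv' := h'.view
  have hview : s₁.view = s₃.view → s₁.view = s₂.view ∧ s₂.view = s₃.view := fun _ => by omega
  exact {
    view := hv.trans hv'
    request := fun j => (h.request j).trans (h'.request j)
    abort := fun j => (h.abort j).trans (h'.abort j)
    doneFrom := fun val => (h.doneFrom val).trans (h'.doneFrom val)
    doneSent := fun hd => h'.doneSent (h.doneSent hd)
    join := fun e m hm => h'.join (hview e).2 m (h.join (hview e).1 m hm)
    vote := fun e ph val => (h.vote (hview e).1 ph val).trans (h'.vote (hview e).2 ph val)
    suggest := fun e j x hx => h'.suggest (hview e).2 j x (h.suggest (hview e).1 j x hx)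
    proof := fun e j x hx => h'.proof (hview e).2 j x (h.proof (hview e).1 j x hx)
    proposed := fun e hx => h'.proposed (hview e).2 (h.proposed (hview e).1 hx)
    proposalSeen := fun e hx => h'.proposalSeen (hview e).2 (h.proposalSeen (hview e).1 hx) }

theorem le_update_of_lt {a : Fin n → ℕ} {j : Fin n} {v : ℕ} (h : a j < v) (l : Fin n) :
    a l ≤ Function.update a j v l := by
  rw [Function.update_apply]
  split_ifs with hl
  · subst hl; omega
  · rfl

theorem update_eq_some_of_none {α : Type*} {a : Fin n → Option α} {j l : Fin n} {x y : α}
    (h : a j = none) (hx : a l = some x) : Function.update a j (some y) l = some x := by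
  rw [Function.update_of_ne, hx]
  rintro rfl
  simp [h] at hx

theorem subset_update_insert (d : V → Finset (Fin n)) (val val' : V) (j : Fin n) :
    d val' ⊆ Function.update d val (insert j (d val)) val' := by
  rw [Function.update_apply]
  split_ifs with h
  · subst h; exact Finset.subset_insert _ _
  · rfl

theorem addVote_apply (s : State n V) (ph ph' : Phase) (val val' : V) (j : Fin n) :
    addVote s ph val j ph' val' =
      if ph' = ph ∧ val' = val then insert j (s.voteFrom ph val) else s.voteFrom ph' val' := by
  unfold addVote
  by_cases h : ph' = ph
  · subst h
    by_cases h' : val' = val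
    · subst h'; simp
    · simp [h']
  · simp [h]

theorem subset_addVote (s : State n V) (ph ph' : Phase) (val val' : V) (j : Fin n) :
    s.voteFrom ph' val' ⊆ addVote s ph val j ph' val' := by
  rw [addVote_apply]
  split_ifs with h
  · obtain ⟨rfl, rfl⟩ := h; exact Finset.subset_insert _ _
  · rfl

/-- Entering a view strictly raises `view`, so that the clauses on fields reset at that moment hold
vacuously. -/
theorem Act.le {f : ℕ} {Δ now : ℝ} {i j : Fin n} {m : Msg V} {s s' : State n V}
    {o : Outbox n (Msg V)} (h : Act f Δ now i j s m s' o) : s.Le s' := by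
  have hr := State.Le.refl s
  cases h with
  | stale h => exact hr
  | request h => exact { hr with request := le_update_of_lt h }
  | abortStay h ha hw => exact { hr with abort := ha.le h }
  | abortEnter h ha hw =>
    have hlt : s.view < kthLargest (n - f) _ + 1 := Nat.lt_succ_of_le hw
    exact {
      view := hlt.le
      request := hr.request
      abort := ha.le h
      doneFrom := hr.doneFrom
      doneSent := hr.doneSent
      join := fun e => absurd e hlt.ne
      vote := fun e => absurd e hlt.ne
      suggest := fun e => absurd e hlt.ne
      proof := fun e => absurd e hlt.ne
      proposed := fun e => absurd e hlt.ne
      proposalSeen := fun e => absurd e hlt.ne }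
  | done h hd ho =>
    subst hd
    refine { hr with doneFrom := fun val' => subset_update_insert _ _ _ _, doneSent := ?_ }
    rintro hs
    rcases ho with ho | ho
    · exact ho.2.2.1
    · exact ho.2.1.trans hs
  | suggest hi h h₁ hq => exact { hr with suggest := fun _ _ _ => update_eq_some_of_none h }
  | propose hi h h₁ hp hq hpick hmax =>
    exact { hr with
      suggest := fun _ _ _ => update_eq_some_of_none h
      proposed := fun _ _ => rfl
      join := fun _ _ => List.mem_append_left _ }
  | proof h h₁ hq => exact { hr with proof := fun _ _ _ => update_eq_some_of_none h }
  | proofOpen h h₁ hp hq =>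
    exact { hr with
      proof := fun _ _ _ => update_eq_some_of_none h
      join := fun _ _ => List.mem_append_left _ }
  | proposeEcho =>
    exact { hr with
      proposalSeen := fun _ _ => rfl
      join := fun _ _ => List.mem_append_left _ }
  | proposeOpen =>
    exact { hr with
      proposalSeen := fun _ _ => rfl
      join := fun _ _ => List.mem_append_left _ }
  | proposeWait => exact { hr with proposalSeen := fun _ _ => rfl }
  | proposeReject => exact { hr with proposalSeen := fun _ _ => rfl }
  | vote => exact { hr with vote := fun _ _ _ => subset_addVote _ _ _ _ _ _ }
  | quorumEcho =>
    exact { hr with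
      vote := fun _ _ _ => subset_addVote _ _ _ _ _ _
      join := fun _ _ => List.mem_append_left _ }
  | quorumKey1 =>
    exact { hr with
      vote := fun _ _ _ => subset_addVote _ _ _ _ _ _
      join := fun _ _ => List.mem_append_left _ }
  | quorumKey2 =>
    exact { hr with
      vote := fun _ _ _ => subset_addVote _ _ _ _ _ _
      join := fun _ _ => List.mem_append_left _ }
  | quorumKey3 =>
    exact { hr with
      vote := fun _ _ _ => subset_addVote _ _ _ _ _ _
      join := fun _ _ => List.mem_append_left _ }
  | quorumLock =>
    exact { hr with
      vote := fun _ _ _ => subset_addVote _ _ _ _ _ _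
      doneSent := fun _ => rfl }

/-! ### Induction over steps, and the history of messages -/

namespace Run

variable {f : ℕ} {Δ : ℝ} (R : Run n V f Δ)

/-- To prove a property of all states of a nonfaulty party, it is enough to consider its steps. -/
theorem state_induction {i : Fin n} (hi : i ∉ R.faulty) (Inv : ℕ → State n V → Prop)
    (mono : ∀ k s, R.state k i = some s → R.state (k + 1) i = some s → Inv k s → Inv (k + 1) s)
    (start : ∀ k, R.state k i = none → R.sent k i = (enterView Δ (R.clock i (R.time k)) 1 (initState (R.input i))).2 →
      R.state (k + 1) i = some (enterView Δ (R.clock i (R.time k)) 1 (initState (R.input i))).1 →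
      Inv (k + 1) (enterView Δ (R.clock i (R.time k)) 1 (initState (R.input i))).1)
    (recv : ∀ k j m s s' o, R.event k = .recv i j m → R.state k i = some s →
      R.state (k + 1) i = some s' → R.sent k i = o →
      Act f Δ (R.clock i (R.time k)) i j s m s' o → Inv k s → Inv (k + 1) s')
    (timeout : ∀ k s d, R.state k i = some s → s.timer = some d → d ≤ R.clock i (R.time k) →
      R.state (k + 1) i = some { s with timer := none } → R.sent k i = sendAll (.abort s.view) →
      Inv k s → Inv (k + 1) { s with timer := none }) :
    ∀ {k s}, R.state k i = some s → Inv k s := by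
  intro k
  induction k with
  | zero => intro s hs; rw [R.state_zero i hi] at hs; cases hs
  | succ k ih =>
    intro s' hs'
    have h := R.step k i hi
    generalize he : R.event k = e at h
    generalize hs : R.state k i = so at h
    generalize hs'' : R.state (k + 1) i = so' at h
    generalize ho : R.sent k i = o at h
    cases h with
    | start =>
      rw [hs''] at hs'
      cases hs'
      exact start k hs ho hs''
    | recv hd h =>
      rw [hs''] at hs'
      cases hs'
      exact recv k _ _ _ _ _ he hs hs'' ho h (ih hs)
    | timeout hd ht hnow =>
      rw [hs''] at hs'
      cases hs'
      exact timeout k _ _ hs ht hnow hs'' ho (ih hs)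
    | terminated =>
      rw [hs''] at hs'
      cases hs'
      exact mono k _ hs hs'' (ih hs)
    | other =>
      rw [hs''] at hs'
      subst hs'
      exact mono k _ hs hs'' (ih hs)

theorem invariant {i : Fin n} (hi : i ∉ R.faulty) (Inv : ℕ → State n V → Prop)
    (mono : ∀ k s, Inv k s → Inv (k + 1) s)
    (start : ∀ k, R.sent k i = (enterView Δ (R.clock i (R.time k)) 1 (initState (R.input i))).2 →
      R.state (k + 1) i = some (enterView Δ (R.clock i (R.time k)) 1 (initState (R.input i))).1 →
      Inv (k + 1) (enterView Δ (R.clock i (R.time k)) 1 (initState (R.input i))).1)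
    (recv : ∀ k j m s s' o, R.event k = .recv i j m → R.state k i = some s →
      R.state (k + 1) i = some s' → R.sent k i = o →
      Act f Δ (R.clock i (R.time k)) i j s m s' o → Inv k s → Inv (k + 1) s')
    (timeout : ∀ k s d, R.state k i = some s → s.timer = some d → d ≤ R.clock i (R.time k) →
      R.state (k + 1) i = some { s with timer := none } → R.sent k i = sendAll (.abort s.view) →
      Inv k s → Inv (k + 1) { s with timer := none }) :
    ∀ {k s}, R.state k i = some s → Inv k s :=
  R.state_induction hi Inv (fun k s _ _ => mono k s) (fun k _ => start k) recv timeout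

theorem state_succ {i : Fin n} (hi : i ∉ R.faulty) {k : ℕ} {s : State n V}
    (hs : R.state k i = some s) : ∃ s', R.state (k + 1) i = some s' ∧ s.Le s' := by
  have h := R.step k i hi
  rw [hs] at h
  generalize R.event k = e at h
  generalize R.state (k + 1) i = so' at h
  generalize R.sent k i = o at h
  cases h with
  | recv hd h => exact ⟨_, rfl, h.le⟩
  | timeout => exact ⟨_, rfl, { State.Le.refl s with }⟩
  | terminated => exact ⟨_, rfl, .refl s⟩
  | other => exact ⟨_, rfl, .refl s⟩

theorem state_later {i : Fin n} (hi : i ∉ R.faulty) {k k' : ℕ} (hk : k ≤ k') {s : State n V}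
    (hs : R.state k i = some s) : ∃ s', R.state k' i = some s' ∧ s.Le s' := by
  induction hk with
  | refl => exact ⟨s, hs, .refl s⟩
  | step hk ih =>
    obtain ⟨s', hs', hle⟩ := ih
    obtain ⟨s'', hs'', hle'⟩ := R.state_succ hi hs'
    exact ⟨s'', hs'', hle.trans hle'⟩

theorem state_le {i : Fin n} (hi : i ∉ R.faulty) {k k' : ℕ} (hk : k ≤ k') {s s' : State n V}
    (hs : R.state k i = some s) (hs' : R.state k' i = some s') : s.Le s' := by
  obtain ⟨s'', hs'', hle⟩ := R.state_later hi hk hs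
  rw [hs'] at hs''
  cases hs''
  exact hle

/-- Views serve as a clock of the party: what it did in an earlier view, it did at an earlier step.
-/
theorem le_of_view_lt {i : Fin n} (hi : i ∉ R.faulty) {k k' : ℕ} {s s' : State n V}
    (hs : R.state k i = some s) (hs' : R.state k' i = some s') (h : s.view < s'.view) :
    k < k' := by
  by_contra hk
  have := (R.state_le hi (not_lt.1 hk) hs' hs).view
  omega

/-- Before step `k`, party `i` has received `m` from `j`. -/
def Received (k : ℕ) (i j : Fin n) (m : Msg V) : Prop := ∃ k' < k, R.event k' = .recv i j m

/-- Before step `k`, party `i` has sent `m` to `j`. -/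
def Sent (k : ℕ) (i j : Fin n) (m : Msg V) : Prop := ∃ l < k, m ∈ R.sent l i j

/-- Before step `k`, party `i` has sent `m` upon join. -/
def Cast (k : ℕ) (i : Fin n) (m : Msg V) : Prop :=
  ∃ k' ≤ k, ∃ s, R.state k' i = some s ∧ m ∈ s.joinMsgs

variable {R}

theorem Received.mono {k k' : ℕ} {i j : Fin n} {m : Msg V} (h : R.Received k i j m)
    (hk : k ≤ k') : R.Received k' i j m :=
  let ⟨l, hl, h⟩ := h
  ⟨l, hl.trans_le hk, h⟩

theorem Sent.mono {k k' : ℕ} {i j : Fin n} {m : Msg V} (h : R.Sent k i j m)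
    (hk : k ≤ k') : R.Sent k' i j m :=
  let ⟨l, hl, h⟩ := h
  ⟨l, hl.trans_le hk, h⟩

theorem Cast.mono {k k' : ℕ} {i : Fin n} {m : Msg V} (h : R.Cast k i m)
    (hk : k ≤ k') : R.Cast k' i m :=
  let ⟨l, hl, h⟩ := h
  ⟨l, hl.trans hk, h⟩

theorem Received.sent {k : ℕ} {i j : Fin n} {m : Msg V} (hi : i ∉ R.faulty) (hj : j ∉ R.faulty)
    (h : R.Received k i j m) : ∃ k' < k, R.Sent k' j i m := by
  obtain ⟨k', hk', h⟩ := h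
  obtain ⟨l, hl, h⟩ := R.authentic k' i j m hi hj h
  exact ⟨k', hk', l, hl, h⟩

end Run

/-- `m` is a message of view `v` of a kind that is sent upon join. -/
def Msg.InView (v : ℕ) : Msg V → Prop
  | .proof _ w => w = v
  | .propose _ _ w => w = v
  | .vote _ _ w => w = v
  | _ => False

/-- `ph'` is the phase after `ph`. -/
def Phase.Next : Phase → Phase → Prop
  | .echo, .key1 => True
  | .key1, .key2 => True
  | .key2, .key3 => True
  | .key3, .lock => True
  | _, _ => False

namespace Run

variable {f : ℕ} {Δ : ℝ} {R : Run n V f Δ}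

/-! ### Messages sent -/

theorem inView_of_mem {i : Fin n} (hi : i ∉ R.faulty) {k : ℕ} {s : State n V}
    (hs : R.state k i = some s) : ∀ m ∈ s.joinMsgs, m.InView s.view := by
  refine R.invariant hi (fun _ s => ∀ m ∈ s.joinMsgs, m.InView s.view) (fun _ _ h => h) ?_ ?_ ?_ hs
  · intro k _ _ m hm
    cases List.mem_singleton.1 hm
    rfl
  · intro k j m s s' o _ _ _ _ h ih
    cases h
    case abortEnter =>
      intro m hm
      cases List.mem_singleton.1 hm
      rfl
    all_goals first
      | exact ih
      | exact List.forall_mem_append.2 ⟨ih, List.forall_mem_singleton.2 rfl⟩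
  · intro k s d _ _ _ _ _ ih
    exact ih

theorem mem_enterView {now : ℝ} {v : ℕ} {s : State n V} {j : Fin n} {m : Msg V}
    (h : m ∈ (enterView Δ now v s).2 j) : m = .request v ∨
      (m = suggestMsg (enterView Δ now v s).1 ∧ s.highestRequest j = v ∧ IsPrimary j v) ∨
      (m = .proof s.key1 v ∧ s.highestRequest j = v) := by
  simp only [enterView, sendAllUponJoin, List.mem_cons, List.mem_append] at h ⊢
  rcases h with h | h | h
  · exact .inl h
  · split_ifs at h with hc
    · exact .inr (.inl ⟨List.mem_singleton.1 h, hc⟩)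
    · cases h
  · split_ifs at h with hc
    · exact .inr (.inr ⟨List.mem_singleton.1 h, hc⟩)
    · cases h

theorem mem_sendJoined {s : State n V} {j : Fin n} {m m' : Msg V} (h : m ∈ sendJoined s m' j) :
    m = m' ∧ s.highestRequest j = s.view := by
  unfold sendJoined at h
  split_ifs at h with hc
  · exact ⟨List.mem_singleton.1 h, hc⟩
  · cases h

/-- The reasons for sending `m` to `j` in step `k`. -/
inductive SentBy (R : Run n V f Δ) (k : ℕ) (i j : Fin n) : Msg V → Prop
  | request {s : State n V} (hs : R.state (k + 1) i = some s) : SentBy R k i j (.request s.view)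
  | suggest {s : State n V} (hs : R.state (k + 1) i = some s)
      (hj : s.highestRequest j = s.view) : SentBy R k i j (suggestMsg s)
  | join {s : State n V} {m : Msg V} (hs : R.state (k + 1) i = some s)
      (hj : s.highestRequest j = s.view) (hm : m ∈ s.joinMsgs) : SentBy R k i j m
  | timeout {s : State n V} {d : ℝ} (hs : R.state k i = some s) (hd : s.timer = some d)
      (hnow : d ≤ R.clock i (R.time k)) (ho : R.sent k i = sendAll (.abort s.view)) :
      SentBy R k i j (.abort s.view)
  | abort {s : State n V} {l : Fin n} {v u : ℕ} (hs : R.state k i = some s)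
      (he : R.event k = .recv i l (.abort v))
      (hu : f + 1 ≤ (Finset.univ.filter fun p => u ≤ Function.update s.highestAbort l v p).card)
      (ho : ∀ p, .abort u ∈ R.sent k i p) : SentBy R k i j (.abort u)
  | lock {s : State n V} {val : V} (hs : R.state (k + 1) i = some s)
      (hc : n - f ≤ (s.voteFrom .lock val).card) (ho : ∀ p, .done val ∈ R.sent k i p) :
      SentBy R k i j (.done val)
  | done {s : State n V} {val : V} (hs : R.state (k + 1) i = some s)
      (hc : f + 1 ≤ (s.doneFrom val).card) (ho : ∀ p, .done val ∈ R.sent k i p) :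
      SentBy R k i j (.done val)

theorem SentBy.of_enterView {i : Fin n} {k : ℕ} {now : ℝ} {v : ℕ} {s : State n V}
    (hs : R.state (k + 1) i = some (enterView Δ now v s).1) {j : Fin n} {m : Msg V}
    (h : m ∈ (enterView Δ now v s).2 j) : R.SentBy k i j m := by
  rcases mem_enterView h with rfl | ⟨rfl, hj, -⟩ | ⟨rfl, hj⟩
  · exact .request hs
  · exact .suggest hs hj
  · exact .join hs hj (List.mem_singleton.2 rfl)

/-- The provenance of messages: whatever a nonfaulty party sends can be read off from its state
after the step or, for aborts, before it. -/
theorem sentBy_of_mem {i : Fin n} (hi : i ∉ R.faulty) {k : ℕ} {j : Fin n} {m : Msg V}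
    (hm : m ∈ R.sent k i j) : R.SentBy k i j m := by
  have h := R.step k i hi
  generalize he : R.event k = e at h
  generalize hs : R.state k i = so at h
  generalize hs' : R.state (k + 1) i = so' at h
  generalize ho : R.sent k i = o at h hm
  have hf := R.hf
  cases h with
  | start => exact .of_enterView hs' hm
  | timeout hd ht hnow =>
    cases List.mem_singleton.1 hm
    exact .timeout hs ht hnow ho
  | terminated => cases hm
  | other => cases hm
  | recv hd h =>
    cases h with
    | request h =>
      dsimp only at hm
      split at hm
      · next hc =>
        obtain ⟨rfl, rfl⟩ := hc
        rcases List.mem_append.1 hm with hm | hm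
        · split at hm
          · cases List.mem_singleton.1 hm
            have := SentBy.suggest (j := j) hs' (Function.update_self ..)
            exact this
          · cases hm
        · exact .join hs' (Function.update_self ..) hm
      · cases hm
    | abortStay h ha hw =>
      cases ha with
      | keep => cases hm
      | raise u hu h =>
        cases List.mem_singleton.1 hm
        exact .abort hs he ((le_kthLargest_iff (by omega) (by omega) _ _).1 hu.le)
          (fun p => by rw [ho]; exact List.mem_singleton.2 rfl)
    | abortEnter h ha hw =>
      rcases List.mem_append.1 hm with hm' | hm'
      · clear hm
        cases ha with
        | keep => cases hm'
        | raise u hu h =>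
          cases List.mem_singleton.1 hm'
          exact .abort hs he ((le_kthLargest_iff (by omega) (by omega) _ _).1 hu.le)
            (fun p => by rw [ho]; exact List.mem_append_left _ (List.mem_singleton.2 rfl))
      · exact .of_enterView hs' hm'
    | done h hd' ho' =>
      rcases ho' with ⟨hc, -, -, rfl⟩ | ⟨-, -, rfl⟩
      · cases List.mem_singleton.1 hm
        refine .done hs' ?_ (fun p => by rw [ho]; exact List.mem_singleton.2 rfl)
        simp [hc]
      · cases hm
    | quorumLock h hc ho' =>
      rcases ho' with ⟨-, rfl⟩ | ⟨-, rfl⟩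
      · cases List.mem_singleton.1 hm
        refine .lock hs' ?_ (fun p => by rw [ho]; exact List.mem_singleton.2 rfl)
        simp [addVote_apply, hc]
      · cases hm
    | _ => first
      | cases hm
      | (obtain ⟨rfl, hj⟩ := mem_sendJoined hm
         exact .join hs' hj (List.mem_append_right _ (List.mem_singleton.2 rfl)))

theorem join_of_sent {i : Fin n} (hi : i ∉ R.faulty) {k : ℕ} {j : Fin n} {m : Msg V} {v : ℕ}
    (hm : m ∈ R.sent k i j) (hv : m.InView v) : ∃ s, R.state (k + 1) i = some s ∧
      s.view = v ∧ s.highestRequest j = v ∧ m ∈ s.joinMsgs := by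
  cases sentBy_of_mem hi hm with
  | join hs hj hm =>
    have := inView_of_mem hi hs _ hm
    obtain rfl : v = _ := by
      cases m <;> first | exact hv.elim | exact hv.symm.trans this
    exact ⟨_, hs, rfl, hj, hm⟩
  | _ => exact hv.elim

theorem suggest_of_sent {i : Fin n} (hi : i ∉ R.faulty) {k : ℕ} {j : Fin n} {k3 : ℤ} {v3 : V}
    {r : KeyRecord V} {v : ℕ} (hm : .suggest k3 v3 r v ∈ R.sent k i j) :
    ∃ s, R.state (k + 1) i = some s ∧ s.view = v ∧ s.highestRequest j = v ∧
      s.key3 = k3 ∧ s.key3Val = v3 ∧ s.key2 = r := by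
  generalize h : Msg.suggest k3 v3 r v = m at hm
  cases sentBy_of_mem hi hm with
  | join hs hj hm => subst h; exact (inView_of_mem hi hs _ hm).elim
  | suggest hs hj =>
    cases h
    exact ⟨_, hs, rfl, hj, rfl, rfl, rfl⟩
  | _ => cases h

theorem request_of_sent {i : Fin n} (hi : i ∉ R.faulty) {k : ℕ} {j : Fin n} {v : ℕ}
    (hm : .request v ∈ R.sent k i j) : ∃ s, R.state (k + 1) i = some s ∧ s.view = v := by
  generalize h : Msg.request v = m at hm
  cases sentBy_of_mem hi hm with
  | join hs hj hm => subst h; exact (inView_of_mem hi hs _ hm).elim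
  | request hs => cases h; exact ⟨_, hs, rfl⟩
  | _ => cases h

/-- By authenticity the message was on the sender's list strictly before step `k`; this strictness
drives the inductions over steps below. -/
theorem cast_of_received {i j : Fin n} (hi : i ∉ R.faulty) (hj : j ∉ R.faulty) {k : ℕ}
    {m : Msg V} {v : ℕ} (hm : R.Received k i j m) (hv : m.InView v) :
    ∃ k' < k, R.Cast k' j m := by
  obtain ⟨k', hk', l, hl, h⟩ := hm.sent hi hj
  obtain ⟨s, hs, -, -, h⟩ := join_of_sent hj h hv
  exact ⟨k', hk', l + 1, hl, s, hs, h⟩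

theorem cast_mem {i : Fin n} (hi : i ∉ R.faulty) {k k' : ℕ} {m : Msg V} {s : State n V}
    (h : R.Cast k' i m) (hk : k' ≤ k) (hs : R.state k i = some s) (hv : m.InView s.view) :
    m ∈ s.joinMsgs := by
  obtain ⟨l, hl, s', hs', hm⟩ := h
  refine (R.state_le hi (hl.trans hk) hs' hs).join ?_ m hm
  have := inView_of_mem hi hs' _ hm
  cases m <;> first | exact hv.elim | exact this.symm.trans hv

/-- Two messages sent upon join in the same view appear together in some later state. -/
theorem cast_common {i : Fin n} (hi : i ∉ R.faulty) {k k' : ℕ} {m m' : Msg V} {v : ℕ}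
    (h : R.Cast k i m) (h' : R.Cast k' i m') (hv : m.InView v) (hv' : m'.InView v) :
    ∃ l ≤ max k k', ∃ s, R.state l i = some s ∧ s.view = v ∧ m ∈ s.joinMsgs ∧ m' ∈ s.joinMsgs := by
  have key : ∀ {m : Msg V} {v w : ℕ}, m.InView v → m.InView w → v = w := by
    intro m v w h h'
    cases m <;> first | exact h.elim | exact h.symm.trans h'
  obtain ⟨l, hl, s, hs, hm⟩ := h
  obtain ⟨l', hl', s', hs', hm'⟩ := h'
  have e := key (inView_of_mem hi hs _ hm) hv
  have e' := key (inView_of_mem hi hs' _ hm') hv'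
  rcases le_total l l' with hll | hll
  · exact ⟨l', by omega, s', hs', e', (R.state_le hi hll hs hs').join (by omega) _ hm, hm'⟩
  · exact ⟨l, by omega, s, hs, e, hm, (R.state_le hi hll hs' hs).join (by omega) _ hm'⟩

/-! ### Votes -/

theorem received_of_mem_voteFrom {i : Fin n} (hi : i ∉ R.faulty) {k : ℕ} {s : State n V}
    (hs : R.state k i = some s) : ∀ j ph val, j ∈ s.voteFrom ph val →
      R.Received k i j (.vote ph val s.view) := by
  refine R.invariant hi (fun k s => ∀ j ph val, j ∈ s.voteFrom ph val →
    R.Received k i j (.vote ph val s.view)) ?_ ?_ ?_ ?_ hs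
  · exact fun k s h j ph val hj => (h j ph val hj).mono k.le_succ
  · intro k _ _ j ph val hj
    cases hj
  · intro k j m s s' o he _ _ _ h ih
    have ih' := fun j ph val hj => (ih j ph val hj).mono k.le_succ
    have hadd : ∀ ph val, R.event k = .recv i j (.vote ph val s.view) →
        ∀ j' ph' val', j' ∈ addVote s ph val j ph' val' →
          R.Received (k + 1) i j' (.vote ph' val' s.view) := by
      intro ph val he j' ph' val' hj'
      rw [addVote_apply] at hj'
      split_ifs at hj' with hc
      · obtain ⟨rfl, rfl⟩ := hc
        rcases Finset.mem_insert.1 hj' with rfl | hj'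
        · exact ⟨k, k.lt_succ_self, he⟩
        · exact ih' _ _ _ hj'
      · exact ih' _ _ _ hj'
    cases h
    case abortEnter => intro j ph val hj; cases hj
    all_goals first
      | exact ih'
      | exact hadd _ _ he
  · exact fun k s d _ _ _ _ _ h j ph val hj => (h j ph val hj).mono k.le_succ

theorem mem_append_vote {L : List (Msg V)} {ph ph' : Phase} {val val' : V} {v v' : ℕ} :
    .vote ph val v ∈ L ++ [.vote ph' val' v'] ↔
      .vote ph val v ∈ L ∨ (ph = ph' ∧ val = val' ∧ v = v') := by
  simp

/-- Senders are counted one at a time, so the code's test for equality with `n - f` catches every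
passage of the threshold, and list and counters are reset together. The forward direction serves
safety, the backward one liveness. -/
theorem vote_mem_iff {i : Fin n} (hi : i ∉ R.faulty) {k : ℕ} {s : State n V}
    (hs : R.state k i = some s) : ∀ (ph ph' : Phase) (val : V), ph.Next ph' →
      ((.vote ph' val s.view : Msg V) ∈ s.joinMsgs ↔ n - f ≤ (s.voteFrom ph val).card) := by
  have hf := R.hf
  refine R.invariant hi (fun _ s => ∀ (ph ph' : Phase) (val : V), ph.Next ph' →
      ((.vote ph' val s.view : Msg V) ∈ s.joinMsgs ↔ n - f ≤ (s.voteFrom ph val).card))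
      (fun _ _ h => h) ?_ ?_ ?_ hs
  · intro k _ _ ph ph' val _
    simp only [enterView, sendAllUponJoin]
    simp
    omega
  · intro k j m s s' o _ _ _ _ h ih
    have hq : ∀ p p' val₀, p.Next p' → j ∉ s.voteFrom p val₀ →
        (insert j (s.voteFrom p val₀)).card = n - f → ∀ (ph ph' : Phase) (val : V), ph.Next ph' →
        ((.vote ph' val s.view : Msg V) ∈ s.joinMsgs ++ [.vote p' val₀ s.view] ↔
          n - f ≤ (addVote s p val₀ j ph val).card) := by
      intro p p' val₀ hp hj hc ph ph' val hn
      rw [mem_append_vote, ih _ _ _ hn, addVote_apply]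
      -- A phase and its successor determine each other.
      have : ph = p ↔ ph' = p' := by
        revert hp hn
        cases ph <;> cases ph' <;> cases p <;> cases p' <;> simp [Phase.Next]
      split_ifs with h
      · obtain ⟨h1, rfl⟩ := h
        simp [this.1 h1, hc]
      · rw [this] at h
        tauto
    have hv : ∀ p val₀, j ∉ s.voteFrom p val₀ →
        ((insert j (s.voteFrom p val₀)).card ≠ n - f ∨ p = .lock) → ∀ (ph ph' : Phase) (val : V), ph.Next ph' →
        ((.vote ph' val s.view : Msg V) ∈ s.joinMsgs ↔ n - f ≤ (addVote s p val₀ j ph val).card) := by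
      intro p val₀ hj hc ph ph' val hn
      rw [ih _ _ _ hn, addVote_apply]
      split_ifs with h
      · obtain ⟨rfl, rfl⟩ := h
        rcases hc with hc | rfl
        · rw [Finset.card_insert_of_notMem hj] at hc ⊢
          omega
        · cases ph' <;> exact hn.elim
      · rfl
    have he : ∀ val₀ ph ph' val, ph.Next ph' →
        ((.vote ph' val s.view : Msg V) ∈ s.joinMsgs ++ [.vote .echo val₀ s.view] ↔
          n - f ≤ (s.voteFrom ph val).card) := by
      intro val₀ ph ph' val hn
      rw [mem_append_vote, ih _ _ _ hn]
      have : ph' ≠ .echo := by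
        rintro rfl
        cases ph <;> exact hn.elim
      tauto
    cases h with
    | abortEnter =>
      intro ph ph' val _
      simp only [enterView, sendAllUponJoin]
      simp
      omega
    | propose => intro ph ph' val hn; simpa using ih ph ph' val hn
    | vote h hc => exact hv _ _ h (.inl hc)
    | quorumLock h hc _ => exact hv _ _ h (.inr rfl)
    | quorumEcho h hc => exact hq _ _ _ trivial h hc
    | quorumKey1 h hc => exact hq _ _ _ trivial h hc
    | quorumKey2 h hc => exact hq _ _ _ trivial h hc
    | quorumKey3 h hc => exact hq _ _ _ trivial h hc
    | _ => first
      | exact ih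
      | exact he _
  · intro k s d _ _ _ _ _ h
    exact h

/-- Before step `k`, at least `n - f` parties, apart from faulty ones, have voted for `val`. -/
def Quorum (R : Run n V f Δ) (k : ℕ) (ph : Phase) (val : V) (v : ℕ) : Prop :=
  ∃ S : Finset (Fin n), n - f ≤ S.card ∧
    ∀ j ∈ S, j ∉ R.faulty → ∃ k' < k, R.Cast k' j (.vote ph val v)

theorem Quorum.mono {k k' : ℕ} {ph : Phase} {val : V} {v : ℕ} (h : R.Quorum k ph val v)
    (hk : k ≤ k') : R.Quorum k' ph val v := by
  obtain ⟨S, hS, h⟩ := h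
  refine ⟨S, hS, fun j hj hjf => ?_⟩
  obtain ⟨l, hl, h⟩ := h j hj hjf
  exact ⟨l, by omega, h⟩

/-- Some party outside a set of at most `n - f - 1` parties is part of a quorum. -/
theorem Quorum.exists_mem {k : ℕ} {ph : Phase} {val : V} {v : ℕ} (h : R.Quorum k ph val v)
    {H : Finset (Fin n)} (hH : f + 1 ≤ H.card) (hH' : ∀ j ∈ H, j ∉ R.faulty) :
    ∃ j ∈ H, ∃ k' < k, R.Cast k' j (.vote ph val v) := by
  obtain ⟨S, hS, h⟩ := h
  -- Here `(n - f) + (f + 1)` exceeds `n`.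
  have hne : (S ∩ H).Nonempty := by
    rw [← Finset.card_pos]
    have h1 := Finset.card_union_add_card_inter S H
    have h2 : (S ∪ H).card ≤ n := (Finset.card_le_univ _).trans_eq (Fintype.card_fin n)
    omega
  obtain ⟨j, hj⟩ := hne
  rw [Finset.mem_inter] at hj
  exact ⟨j, hj.2, h j hj.1 (hH' j hj.2)⟩

theorem card_sdiff_faulty (R : Run n V f Δ) {S : Finset (Fin n)} (hS : n - f ≤ S.card) :
    f + 1 ≤ (S \ R.faulty).card := by
  have h1 := Finset.le_card_sdiff R.faulty S
  have h2 := R.card_faulty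
  have h3 := R.hf
  omega

theorem exists_mem_not_faulty (R : Run n V f Δ) {S : Finset (Fin n)} (hS : f + 1 ≤ S.card) :
    ∃ j ∈ S, j ∉ R.faulty := by
  by_contra! h
  have := Finset.card_le_card (show S ⊆ R.faulty from h)
  have := R.card_faulty
  omega

theorem card_compl_faulty (R : Run n V f Δ) : n - f ≤ R.faultyᶜ.card := by
  rw [Finset.card_compl, Fintype.card_fin]
  have := R.card_faulty
  omega

theorem Quorum.exists_voters {k : ℕ} {ph : Phase} {val : V} {v : ℕ} (h : R.Quorum k ph val v) :
    ∃ H : Finset (Fin n), f + 1 ≤ H.card ∧ ∀ j ∈ H, j ∉ R.faulty ∧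
      ∃ k' < k, R.Cast k' j (.vote ph val v) := by
  obtain ⟨S, hS, h⟩ := h
  refine ⟨S \ R.faulty, R.card_sdiff_faulty hS, fun j hj => ?_⟩
  rw [Finset.mem_sdiff] at hj
  exact ⟨hj.2, h j hj.1 hj.2⟩

theorem Quorum.exists_voter {k : ℕ} {ph : Phase} {val : V} {v : ℕ} (h : R.Quorum k ph val v) :
    ∃ j, j ∉ R.faulty ∧ ∃ k' < k, R.Cast k' j (.vote ph val v) := by
  obtain ⟨H, hH, h⟩ := h.exists_voters
  obtain ⟨j, hj⟩ := Finset.card_pos.1 (by omega : 0 < H.card)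
  exact ⟨j, h j hj⟩

theorem quorum_of_voteFrom {i : Fin n} (hi : i ∉ R.faulty) {k : ℕ} {s : State n V}
    (hs : R.state k i = some s) {ph : Phase} {val : V}
    (h : n - f ≤ (s.voteFrom ph val).card) : R.Quorum k ph val s.view := by
  refine ⟨_, h, fun j hj hjf => ?_⟩
  exact cast_of_received hi hjf (received_of_mem_voteFrom hi hs j ph val hj) rfl

theorem quorum_of_cast {i : Fin n} (hi : i ∉ R.faulty) {k : ℕ} {ph ph' : Phase} {val : V} {v : ℕ}
    (h : R.Cast k i (.vote ph' val v)) (hn : ph.Next ph') : R.Quorum k ph val v := by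
  obtain ⟨l, hl, s, hs, hm⟩ := h
  obtain rfl : v = s.view := inView_of_mem hi hs _ hm
  exact (quorum_of_voteFrom hi hs ((vote_mem_iff hi hs _ _ _ hn).1 hm)).mono hl

/-- A quorum contains a nonfaulty voter, and this voter had a quorum of the phase before. -/
theorem Quorum.of_next {k : ℕ} {ph ph' : Phase} {val : V} {v : ℕ} (h : R.Quorum k ph' val v)
    (hn : ph.Next ph') : R.Quorum k ph val v := by
  obtain ⟨j, hj, l, hl, h⟩ := h.exists_voter
  exact (quorum_of_cast hj h hn).mono hl.le

theorem Quorum.echo {k : ℕ} {ph : Phase} {val : V} {v : ℕ} (h : R.Quorum k ph val v) :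
    R.Quorum k .echo val v := by
  have h1 : R.Quorum k .key1 val v → R.Quorum k .echo val v := fun h => h.of_next trivial
  have h2 : R.Quorum k .key2 val v → R.Quorum k .echo val v := fun h => h1 (h.of_next trivial)
  have h3 : R.Quorum k .key3 val v → R.Quorum k .echo val v := fun h => h2 (h.of_next trivial)
  cases ph
  · exact h
  · exact h1 h
  · exact h2 h
  · exact h3 h
  · exact h3 (h.of_next trivial)

end Run

theorem proofs_eq_some {s : State n V} {j : Fin n} {r : KeyRecord V} :
    proofs s j = some r ↔ s.proofFrom j = some r ∧ r.prev < r.key ∧ r.key < s.view := by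
  unfold proofs
  cases s.proofFrom j with
  | none => simp
  | some r' =>
    simp only [Option.some.injEq, ite_eq_iff]
    constructor
    · rintro (⟨h, rfl⟩ | ⟨_, h⟩)
      · exact ⟨rfl, h⟩
      · cases h
    · rintro ⟨rfl, h⟩
      exact .inl ⟨h, rfl⟩

namespace Run

variable {f : ℕ} {Δ : ℝ} {R : Run n V f Δ}

/-! ### Echoes -/

/-- In view `v`, before step `k`, party `i` has processed the proposal `(key, val)` of the primary
while holding the lock `(l, lv)`. -/
def Considered (R : Run n V f Δ) (k : ℕ) (i : Fin n) (v : ℕ) (key : ℤ) (val : V) (l : ℤ)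
    (lv : V) : Prop :=
  ∃ k' < k, ∃ s p, R.state k' i = some s ∧ s.view = v ∧ s.lock = l ∧ s.lockVal = lv ∧
    IsPrimary p v ∧ R.Received k i p (.propose key val v)

/-- Before step `k`, party `i` has received proofs in view `v` that open the lock `(l, lv)`. -/
def Opened (R : Run n V f Δ) (k : ℕ) (i : Fin n) (v : ℕ) (l : ℤ) (lv : V) : Prop :=
  ∃ S : Finset (Fin n), f + 1 ≤ S.card ∧ ∀ j ∈ S, ∃ r, R.Received k i j (.proof r v) ∧
    (l ≤ r.prev ∨ (l ≤ r.key ∧ r.val ≠ lv))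

theorem Considered.mono {k k' : ℕ} {i : Fin n} {v : ℕ} {key : ℤ} {val : V} {l : ℤ} {lv : V}
    (h : R.Considered k i v key val l lv) (hk : k ≤ k') : R.Considered k' i v key val l lv := by
  obtain ⟨l, hl, s, p, h1, h2, h3, h4, h5, h6⟩ := h
  exact ⟨l, by omega, s, p, h1, h2, h3, h4, h5, h6.mono hk⟩

theorem Opened.mono {k k' : ℕ} {i : Fin n} {v : ℕ} {l : ℤ} {lv : V}
    (h : R.Opened k i v l lv) (hk : k ≤ k') : R.Opened k' i v l lv := by
  obtain ⟨S, hS, h⟩ := h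
  refine ⟨S, hS, fun j hj => ?_⟩
  obtain ⟨r, hr, h⟩ := h j hj
  exact ⟨r, hr.mono hk, h⟩

/-- What the echoes and the pending proposal in a state of a nonfaulty party tell. -/
structure EchoInv (R : Run n V f Δ) (i : Fin n) (k : ℕ) (s : State n V) : Prop where
  received : ∀ j r, s.proofFrom j = some r → R.Received k i j (.proof r s.view)
  seen : ∀ val, .vote .echo val s.view ∈ s.joinMsgs → s.proposalSeen = true ∧ s.pending = none
  unique : ∀ val val', .vote .echo val s.view ∈ s.joinMsgs → .vote .echo val' s.view ∈ s.joinMsgs →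
    val = val'
  reason : ∀ val, .vote .echo val s.view ∈ s.joinMsgs → ∃ key l lv,
    R.Considered k i s.view key val l lv ∧ (l = 0 ∨ val = lv ∨ R.Opened k i s.view l lv)
  waiting : ∀ val l lv, s.pending = some (val, l, lv) →
    s.proposalSeen = true ∧ ¬ openLock f l lv (proofs s) ∧ ∃ key,
      R.Considered k i s.view key val l lv ∧ l ≠ 0 ∧ val ≠ lv ∧ l ≤ key ∧ key < s.view
  answered : s.proposalSeen = true → (∃ val, .vote .echo val s.view ∈ s.joinMsgs) ∨
    (∃ val l lv, s.pending = some (val, l, lv)) ∨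
    ∃ key val l lv, R.Considered k i s.view key val l lv ∧ l ≠ 0 ∧ val ≠ lv ∧
      ¬ (l ≤ key ∧ key < s.view)

theorem EchoInv.frame {i : Fin n} {k k' : ℕ} {s s' : State n V} (h : R.EchoInv i k s)
    (hk : k ≤ k') (hv : s'.view = s.view) (hs : s'.proposalSeen = s.proposalSeen)
    (hp : s'.pending = s.pending) (hf : s'.proofFrom = s.proofFrom)
    (hj : ∀ val, .vote .echo val s.view ∈ s'.joinMsgs ↔ .vote .echo val s.view ∈ s.joinMsgs) :
    R.EchoInv i k' s' := by
  have hpr : proofs s' = proofs s := by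
    funext j
    simp only [proofs, hf, hv]
  constructor
  · rw [hf, hv]
    exact fun j r hr => (h.received j r hr).mono hk
  · simp only [hv, hs, hp, hj]
    exact h.seen
  · simp only [hv, hj]
    exact h.unique
  · simp only [hv, hj]
    intro val hval
    obtain ⟨key, l, lv, h1, h2⟩ := h.reason val hval
    exact ⟨key, l, lv, h1.mono hk, h2.imp_right fun h2 => h2.imp_right fun h2 => h2.mono hk⟩
  · simp only [hv, hs, hp, hpr]
    intro val l lv hpend
    obtain ⟨h1, h2, key, h3, h4⟩ := h.waiting val l lv hpend
    exact ⟨h1, h2, key, h3.mono hk, h4⟩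
  · simp only [hv, hs, hp, hj]
    intro hseen
    refine (h.answered hseen).imp_right fun h => h.imp_right fun h => ?_
    obtain ⟨key, val, l, lv, h1, h2⟩ := h
    exact ⟨key, val, l, lv, h1.mono hk, h2⟩

theorem opened_of_openLock {i : Fin n} {k : ℕ} {s : State n V}
    (hr : ∀ j r, s.proofFrom j = some r → R.Received k i j (.proof r s.view)) {l : ℤ} {lv : V}
    (h : openLock f l lv (proofs s)) : R.Opened k i s.view l lv := by
  refine ⟨_, h, fun j hj => ?_⟩
  obtain ⟨r, hr', h⟩ := (Finset.mem_filter.1 hj).2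
  exact ⟨r, hr j r (proofs_eq_some.1 hr').1, h⟩

theorem EchoInv.of_enterView {i : Fin n} {k : ℕ} {now : ℝ} {v : ℕ} {s : State n V} :
    R.EchoInv i k (enterView Δ now v s).1 := by
  constructor <;> simp [enterView, sendAllUponJoin]

theorem EchoInv.of_echo {i : Fin n} {k' : ℕ} {s s' : State n V} {val : V}
    (hv : s'.view = s.view) (hs : s'.proposalSeen = true)
    (hp : s'.pending = none) (hj : s'.joinMsgs = s.joinMsgs ++ [.vote .echo val s.view])
    (hnew : ∀ val, .vote .echo val s.view ∉ s.joinMsgs)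
    (hr : ∀ j r, s'.proofFrom j = some r → R.Received k' i j (.proof r s.view))
    {key l : ℤ} {lv : V} (hcon : R.Considered k' i s.view key val l lv)
    (hc : l = 0 ∨ val = lv ∨ R.Opened k' i s.view l lv) :
    R.EchoInv i k' s' := by
  have hj' : ∀ val', .vote .echo val' s.view ∈ s'.joinMsgs ↔ val' = val := by
    intro val'
    simp [hj, hnew]
  constructor
  · rwa [hv]
  · exact fun _ _ => ⟨hs, hp⟩
  · simp only [hv, hj']
    rintro _ _ rfl rfl
    rfl
  · simp only [hv, hj']
    rintro _ rfl
    exact ⟨key, l, lv, hcon, hc⟩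
  · simp [hp]
  · intro _
    exact .inl ⟨val, by simp only [hv, hj']⟩

/-- The first proposal sets `proposalSeen`, after which there is an echo, a pending proposal or a
rejection, and only a pending proposal can still become an echo. The lock recorded is the one held
when the proposal was processed. Safety uses `unique` and `reason`, liveness `waiting` and
`answered`. -/
theorem echoInv {i : Fin n} (hi : i ∉ R.faulty) {k : ℕ} {s : State n V}
    (hs : R.state k i = some s) : R.EchoInv i k s := by
  refine R.invariant hi (R.EchoInv i) ?_ ?_ ?_ ?_ hs
  · exact fun k s h => h.frame k.le_succ rfl rfl rfl rfl fun _ => Iff.rfl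
  · exact fun _ _ _ => .of_enterView
  · intro k j m s s' o he hs hs' _ h ih
    have hrec : ∀ r, R.event k = .recv i j (.proof r s.view) → ∀ j' r',
        Function.update s.proofFrom j (some r) j' = some r' →
        R.Received (k + 1) i j' (.proof r' s.view) := by
      intro r he j' r' h
      rw [Function.update_apply] at h
      split_ifs at h with hj
      · cases h
        subst hj
        exact ⟨k, k.lt_succ_self, he⟩
      · exact (ih.received j' r' h).mono k.le_succ
    have hrec' := fun j r h => (ih.received j r h).mono k.le_succ
    have hcon : ∀ key val, IsPrimary j s.view → R.event k = .recv i j (.propose key val s.view) →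
        R.Considered (k + 1) i s.view key val s.lock s.lockVal := fun key val hj he =>
      ⟨k, k.lt_succ_self, s, j, hs, rfl, rfl, rfl, hj, k, k.lt_succ_self, he⟩
    have hnew : s.proposalSeen = false → ∀ val, .vote .echo val s.view ∉ s.joinMsgs := by
      intro h val hm
      exact Bool.false_ne_true (h.symm.trans (ih.seen val hm).1)
    cases h with
    | abortEnter => exact .of_enterView
    | @proof r s₁ h h₁ hq =>
      constructor
      · exact hrec r he
      · exact ih.seen
      · exact ih.unique
      · intro val hval
        obtain ⟨key, l, lv, h1, h2⟩ := ih.reason val hval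
        exact ⟨key, l, lv, h1.mono k.le_succ,
          h2.imp_right fun h2 => h2.imp_right fun h2 => h2.mono k.le_succ⟩
      · intro val l lv hp
        obtain ⟨h1, h2, key, h3, h4⟩ := ih.waiting val l lv hp
        exact ⟨h1, h₁ ▸ hq val l lv hp, key, h3.mono k.le_succ, h4⟩
      · intro hseen
        refine (ih.answered hseen).imp_right fun h => h.imp_right fun h => ?_
        obtain ⟨key, val, l, lv, h1, h2⟩ := h
        exact ⟨key, val, l, lv, h1.mono k.le_succ, h2⟩
    | @proofOpen r s₁ val l lv h h₁ hp hq =>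
      obtain ⟨h1, h2, key, h3, h4⟩ := ih.waiting val l lv hp
      subst h₁
      refine EchoInv.of_echo (s := s) rfl h1 rfl rfl ?_ (hrec r he) (h3.mono k.le_succ)
        (.inr (.inr (opened_of_openLock (s := { s with
          proofFrom := Function.update s.proofFrom j (some r) }) (hrec r he) hq)))
      intro val hm
      exact Option.some_ne_none _ (hp.symm.trans (ih.seen val hm).2)
    | proposeEcho hj h hl =>
      have hp : s.pending = none := by
        rcases hp : s.pending with _ | ⟨val, l, lv⟩
        · rfl
        · exact absurd (h.symm.trans (ih.waiting val l lv hp).1) Bool.false_ne_true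
      exact EchoInv.of_echo (s := s) rfl rfl hp rfl (hnew h) hrec' (hcon _ _ hj he)
        (hl.imp_right fun h => .inl h)
    | proposeOpen hj h hl hv hk hk' hq =>
      exact EchoInv.of_echo (s := s) rfl rfl rfl rfl (hnew h) hrec' (hcon _ _ hj he)
        (.inr (.inr (opened_of_openLock hrec' hq)))
    | proposeWait hj h hl hv hk hk' hq =>
      constructor
      · exact hrec'
      · exact fun val hm => absurd hm (hnew h val)
      · exact ih.unique
      · exact fun val hm => absurd hm (hnew h val)
      · intro val' l lv hp
        cases hp
        exact ⟨rfl, hq, _, hcon _ _ hj he, hl, hv, hk, hk'⟩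
      · exact fun _ => .inr (.inl ⟨_, _, _, rfl⟩)
    | proposeReject hj h hl hv hk =>
      constructor
      · exact hrec'
      · exact fun val hm => absurd hm (hnew h val)
      · exact ih.unique
      · exact fun val hm => absurd hm (hnew h val)
      · intro val' l lv hp
        obtain ⟨h1, h2, key, h3, h4⟩ := ih.waiting _ _ _ hp
        simp [h] at h1
      · exact fun _ => .inr (.inr ⟨_, _, _, _, hcon _ _ hj he, hl, hv, hk⟩)
    | _ => exact ih.frame k.le_succ rfl rfl rfl rfl (by simp)
  · exact fun k s _ _ _ _ _ _ h => h.frame k.le_succ rfl rfl rfl rfl fun _ => Iff.rfl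

theorem echo_unique {i : Fin n} (hi : i ∉ R.faulty) {k k' : ℕ} {val val' : V} {v : ℕ}
    (h : R.Cast k i (.vote .echo val v)) (h' : R.Cast k' i (.vote .echo val' v)) : val = val' := by
  obtain ⟨l, -, s, hs, rfl, hm, hm'⟩ := cast_common hi h h' rfl rfl
  exact (echoInv hi hs).unique val val' hm hm'

/-- Both quorums go back to echo quorums of the same view; these share a nonfaulty party, which
echoed only once. -/
theorem Quorum.unique {k k' : ℕ} {ph ph' : Phase} {val val' : V} {v : ℕ}
    (h : R.Quorum k ph val v) (h' : R.Quorum k' ph' val' v) : val = val' := by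
  obtain ⟨H, hH, hvote⟩ := h.echo.exists_voters
  obtain ⟨j, hj, l, -, hc⟩ := h'.echo.exists_mem hH fun j hj => (hvote j hj).1
  obtain ⟨l', -, hc'⟩ := (hvote j hj).2
  exact echo_unique (hvote j hj).1 hc' hc

/-! ### Keys and locks -/

/-- `r` may be the record of a key that party `i` sets when it sends votes of phase `ph`. -/
structure KeyInv (R : Run n V f Δ) (i : Fin n) (ph : Phase) (k : ℕ) (v : ℕ) (r : KeyRecord V) :
    Prop where
  lt : r.prev < r.key
  nonneg : 0 ≤ r.key
  le : r.key ≤ v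
  key : 0 < r.key → ∃ w : ℕ, r.key = w ∧ R.Cast k i (.vote ph r.val w)
  prev : 0 < r.prev → ∃ w : ℕ, r.prev = w ∧ ∃ val ≠ r.val, R.Cast k i (.vote ph val w)

theorem KeyInv.mono {i : Fin n} {ph : Phase} {k k' v v' : ℕ} {r : KeyRecord V}
    (h : R.KeyInv i ph k v r) (hk : k ≤ k') (hv : v ≤ v') : R.KeyInv i ph k' v' r := by
  refine ⟨h.lt, h.nonneg, by have := h.le; omega, fun h0 => ?_, fun h0 => ?_⟩
  · obtain ⟨w, hw, hc⟩ := h.key h0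
    exact ⟨w, hw, hc.mono hk⟩
  · obtain ⟨w, hw, val, hval, hc⟩ := h.prev h0
    exact ⟨w, hw, val, hval, hc.mono hk⟩

theorem KeyInv.init {i : Fin n} {ph : Phase} {k v : ℕ} {x : V} :
    R.KeyInv i ph k v ⟨0, x, -1⟩ := by
  constructor <;> simp

/-- The point is that `prev` stays strictly below `key` when the value changes. Had the old key been
set in view `v` already, both values would have a quorum in that view and would coincide. Positivity
of `v` tells a key set in view `v` from the initial key `0`. -/
theorem KeyInv.set {i : Fin n} (hi : i ∉ R.faulty) {ph ph' : Phase} (hn : ph.Next ph') {k v : ℕ}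
    {r : KeyRecord V} {val : V} (h : R.KeyInv i ph' k v r) (hv : 0 < v)
    (hc : R.Cast k i (.vote ph' val v)) : R.KeyInv i ph' k v (r.set v val) := by
  unfold KeyRecord.set
  split_ifs with hval
  · refine ⟨?_, by simp, le_rfl, fun _ => ⟨v, rfl, hc⟩, fun h0 => ?_⟩
    · refine lt_of_le_of_ne h.le fun he => hval ?_
      replace he : r.key = v := he
      obtain ⟨w, hw, hc'⟩ := h.key (by omega)
      obtain rfl : w = v := by omega
      exact (quorum_of_cast hi hc' hn).unique (quorum_of_cast hi hc hn)
    · obtain ⟨w, hw, hc⟩ := h.key h0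
      exact ⟨w, hw, _, hval, hc⟩
  · rw [not_not] at hval
    subst hval
    exact ⟨h.lt.trans_le h.le, by simp, le_rfl, fun _ => ⟨v, rfl, hc⟩, h.prev⟩

theorem view_pos {i : Fin n} (hi : i ∉ R.faulty) {k : ℕ} {s : State n V}
    (hs : R.state k i = some s) : 0 < s.view := by
  refine R.invariant hi (fun _ s => 0 < s.view) (fun _ _ h => h) (fun _ _ _ => Nat.one_pos) ?_
    (fun _ _ _ _ _ _ _ _ h => h) hs
  intro k j m s s' o _ _ _ _ h ih
  exact lt_of_lt_of_le ih h.le.view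

/-- What the keys and the lock in a state of a nonfaulty party tell. -/
structure KeysInv (R : Run n V f Δ) (i : Fin n) (k : ℕ) (s : State n V) : Prop where
  key1 : R.KeyInv i .key1 k s.view s.key1
  key2 : R.KeyInv i .key2 k s.view s.key2
  key3 : (s.key3 = 0 ∧ s.key3Val = R.input i) ∨
    ∃ w : ℕ, 0 < w ∧ w ≤ s.view ∧ s.key3 = w ∧ R.Cast k i (.vote .key3 s.key3Val w)
  lock : s.lock = 0 ∨
    ∃ w : ℕ, 0 < w ∧ w ≤ s.view ∧ s.lock = w ∧ R.Cast k i (.vote .lock s.lockVal w)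

theorem KeysInv.frame {i : Fin n} {k k' : ℕ} {s s' : State n V} (h : R.KeysInv i k s)
    (hk : k ≤ k') (hv : s.view ≤ s'.view) (h1 : s'.key1 = s.key1) (h2 : s'.key2 = s.key2)
    (h3 : s'.key3 = s.key3) (h3' : s'.key3Val = s.key3Val) (hl : s'.lock = s.lock)
    (hl' : s'.lockVal = s.lockVal) : R.KeysInv i k' s' := by
  refine ⟨h1 ▸ h.key1.mono hk hv, h2 ▸ h.key2.mono hk hv, ?_, ?_⟩
  · rw [h3, h3']
    refine h.key3.imp_right fun ⟨w, h0, hw, he, hc⟩ => ⟨w, h0, hw.trans hv, he, hc.mono hk⟩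
  · rw [hl, hl']
    refine h.lock.imp_right fun ⟨w, h0, hw, he, hc⟩ => ⟨w, h0, hw.trans hv, he, hc.mono hk⟩

theorem keysInv {i : Fin n} (hi : i ∉ R.faulty) {k : ℕ} {s : State n V}
    (hs : R.state k i = some s) : R.KeysInv i k s := by
  refine R.invariant hi (R.KeysInv i) ?_ ?_ ?_ ?_ hs
  · exact fun k s h => h.frame k.le_succ le_rfl rfl rfl rfl rfl rfl rfl
  · exact fun k _ _ => ⟨.init, .init, .inl ⟨rfl, rfl⟩, .inl rfl⟩
  · intro k j m s s' o he hs hs' _ h ih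
    have ih' : R.KeysInv i (k + 1) s := ih.frame k.le_succ le_rfl rfl rfl rfl rfl rfl rfl
    have h0 := view_pos hi hs
    have hcast : ∀ m ∈ s'.joinMsgs, R.Cast (k + 1) i m := fun m hm => ⟨k + 1, le_rfl, s', hs', hm⟩
    cases h with
    | abortEnter h ha hw => exact ih.frame k.le_succ (Nat.le_succ_of_le hw) rfl rfl rfl rfl rfl rfl
    | quorumEcho h hc =>
      exact { ih' with key1 := ih'.key1.set hi (show Phase.Next .echo .key1 from trivial) h0 (hcast _ (by simp)) }
    | quorumKey1 h hc =>
      exact { ih' with key2 := ih'.key2.set hi (show Phase.Next .key1 .key2 from trivial) h0 (hcast _ (by simp)) }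
    | quorumKey2 h hc =>
      exact { ih' with key3 := .inr ⟨s.view, h0, le_rfl, rfl, hcast _ (by simp)⟩ }
    | quorumKey3 h hc =>
      exact { ih' with lock := .inr ⟨s.view, h0, le_rfl, rfl, hcast _ (by simp)⟩ }
    | _ => exact ih'.frame le_rfl le_rfl rfl rfl rfl rfl rfl rfl
  · exact fun k s _ _ _ _ _ _ h => h.frame k.le_succ le_rfl rfl rfl rfl rfl rfl rfl

/-- The record `r` shows that the key was set to `val` in view `w`, or later overwritten. -/
def Dominates (r : KeyRecord V) (w : ℕ) (val : V) : Prop :=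
  (w : ℤ) ≤ r.key ∧ (r.val = val ∨ (w : ℤ) ≤ r.prev)

/-- Overwriting by another value moves the old key, which is at least `w`, into `prev`, and setting
the same value only raises the key. So the trace of a vote is never lost. -/
theorem Dominates.set {r : KeyRecord V} {w v : ℕ} {val val' : V} (h : Dominates r w val)
    (hv : r.key ≤ v) : Dominates (r.set v val') w val := by
  unfold KeyRecord.set
  obtain ⟨h1, h2⟩ := h
  split_ifs with hc
  · exact ⟨h1.trans hv, .inr h1⟩
  · exact ⟨h1.trans hv, h2⟩

theorem dominates_set_self (r : KeyRecord V) (v : ℕ) (val : V) : Dominates (r.set v val) v val := by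
  unfold KeyRecord.set
  split_ifs with hc
  · exact ⟨le_rfl, .inl rfl⟩
  · exact ⟨le_rfl, .inl (not_not.1 hc)⟩

/-- The keys of a state of a nonfaulty party reflect its votes before step `k`. -/
structure VotesInv (R : Run n V f Δ) (i : Fin n) (k : ℕ) (s : State n V) : Prop where
  key1 : ∀ val w, R.Cast k i (.vote .key1 val w) → Dominates s.key1 w val
  key2 : ∀ val w, R.Cast k i (.vote .key2 val w) → Dominates s.key2 w val
  key3 : ∀ val w, R.Cast k i (.vote .key3 val w) → (w : ℤ) ≤ s.key3
  lock : ∀ val w, R.Cast k i (.vote .lock val w) → (w : ℤ) ≤ s.lock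

theorem cast_succ {i : Fin n} {k : ℕ} {m : Msg V} {s : State n V}
    (hs : R.state (k + 1) i = some s) (h : R.Cast (k + 1) i m) :
    R.Cast k i m ∨ m ∈ s.joinMsgs := by
  obtain ⟨l, hl, s', hs', hm⟩ := h
  rcases hl.lt_or_eq with hl | rfl
  · exact .inl ⟨l, by omega, s', hs', hm⟩
  · rw [hs] at hs'
    cases hs'
    exact .inr hm

theorem view_le_of_cast {i : Fin n} (hi : i ∉ R.faulty) {k : ℕ} {m : Msg V} {v : ℕ}
    {s : State n V} (hs : R.state k i = some s) (h : R.Cast k i m) (hv : m.InView v) :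
    v ≤ s.view := by
  obtain ⟨l, hl, s', hs', hm⟩ := h
  have := inView_of_mem hi hs' _ hm
  have e : v = s'.view := by
    cases m <;> first | exact hv.elim | exact hv.symm.trans this
  exact e ▸ (R.state_le hi hl hs' hs).view

/-- The converse of `keysInv`: there a key comes from a vote, here every vote leaves its trace in
the keys. -/
theorem votesInv {i : Fin n} (hi : i ∉ R.faulty) {k : ℕ} {s : State n V}
    (hs : R.state k i = some s) : R.VotesInv i k s := by
  -- The claim speaks of all votes up to a step and so gets stronger as the step grows; even a step
  -- that leaves the state unchanged needs the states on both sides.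
  refine R.state_induction hi (R.VotesInv i) ?_ ?_ ?_ ?_ hs
  · intro k s hs hs' ih
    have hold : ∀ {m}, R.Cast (k + 1) i m → R.Cast k i m := fun h =>
      (cast_succ hs' h).elim id fun h => ⟨k, le_rfl, s, hs, h⟩
    exact ⟨fun val w h => ih.key1 val w (hold h), fun val w h => ih.key2 val w (hold h),
      fun val w h => ih.key3 val w (hold h), fun val w h => ih.lock val w (hold h)⟩
  · intro k hs _ hs'
    have hold : ∀ {ph val w}, ¬ R.Cast (k + 1) i (.vote ph val w) := by
      intro ph val w h
      rcases cast_succ hs' h with ⟨l, hl, s', hs'', -⟩ | h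
      · obtain ⟨s'', h, -⟩ := R.state_later hi hl hs''
        rw [hs] at h
        cases h
      · cases List.mem_singleton.1 h
    exact ⟨fun _ _ h => (hold h).elim, fun _ _ h => (hold h).elim, fun _ _ h => (hold h).elim,
      fun _ _ h => (hold h).elim⟩
  · intro k j m s s' o he hs hs' _ h ih
    have hold : ∀ {ph val w}, (.vote ph val w ∈ s'.joinMsgs → .vote ph val w ∈ s.joinMsgs) →
        R.Cast (k + 1) i (.vote ph val w) → R.Cast k i (.vote ph val w) := fun h h' =>
      (cast_succ hs' h').elim id fun h' => ⟨k, le_rfl, s, hs, h h'⟩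
    have hkeys := keysInv hi hs
    cases h with
    | quorumEcho h hc =>
      refine ⟨fun val w h => ?_, fun val w h => ih.key2 val w (hold (by simp) h),
        fun val w h => ih.key3 val w (hold (by simp) h),
        fun val w h => ih.lock val w (hold (by simp) h)⟩
      rcases cast_succ hs' h with h | h
      · exact (ih.key1 val w h).set hkeys.key1.le
      · rcases mem_append_vote.1 h with h | ⟨-, rfl, rfl⟩
        · exact (ih.key1 val w ⟨k, le_rfl, s, hs, h⟩).set hkeys.key1.le
        · exact dominates_set_self _ _ _
    | quorumKey1 h hc =>
      refine ⟨fun val w h => ih.key1 val w (hold (by simp) h), fun val w h => ?_,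
        fun val w h => ih.key3 val w (hold (by simp) h),
        fun val w h => ih.lock val w (hold (by simp) h)⟩
      rcases cast_succ hs' h with h | h
      · exact (ih.key2 val w h).set hkeys.key2.le
      · rcases mem_append_vote.1 h with h | ⟨-, rfl, rfl⟩
        · exact (ih.key2 val w ⟨k, le_rfl, s, hs, h⟩).set hkeys.key2.le
        · exact dominates_set_self _ _ _
    | quorumKey2 h hc =>
      refine ⟨fun val w h => ih.key1 val w (hold (by simp) h),
        fun val w h => ih.key2 val w (hold (by simp) h), fun val w h => ?_,
        fun val w h => ih.lock val w (hold (by simp) h)⟩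
      -- The key becomes the present view, which bounds the views of all votes so far.
      have hle := view_le_of_cast (v := w) hi hs' h rfl
      exact Int.ofNat_le.2 hle
    | quorumKey3 h hc =>
      refine ⟨fun val w h => ih.key1 val w (hold (by simp) h),
        fun val w h => ih.key2 val w (hold (by simp) h),
        fun val w h => ih.key3 val w (hold (by simp) h), fun val w h => ?_⟩
      have hle := view_le_of_cast (v := w) hi hs' h rfl
      exact Int.ofNat_le.2 hle
    | abortEnter =>
      have hold : ∀ {ph val w}, R.Cast (k + 1) i (.vote ph val w) →
          R.Cast k i (.vote ph val w) := fun h' =>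
        (cast_succ hs' h').elim id fun h' => by cases List.mem_singleton.1 h'
      exact ⟨fun val w h => ih.key1 val w (hold h), fun val w h => ih.key2 val w (hold h),
        fun val w h => ih.key3 val w (hold h), fun val w h => ih.lock val w (hold h)⟩
    | _ =>
      exact ⟨fun val w h => ih.key1 val w (hold (by simp) h),
        fun val w h => ih.key2 val w (hold (by simp) h),
        fun val w h => ih.key3 val w (hold (by simp) h),
        fun val w h => ih.lock val w (hold (by simp) h)⟩
  · intro k s d hs _ _ hs' _ ih
    have hold : ∀ {m}, R.Cast (k + 1) i m → R.Cast k i m := fun h =>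
      (cast_succ hs' h).elim id fun h => ⟨k, le_rfl, s, hs, h⟩
    exact ⟨fun val w h => ih.key1 val w (hold h), fun val w h => ih.key2 val w (hold h),
      fun val w h => ih.key3 val w (hold h), fun val w h => ih.lock val w (hold h)⟩

end Run

namespace Run

variable {f : ℕ} {Δ : ℝ} {R : Run n V f Δ}

/-! ### Proofs -/

theorem view_of_cast {i : Fin n} (hi : i ∉ R.faulty) {k : ℕ} {m : Msg V} {v : ℕ}
    (h : R.Cast k i m) (hv : m.InView v) :
    ∃ l ≤ k, ∃ s, R.state l i = some s ∧ s.view = v ∧ m ∈ s.joinMsgs := by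
  obtain ⟨l, hl, s, hs, hm⟩ := h
  refine ⟨l, hl, s, hs, ?_, hm⟩
  have := inView_of_mem hi hs _ hm
  cases m <;> first | exact hv.elim | exact this.symm.trans hv

/-- A message of an earlier view has been sent before the present view was reached. -/
theorem Cast.of_view_lt {i : Fin n} (hi : i ∉ R.faulty) {k k' : ℕ} {m : Msg V} {v : ℕ}
    {s : State n V} (h : R.Cast k' i m) (hv : m.InView v) (hs : R.state k i = some s)
    (hlt : v < s.view) : ∃ l < k, R.Cast l i m := by
  obtain ⟨l, -, s', hs', rfl, hm⟩ := view_of_cast hi h hv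
  exact ⟨l, R.le_of_view_lt hi hs' hs hlt, l, le_rfl, s', hs', hm⟩

/-- The proof is fixed on entering the view. Hence it covers exactly the votes of earlier views, and
its key lies below the view even if `key1` is set again afterwards. -/
theorem proof_keyInv {i : Fin n} (hi : i ∉ R.faulty) {k : ℕ} {s : State n V}
    (hs : R.state k i = some s) : ∀ r, .proof r s.view ∈ s.joinMsgs →
      R.KeyInv i .key1 k s.view r ∧ r.key < s.view ∧
        ∀ val w, w < s.view → R.Cast k i (.vote .key1 val w) → Dominates r w val := by
  refine R.state_induction hi (fun k s => ∀ r, .proof r s.view ∈ s.joinMsgs →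
      R.KeyInv i .key1 k s.view r ∧ r.key < s.view ∧
        ∀ val w, w < s.view → R.Cast k i (.vote .key1 val w) → Dominates r w val) ?_ ?_ ?_ ?_ hs
  · intro k s hs hs' ih r hr
    obtain ⟨h1, h2, h3⟩ := ih r hr
    refine ⟨h1.mono k.le_succ le_rfl, h2, fun val w hw h => h3 val w hw ?_⟩
    exact (cast_succ hs' h).elim id fun h => ⟨k, le_rfl, s, hs, h⟩
  · intro k hs _ hs' r hr
    cases List.mem_singleton.1 hr
    refine ⟨.init, Int.zero_lt_one, fun val w hw h => ?_⟩
    rcases cast_succ hs' h with ⟨l, hl, s', hs'', -⟩ | h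
    · obtain ⟨s'', h, -⟩ := R.state_later hi hl hs''
      rw [hs] at h
      cases h
    · cases List.mem_singleton.1 h
  · intro k j m s s' o he hs hs' _ h ih
    have hold : ∀ {val w}, w < s'.view → R.Cast (k + 1) i (.vote .key1 val w) →
        R.Cast k i (.vote .key1 val w) := fun hw h' =>
      (cast_succ hs' h').elim id fun h' => absurd (inView_of_mem hi hs' _ h') hw.ne
    have frame : s'.view = s.view →
        (∀ r, .proof r s.view ∈ s'.joinMsgs → .proof r s.view ∈ s.joinMsgs) →
        ∀ r, .proof r s'.view ∈ s'.joinMsgs →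
          R.KeyInv i .key1 (k + 1) s'.view r ∧ r.key < s'.view ∧
          ∀ val w, w < s'.view → R.Cast (k + 1) i (.vote .key1 val w) → Dominates r w val := by
      intro hv hj r hr
      rw [hv] at hr hold ⊢
      obtain ⟨h1, h2, h3⟩ := ih r (hj r hr)
      exact ⟨h1.mono k.le_succ le_rfl, h2, fun val w hw h => h3 val w hw (hold hw h)⟩
    cases h with
    | abortEnter h ha hw =>
      intro r hr
      cases List.mem_singleton.1 hr
      have h1 := (keysInv hi hs).key1
      have hlt : s.view < kthLargest (n - f) _ + 1 := Nat.lt_succ_of_le hw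
      exact ⟨h1.mono k.le_succ hlt.le, h1.le.trans_lt (Int.ofNat_lt.2 hlt),
        fun val w hw h => (votesInv hi hs).key1 val w (hold hw h)⟩
    | _ => exact frame rfl (by simp)
  · intro k s d hs _ _ hs' _ ih r hr
    obtain ⟨h1, h2, h3⟩ := ih r hr
    refine ⟨h1.mono k.le_succ le_rfl, h2, fun val w hw h => h3 val w hw ?_⟩
    exact (cast_succ hs' h).elim id fun h => ⟨k, le_rfl, s, hs, h⟩

/-- A proof received from a nonfaulty party is well-formed and reflects its earlier votes. -/
theorem proof_of_received {i j : Fin n} (hi : i ∉ R.faulty) (hj : j ∉ R.faulty) {k : ℕ}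
    {r : KeyRecord V} {v : ℕ} (h : R.Received k i j (.proof r v)) :
    R.KeyInv j .key1 k v r ∧ r.key < v ∧
      ∀ k' val w, w < v → R.Cast k' j (.vote .key1 val w) → Dominates r w val := by
  obtain ⟨k', hk', h⟩ := cast_of_received hi hj h (v := v) rfl
  obtain ⟨l, hl, s, hs, rfl, hm⟩ := view_of_cast hj h (v := v) rfl
  obtain ⟨h1, h2, h3⟩ := proof_keyInv hj hs r hm
  refine ⟨h1.mono (by omega) le_rfl, h2, fun k' val w hw hc => h3 val w hw ?_⟩
  obtain ⟨l', hl', hc⟩ := hc.of_view_lt hj (v := w) rfl hs hw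
  exact hc.mono hl'.le

/-! ### Agreement -/

/-- Once `f + 1` nonfaulty parties have locked `val`, they echo no other value. -/
theorem echo_of_locked {L : Finset (Fin n)} (hL : f + 1 ≤ L.card) {val : V} {v : ℕ}
    (hlock : ∀ i ∈ L, i ∉ R.faulty ∧ ∃ k, R.Cast k i (.vote .lock val v)) (k : ℕ) :
    ∀ i ∈ L, ∀ v' > v, ∀ val', R.Cast k i (.vote .echo val' v') → val' = val := by
  induction k using Nat.strong_induction_on with
  | _ k ih =>
  intro i hiL v' hv' val' hcast
  obtain ⟨hi, K, hK⟩ := hlock i hiL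
  -- The induction hypothesis in usable form: a quorum of view `v` agrees with the lock votes by
  -- uniqueness, and the echo quorum behind a later one contains a member of `L`, which echoed at an
  -- earlier step.
  have hQ : ∀ {ph : Phase} {w : ℕ} {val'' : V}, v ≤ w → R.Quorum k ph val'' w → val'' = val := by
    intro ph w val'' hw h
    rcases hw.eq_or_lt with rfl | hw
    · exact h.unique (quorum_of_cast hi hK (ph := .key3) trivial)
    · obtain ⟨i', hi', l, hl, hc⟩ := h.echo.exists_mem hL fun i hi => (hlock i hi).1
      exact ih l hl i' hi' w hw val'' hc
  obtain ⟨l, hl, s, hs, rfl, hm⟩ := view_of_cast hi hcast rfl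
  obtain ⟨key, l0, lv, ⟨k', hk', s0, p, hs0, hv0, rfl, rfl, -, -⟩, hor⟩ :=
    (echoInv hi hs).reason val' hm
  obtain ⟨K', -, sK, hsK, hvK, -⟩ := view_of_cast hi hK rfl
  have hvpos := view_pos hi hsK
  -- The party processed the proposal in a later view, hence after its lock vote in `v`. So the lock
  -- it then held is from view `v` or later, and its value is `val`.
  obtain ⟨l', hl', hc⟩ := hK.of_view_lt hi rfl hs0 (by omega)
  have hle := (votesInv hi hs0).lock val v (hc.mono hl'.le)
  have hlv : s0.lockVal = val := by
    rcases (keysInv hi hs0).lock with h | ⟨w, -, -, hw, hc⟩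
    · omega
    · exact hQ (by omega) ((quorum_of_cast hi hc (ph := .key3) trivial).mono (by omega))
  rcases hor with h | h | ⟨S, hS, h⟩
  · omega
  · exact h.trans hlv
  -- One of the `f + 1` proofs is from a nonfaulty party. If its key is at least `v`, its value is
  -- `val`; if `prev` were at least `v` too, a different value would have had a quorum there.
  -- Neither way of opening the lock remains.
  · exfalso
    obtain ⟨j, hj, hjf⟩ := R.exists_mem_not_faulty hS
    obtain ⟨r, hr, h⟩ := h j hj
    obtain ⟨hkey, -, -⟩ := proof_of_received hi hjf hr
    have hrv : (v : ℤ) ≤ r.key → r.val = val := by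
      intro hle
      obtain ⟨w, hw, hc⟩ := hkey.key (by omega)
      exact hQ (by omega) ((quorum_of_cast hjf hc (ph := .echo) trivial).mono hl)
    have hlt := hkey.lt
    rcases h with h | h
    · obtain ⟨w, hw, val₂, hne, hc⟩ := hkey.prev (by omega)
      refine hne ?_
      rw [hrv (by omega)]
      exact hQ (by omega) ((quorum_of_cast hjf hc (ph := .echo) trivial).mono hl)
    · exact h.2 ((hrv (by omega)).trans hlv.symm)

/-- For different views, the echo quorum behind the later lock quorum contains one of the nonfaulty
parties that locked in the earlier view. -/
theorem lock_quorum_unique {k k' : ℕ} {val val' : V} {v v' : ℕ} (h : R.Quorum k .lock val v)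
    (h' : R.Quorum k' .lock val' v') : val = val' := by
  have key : ∀ {k k' : ℕ} {val val' : V} {v v' : ℕ}, R.Quorum k .lock val v →
      R.Quorum k' .lock val' v' → v < v' → val' = val := by
    intro k k' val val' v v' h h' hv
    obtain ⟨L, hL, hlock⟩ := h.exists_voters
    obtain ⟨i, hi, l, -, hc⟩ := h'.echo.exists_mem hL fun j hj => (hlock j hj).1
    refine echo_of_locked hL (fun i hi => ⟨(hlock i hi).1, ?_⟩) l i hi v' hv val' hc
    obtain ⟨l, -, h⟩ := (hlock i hi).2
    exact ⟨l, h⟩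
  rcases lt_trichotomy v v' with hv | rfl | hv
  · exact (key h h' hv).symm
  · exact h.unique h'
  · exact key h' h hv

/-! ### Done messages and decisions -/

theorem received_of_mem_doneFrom {i : Fin n} (hi : i ∉ R.faulty) {k : ℕ} {s : State n V}
    (hs : R.state k i = some s) : ∀ j val, j ∈ s.doneFrom val → R.Received k i j (.done val) := by
  refine R.invariant hi (fun k s => ∀ j val, j ∈ s.doneFrom val → R.Received k i j (.done val))
    ?_ ?_ ?_ ?_ hs
  · exact fun k s h j val hj => (h j val hj).mono k.le_succ
  · intro k _ _ j val hj
    cases hj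
  · intro k j m s s' o he _ _ _ h ih
    have ih' := fun j val hj => (ih j val hj).mono k.le_succ
    cases h with
    | done h hd ho =>
      intro j' val' hj'
      subst hd
      simp only [Function.update_apply] at hj'
      split_ifs at hj' with hc
      · subst hc
        rcases Finset.mem_insert.1 hj' with rfl | hj'
        · exact ⟨k, k.lt_succ_self, he⟩
        · exact ih' _ _ hj'
      · exact ih' _ _ hj'
    | _ => exact ih'
  · exact fun k s d _ _ _ _ _ h j val hj => (h j val hj).mono k.le_succ

/-- Amplification needs `f + 1` senders, one of them nonfaulty and with an earlier `done`;
descending over steps ends at a lock quorum for the same value. -/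
theorem quorum_of_done {k : ℕ} : ∀ {i p : Fin n} {val : V}, i ∉ R.faulty →
    .done val ∈ R.sent k i p → ∃ k' v, R.Quorum k' .lock val v := by
  induction k using Nat.strong_induction_on with
  | _ k ih =>
  intro i p val hi hm
  generalize h : Msg.done val = m at hm
  cases sentBy_of_mem hi hm with
  | join hs hj hm => subst h; exact (inView_of_mem hi hs _ hm).elim
  | lock hs hc ho =>
    cases h
    exact ⟨_, _, quorum_of_voteFrom hi hs hc⟩
  | done hs hc ho =>
    cases h
    obtain ⟨j, hj, hjf⟩ := R.exists_mem_not_faulty hc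
    obtain ⟨l, hl, l', hl', h⟩ := (received_of_mem_doneFrom hi hs j _ hj).sent hi hjf
    exact ih l' (by omega) hjf h
  | _ => cases h

/-- How the `done` messages received and sent are reflected in a state. -/
structure DoneInv (f : ℕ) (s : State n V) : Prop where
  decided : ∀ val, s.decided = some val → n - f ≤ (s.doneFrom val).card
  decide : ∀ val, n - f ≤ (s.doneFrom val).card → s.decided ≠ none
  amplify : ∀ val, f + 1 ≤ (s.doneFrom val).card → s.doneSent = true
  lock : ∀ val, n - f ≤ (s.voteFrom .lock val).card → s.doneSent = true

/-- The code tests for equality with the thresholds. As senders are added one by one, a count beyond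
a threshold has hit it before, and the flags persist. -/
theorem doneInv {i : Fin n} (hi : i ∉ R.faulty) {k : ℕ} {s : State n V}
    (hs : R.state k i = some s) : DoneInv f s := by
  have hf := R.hf
  refine R.invariant hi (fun _ s => DoneInv f s) (fun _ _ h => h) ?_ ?_ ?_ hs
  · intro k _ _
    constructor <;> simp [enterView, sendAllUponJoin, initState] <;> omega
  · intro k j m s s' o _ _ _ _ h ih
    cases h with
    | abortEnter =>
      refine { ih with lock := fun val h => ?_ }
      simp only [enterView, sendAllUponJoin, Finset.card_empty] at h
      omega
    | @done val d b _ h hd ho =>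
      have hcard : d.card = (s.doneFrom val).card + 1 := by
        rw [hd, Finset.card_insert_of_notMem h]
      have hb : s.doneSent = true → b = true := fun hs => by
        rcases ho with ho | ho
        · exact ho.2.2.1
        · exact ho.2.1.trans hs
      constructor
      · intro val' hval'
        simp only [Function.update_apply] at hval' ⊢
        split_ifs at hval' with hc
        · cases hval'
          simp [hc]
        · have := ih.decided val' hval'
          split_ifs with he
          · subst he; omega
          · exact this
      · intro val' hval'
        simp only [Function.update_apply] at hval' ⊢
        split_ifs with hc
        · simp
        · split_ifs at hval' with he
          · exact ih.decide val (by omega)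
          · exact ih.decide val' hval'
      · intro val' hval'
        simp only [Function.update_apply] at hval' ⊢
        split_ifs at hval' with he
        · rcases ho with ho | ho
          · exact ho.2.2.1
          · by_cases hc : d.card = f + 1
            · exact hb (ho.1 hc)
            · exact hb (ih.amplify val (by omega))
        · exact hb (ih.amplify val' hval')
      · exact fun val' hval' => hb (ih.lock val' hval')
    | @vote ph val h hc =>
      refine { ih with lock := fun val' h' => ?_ }
      simp only [addVote_apply] at h'
      split_ifs at h' with he
      · obtain ⟨rfl, rfl⟩ := he
        rw [Finset.card_insert_of_notMem h] at hc h'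
        exact ih.lock val' (by omega)
      · exact ih.lock val' h'
    | quorumEcho | quorumKey1 | quorumKey2 | quorumKey3 =>
      exact { ih with lock := fun val' h' => ih.lock val' (by simpa [addVote_apply] using h') }
    | quorumLock =>
      exact { ih with lock := fun _ _ => rfl, amplify := fun _ _ => rfl }
    | _ => exact { ih with }
  · intro k s d _ _ _ _ _ h
    exact { h with }

theorem quorum_of_decided {i : Fin n} (hi : i ∉ R.faulty) {k : ℕ} {s : State n V}
    (hs : R.state k i = some s) {val : V} (h : s.decided = some val) :
    ∃ k v, R.Quorum k .lock val v := by
  have hf := R.hf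
  have hc := (doneInv hi hs).decided val h
  obtain ⟨j, hj, hjf⟩ := R.exists_mem_not_faulty (S := s.doneFrom val) (by omega)
  obtain ⟨l, -, l', -, h⟩ := (received_of_mem_doneFrom hi hs j _ hj).sent hi hjf
  exact quorum_of_done hjf h

end Run

theorem key2Proofs_eq_some {s : State n V} {j : Fin n} {r : KeyRecord V} :
    key2Proofs s j = some r ↔
      ∃ kv, s.suggestFrom j = some (kv, r) ∧ r.prev < r.key ∧ r.key < s.view := by
  unfold key2Proofs
  rcases s.suggestFrom j with _ | ⟨kv, r'⟩
  · simp
  · simp only [Option.some.injEq, ite_eq_iff, Prod.mk.injEq]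
    constructor
    · rintro (⟨h, rfl⟩ | ⟨_, h⟩)
      · exact ⟨kv, ⟨rfl, rfl⟩, h⟩
      · cases h
    · rintro ⟨_, ⟨rfl, rfl⟩, h⟩
      exact .inl ⟨h, rfl⟩

theorem suggestions_eq_some {f : ℕ} {s : State n V} {j : Fin n} {k : ℤ} {v : V} :
    suggestions f s j = some (k, v) ↔ (∃ r, s.suggestFrom j = some ((k, v), r)) ∧
      (k = 0 ∨ (k < s.view ∧ acceptKey f k v (key2Proofs s))) := by
  unfold suggestions
  rcases s.suggestFrom j with _ | ⟨⟨k', v'⟩, r'⟩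
  · simp
  · simp only [Option.some.injEq, ite_eq_iff, Prod.mk.injEq]
    constructor
    · rintro (⟨h, rfl, rfl⟩ | ⟨_, h⟩)
      · exact ⟨⟨r', ⟨rfl, rfl⟩, rfl⟩, h⟩
      · cases h
    · rintro ⟨⟨_, ⟨rfl, rfl⟩, rfl⟩, h⟩
      exact .inl ⟨h, rfl, rfl⟩

theorem suggestions_congr {f : ℕ} {s s' : State n V} (hv : s'.view = s.view)
    (hs : s'.suggestFrom = s.suggestFrom) : suggestions f s' = suggestions f s := by
  have : key2Proofs s' = key2Proofs s := by
    funext j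
    simp only [key2Proofs, hv, hs]
  funext j
  simp only [suggestions, hv, hs, this]

namespace Run

variable {f : ℕ} {Δ : ℝ} {R : Run n V f Δ}

/-! ### Suggestions and proposals -/

/-- `(key, val)` is a suggestion with maximal key among at least `n - f` accepted suggestions that
party `i` has received in view `v` before step `k`, and which `s` records. -/
structure Proposal (R : Run n V f Δ) (k : ℕ) (i : Fin n) (v : ℕ) (key : ℤ) (val : V)
    (s : State n V) : Prop where
  view : s.view = v
  received : ∀ j k3 v3 r, s.suggestFrom j = some ((k3, v3), r) →
    R.Received k i j (.suggest k3 v3 r v)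
  card : n - f ≤ (Finset.univ.filter fun l => (suggestions f s l).isSome).card
  mem : ∃ l, suggestions f s l = some (key, val)
  le : ∀ l kv, suggestions f s l = some kv → kv.1 ≤ key

theorem Proposal.mono {k k' : ℕ} {i : Fin n} {v : ℕ} {key : ℤ} {val : V} {s : State n V}
    (h : R.Proposal k i v key val s) (hk : k ≤ k') : R.Proposal k' i v key val s :=
  { h with received := fun j k3 v3 r hr => (h.received j k3 v3 r hr).mono hk }

/-- What the suggestions and proposals in a state of a nonfaulty party tell. -/
structure ProposeInv (R : Run n V f Δ) (i : Fin n) (k : ℕ) (s : State n V) : Prop where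
  received : ∀ j k3 v3 r, s.suggestFrom j = some ((k3, v3), r) →
    R.Received k i j (.suggest k3 v3 r s.view)
  proposed : (∃ key val, .propose key val s.view ∈ s.joinMsgs) ↔ s.proposed = true
  unique : ∀ key val key' val', .propose key val s.view ∈ s.joinMsgs →
    .propose key' val' s.view ∈ s.joinMsgs → key = key' ∧ val = val'
  reason : ∀ key val, .propose key val s.view ∈ s.joinMsgs →
    ∃ s₁, R.Proposal k i s.view key val s₁
  waiting : s.proposed = false →
    (Finset.univ.filter fun l => (suggestions f s l).isSome).card < n - f

theorem ProposeInv.frame {i : Fin n} {k k' : ℕ} {s s' : State n V} (h : R.ProposeInv i k s)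
    (hk : k ≤ k') (hv : s'.view = s.view) (hs : s'.suggestFrom = s.suggestFrom)
    (hp : s'.proposed = s.proposed)
    (hj : ∀ key val, .propose key val s.view ∈ s'.joinMsgs ↔
      .propose key val s.view ∈ s.joinMsgs) : R.ProposeInv i k' s' := by
  constructor
  · rw [hs, hv]
    exact fun j k3 v3 r hr => (h.received j k3 v3 r hr).mono hk
  · simp only [hv, hj, hp]
    exact h.proposed
  · simp only [hv, hj]
    exact h.unique
  · simp only [hv, hj]
    intro key val hm
    obtain ⟨s₁, h⟩ := h.reason key val hm
    exact ⟨s₁, h.mono hk⟩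
  · rw [hp, suggestions_congr hv hs]
    exact h.waiting

theorem ProposeInv.of_enterView {i : Fin n} {k : ℕ} {now : ℝ} {v : ℕ} {s : State n V} :
    R.ProposeInv i k (enterView Δ now v s).1 := by
  have hf := R.hf
  constructor
  case waiting =>
    intro _
    rw [Finset.filter_false_of_mem]
    · simp only [Finset.card_empty]; omega
    · intro l _
      simp [suggestions, enterView, sendAllUponJoin]
  all_goals simp [enterView, sendAllUponJoin]

/-- The number of accepted suggestions is tested after each new one, so a primary that has not
proposed is still short of `n - f`; this gives `waiting`. The state in `reason` is the one in which
the choice was made. -/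
theorem proposeInv {i : Fin n} (hi : i ∉ R.faulty) {k : ℕ} {s : State n V}
    (hs : R.state k i = some s) : R.ProposeInv i k s := by
  refine R.invariant hi (R.ProposeInv i) ?_ ?_ ?_ ?_ hs
  · exact fun k s h => h.frame k.le_succ rfl rfl rfl fun _ _ => Iff.rfl
  · exact fun _ _ _ => .of_enterView
  · intro k j m s s' o he hs hs' _ h ih
    have hrec : ∀ k3 v3 r, R.event k = .recv i j (.suggest k3 v3 r s.view) → ∀ j' k3' v3' r',
        Function.update s.suggestFrom j (some ((k3, v3), r)) j' = some ((k3', v3'), r') →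
        R.Received (k + 1) i j' (.suggest k3' v3' r' s.view) := by
      intro k3 v3 r he j' k3' v3' r' h
      rw [Function.update_apply] at h
      split_ifs at h with hj
      · cases h
        subst hj
        exact ⟨k, k.lt_succ_self, he⟩
      · exact (ih.received j' k3' v3' r' h).mono k.le_succ
    cases h with
    | abortEnter => exact .of_enterView
    | @suggest k3 v3 r s₁ hi h h₁ hq =>
      subst h₁
      refine ⟨hrec k3 v3 r he, ih.proposed, ih.unique, fun key val hm => ?_, hq⟩
      obtain ⟨s₁, h⟩ := ih.reason key val hm
      exact ⟨s₁, h.mono k.le_succ⟩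
    | @propose k3 v3 r s₁ key val hi h h₁ hp hq hpick hmax =>
      have hnew : ∀ key val, .propose key val s.view ∉ s.joinMsgs := fun key val hm =>
        Bool.false_ne_true (hp.symm.trans (ih.proposed.1 ⟨key, val, hm⟩))
      have hj : ∀ key' val', .propose key' val' s.view ∈ s.joinMsgs ++ [.propose key val s.view] ↔
          key' = key ∧ val' = val := by
        intro key' val'
        simp [hnew]
      subst h₁
      refine ⟨hrec k3 v3 r he, ⟨fun _ => rfl, fun _ => ⟨key, val, (hj _ _).2 ⟨rfl, rfl⟩⟩⟩, ?_, ?_,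
        fun h => by cases h⟩
      · intro key₁ val₁ key₂ val₂ h₁ h₂
        obtain ⟨rfl, rfl⟩ := (hj _ _).1 h₁
        obtain ⟨rfl, rfl⟩ := (hj _ _).1 h₂
        exact ⟨rfl, rfl⟩
      · intro key₁ val₁ h₁
        obtain ⟨rfl, rfl⟩ := (hj _ _).1 h₁
        exact ⟨_, rfl, hrec k3 v3 r he, hq, hpick, hmax⟩
    | _ => exact ih.frame k.le_succ rfl rfl rfl (by simp)
  · exact fun k s _ _ _ _ _ _ h => h.frame k.le_succ rfl rfl rfl fun _ _ => Iff.rfl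

theorem propose_unique {i : Fin n} (hi : i ∉ R.faulty) {k k' : ℕ} {key key' : ℤ} {val val' : V}
    {v : ℕ} (h : R.Cast k i (.propose key val v)) (h' : R.Cast k' i (.propose key' val' v)) :
    key = key' ∧ val = val' := by
  obtain ⟨l, -, s, hs, rfl, hm, hm'⟩ := cast_common hi h h' rfl rfl
  exact (proposeInv hi hs).unique key val key' val' hm hm'

theorem suggest_of_received {i j : Fin n} (hi : i ∉ R.faulty) (hj : j ∉ R.faulty) {k : ℕ}
    {k3 : ℤ} {v3 : V} {r : KeyRecord V} {v : ℕ} (h : R.Received k i j (.suggest k3 v3 r v)) :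
    ∃ k' < k, ∃ s, R.state k' j = some s ∧ s.view = v ∧ s.key3 = k3 ∧ s.key3Val = v3 ∧
      s.key2 = r := by
  obtain ⟨k', hk', l, hl, h⟩ := h.sent hi hj
  obtain ⟨s, hs, h1, -, h2⟩ := suggest_of_sent hj h
  exact ⟨l + 1, by omega, s, hs, h1, h2⟩

/-- The proposal behind an echo. -/
theorem propose_of_echo {i : Fin n} (hi : i ∉ R.faulty) {k : ℕ} {val : V} {v : ℕ}
    (h : R.Cast k i (.vote .echo val v)) :
    ∃ p key, IsPrimary p v ∧ R.Received k i p (.propose key val v) := by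
  obtain ⟨l, hl, s, hs, rfl, hm⟩ := view_of_cast hi h rfl
  obtain ⟨key, l0, lv, ⟨k', hk', s0, p, -, -, -, -, hp, hr⟩, -⟩ := (echoInv hi hs).reason val hm
  exact ⟨p, key, hp, hr.mono hl⟩

theorem proposal_of_cast {i : Fin n} (hi : i ∉ R.faulty) {k : ℕ} {key : ℤ} {val : V} {v : ℕ}
    (h : R.Cast k i (.propose key val v)) : ∃ s, R.Proposal k i v key val s := by
  obtain ⟨l, hl, s, hs, rfl, hm⟩ := view_of_cast hi h rfl
  obtain ⟨s₁, h⟩ := (proposeInv hi hs).reason key val hm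
  exact ⟨s₁, h.mono hl⟩

/-! ### Validity -/

/-- Without faulty parties the chain from echo to proposal, suggestion and `key3Val` is followed
entirely by authenticity, each link at an earlier step. -/
theorem echo_val_of_key3Val (hfaulty : R.faulty = ∅) {x : V} {k : ℕ}
    (hk : ∀ k' < k, ∀ i s, R.state k' i = some s → s.key3Val = x) {i : Fin n} {val : V} {v : ℕ}
    (h : R.Cast k i (.vote .echo val v)) : val = x := by
  have hnf : ∀ i, i ∉ R.faulty := by simp [hfaulty]
  obtain ⟨p, key, -, hr⟩ := propose_of_echo (hnf i) h
  obtain ⟨k₁, hk₁, hc⟩ := cast_of_received (hnf i) (hnf p) hr (v := v) rfl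
  obtain ⟨s₁, hs₁⟩ := proposal_of_cast (hnf p) hc
  obtain ⟨l, hl⟩ := hs₁.mem
  obtain ⟨⟨r, hr⟩, -⟩ := suggestions_eq_some.1 hl
  obtain ⟨k₂, hk₂, s₂, hs₂, -, -, h3, -⟩ :=
    suggest_of_received (hnf p) (hnf l) (hs₁.received l _ _ r hr)
  exact h3.symm.trans (hk k₂ (by omega) l s₂ hs₂)

/-- A `key3Val` is the input or comes from a `key2` quorum, hence from an echo at an earlier step.
-/
theorem key3Val_eq (hfaulty : R.faulty = ∅) {x : V} (hx : ∀ i, R.input i = x) (k : ℕ) :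
    ∀ i s, R.state k i = some s → s.key3Val = x := by
  have hnf : ∀ i, i ∉ R.faulty := by simp [hfaulty]
  induction k using Nat.strong_induction_on with
  | _ k ih =>
  intro i s hs
  rcases (keysInv (hnf i) hs).key3 with ⟨-, h⟩ | ⟨w, -, -, -, hc⟩
  · exact h.trans (hx i)
  · obtain ⟨j, hj, l, hl, h⟩ := (quorum_of_cast (hnf i) hc (ph := .key2) trivial).echo.exists_voter
    exact echo_val_of_key3Val hfaulty (fun k' hk' => ih k' (by omega)) h

theorem decided_eq (hfaulty : R.faulty = ∅) {x : V} (hx : ∀ i, R.input i = x) {i : Fin n}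
    {k : ℕ} {s : State n V} (hs : R.state k i = some s) {val : V} (h : s.decided = some val) :
    val = x := by
  have hnf : ∀ i, i ∉ R.faulty := by simp [hfaulty]
  obtain ⟨k, v, hq⟩ := quorum_of_decided (hnf i) hs h
  obtain ⟨j, hj, l, hl, h⟩ := hq.echo.exists_voter
  exact echo_val_of_key3Val hfaulty (fun k' _ => key3Val_eq hfaulty hx k') h

end Run

namespace Run

variable {f : ℕ} {Δ : ℝ} {R : Run n V f Δ}

/-! ### Time -/

/-- The number of steps up to time `T`. -/
noncomputable def upTo (R : Run n V f Δ) (T : ℝ) : ℕ := Nat.find (R.time_unbounded T)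

/-- The bridge between real time and step numbers: `state (upTo T)` is the state after all events up
to and including time `T`. -/
theorem lt_upTo {k : ℕ} {T : ℝ} : k < R.upTo T ↔ R.time k ≤ T := by
  constructor
  · intro h
    exact not_lt.1 (Nat.find_min (R.time_unbounded T) h)
  · intro h
    by_contra hk
    exact absurd (Nat.find_spec (R.time_unbounded T))
      (not_lt.2 ((R.time_mono (not_lt.1 hk)).trans h))

theorem upTo_mono {T T' : ℝ} (h : T ≤ T') : R.upTo T ≤ R.upTo T' := by
  by_contra hlt
  have h1 := lt_upTo.1 (not_le.1 hlt)
  exact lt_irrefl _ (lt_upTo.2 (h1.trans h))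

theorem exists_le_upTo (R : Run n V f Δ) (k : ℕ) : ∃ T, R.GST ≤ T ∧ k ≤ R.upTo T :=
  ⟨max (R.time k) R.GST, le_max_right _ _, (lt_upTo.2 (le_max_left _ _)).le⟩

theorem delivered {i j : Fin n} (hi : i ∉ R.faulty) (hj : j ∉ R.faulty) {k : ℕ} {m : Msg V} {T : ℝ}
    (hk : k < R.upTo T) (hT : R.GST ≤ T) (h : m ∈ R.sent k i j) :
    ∃ k' > k, k' < R.upTo (T + Δ) ∧ R.event k' = .recv j i m := by
  obtain ⟨k', hk', he, ht⟩ := R.delivery k i j m hi hj h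
  refine ⟨k', hk', lt_upTo.2 (ht.trans ?_), he⟩
  have := max_le (lt_upTo.1 hk) hT
  linarith

theorem started {i : Fin n} (hi : i ∉ R.faulty) {T : ℝ} (hT : R.GST ≤ T) :
    ∃ s, R.state (R.upTo T) i = some s := by
  obtain ⟨k, he, ht⟩ := R.starts i hi
  have h := R.step k i hi
  rw [he] at h
  have : ∃ s, R.state (k + 1) i = some s := by
    generalize R.state k i = so at h
    generalize R.state (k + 1) i = so' at h
    generalize R.sent k i = o at h
    cases h with
    | start => exact ⟨_, rfl⟩
    | other he => exact absurd rfl he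
  obtain ⟨s, hs⟩ := this
  obtain ⟨u, hu, -⟩ := R.state_later hi (lt_upTo.2 (ht.trans hT)) hs
  exact ⟨u, hu⟩

/-! ### Effects of messages -/

/-- Party `i` never decides. -/
def Undecided (R : Run n V f Δ) (i : Fin n) : Prop :=
  ∀ k s, R.state k i = some s → s.decided = none

/-- A party that has decided ignores messages. The liveness arguments therefore assume `Undecided`
and aim at a contradiction. -/
theorem act_of_recv {i j : Fin n} (hi : i ∉ R.faulty) (hu : R.Undecided i) {k : ℕ} {m : Msg V}
    (he : R.event k = .recv i j m) : ∃ s s', R.state k i = some s ∧ R.state (k + 1) i = some s' ∧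
      Act f Δ (R.clock i (R.time k)) i j s m s' (R.sent k i) := by
  have h := R.step k i hi
  rw [he] at h
  generalize hs : R.state k i = so at h
  generalize R.state (k + 1) i = so' at h
  generalize R.sent k i = o at h ⊢
  cases h with
  | recv _ h => exact ⟨_, _, rfl, rfl, h⟩
  | terminated hd => exact absurd (hu k _ hs) hd
  | other he => exact absurd rfl he

theorem abortUpdate_le_new {i j : Fin n} {v : ℕ} {a a' : Fin n → ℕ} {o : Outbox n (Msg V)}
    (h : AbortUpdate f i j v a a' o) : v ≤ a' j := by
  cases h with
  | keep h => simp
  | raise u hu h =>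
    by_cases hij : j = i
    · subst hij
      simp only [Function.update_self] at h ⊢
      exact h.le
    · simp [hij]

/-- Here and in the companion lemmas for other messages a stale message is no exception: being
stale, in the right view and role, means that the effect was recorded before. -/
theorem abort_effect {i j : Fin n} (hi : i ∉ R.faulty) (hu : R.Undecided i) {k v : ℕ}
    (he : R.event k = .recv i j (.abort v)) :
    ∃ s, R.state (k + 1) i = some s ∧ v ≤ s.highestAbort j := by
  obtain ⟨s, s', hs, hs', h⟩ := act_of_recv hi hu he
  refine ⟨s', hs', ?_⟩
  generalize R.sent k i = o at h
  cases h with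
  | stale h => exact h
  | abortStay h ha hw => exact abortUpdate_le_new ha
  | abortEnter h ha hw => exact abortUpdate_le_new ha

theorem request_effect {i j : Fin n} (hi : i ∉ R.faulty) (hu : R.Undecided i) {k v : ℕ}
    (he : R.event k = .recv i j (.request v)) :
    ∃ s, R.state (k + 1) i = some s ∧ v ≤ s.highestRequest j := by
  obtain ⟨s, s', hs, hs', h⟩ := act_of_recv hi hu he
  refine ⟨s', hs', ?_⟩
  generalize R.sent k i = o at h
  cases h with
  | stale h => exact h
  | request h => simp

theorem done_effect {i j : Fin n} (hi : i ∉ R.faulty) (hu : R.Undecided i) {k : ℕ} {val : V}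
    (he : R.event k = .recv i j (.done val)) :
    ∃ s, R.state (k + 1) i = some s ∧ j ∈ s.doneFrom val := by
  obtain ⟨s, s', hs, hs', h⟩ := act_of_recv hi hu he
  refine ⟨s', hs', ?_⟩
  generalize R.sent k i = o at h
  cases h with
  | stale h => exact h
  | done h hd ho => simp [hd]

theorem vote_effect {i j : Fin n} (hi : i ∉ R.faulty) (hu : R.Undecided i) {k : ℕ} {ph : Phase}
    {val : V} {s : State n V} (hs : R.state k i = some s)
    (he : R.event k = .recv i j (.vote ph val s.view)) :
    ∃ s', R.state (k + 1) i = some s' ∧ s'.view = s.view ∧ j ∈ s'.voteFrom ph val := by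
  obtain ⟨s₁, s', hs₁, hs', h⟩ := act_of_recv hi hu he
  rw [hs] at hs₁
  cases hs₁
  refine ⟨s', hs', ?_⟩
  have hadd : ∀ ph, j ∈ addVote s ph val j ph val := fun ph => by simp [addVote_apply]
  generalize hw : s.view = w at h
  generalize R.sent k i = o at h
  cases h with
  | stale h => exact ⟨hw, h.resolve_left fun h => h hw.symm⟩
  | _ => exact ⟨rfl, hadd _⟩

theorem proof_effect {i j : Fin n} (hi : i ∉ R.faulty) (hu : R.Undecided i) {k : ℕ}
    {r : KeyRecord V} {s : State n V} (hs : R.state k i = some s)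
    (he : R.event k = .recv i j (.proof r s.view)) :
    ∃ s', R.state (k + 1) i = some s' ∧ s'.view = s.view ∧ ∃ r, s'.proofFrom j = some r := by
  obtain ⟨s₁, s', hs₁, hs', h⟩ := act_of_recv hi hu he
  rw [hs] at hs₁
  cases hs₁
  refine ⟨s', hs', ?_⟩
  generalize hw : s.view = w at h
  generalize R.sent k i = o at h
  cases h with
  | stale h => exact ⟨hw, Option.ne_none_iff_exists'.1 (h.resolve_left fun h => h hw.symm)⟩
  | _ => exact ⟨rfl, r, by simp⟩

theorem propose_effect {i j : Fin n} (hi : i ∉ R.faulty) (hu : R.Undecided i) {k : ℕ}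
    {key : ℤ} {val : V} {s : State n V} (hs : R.state k i = some s) (hj : IsPrimary j s.view)
    (he : R.event k = .recv i j (.propose key val s.view)) :
    ∃ s', R.state (k + 1) i = some s' ∧ s'.view = s.view ∧ s'.proposalSeen = true := by
  obtain ⟨s₁, s', hs₁, hs', h⟩ := act_of_recv hi hu he
  rw [hs] at hs₁
  cases hs₁
  refine ⟨s', hs', ?_⟩
  generalize hw : s.view = w at h
  generalize R.sent k i = o at h
  cases h with
  | stale h => exact ⟨hw, (h.resolve_left fun h => h hw.symm).resolve_left fun h => h hj⟩
  | _ => exact ⟨rfl, rfl⟩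

theorem suggest_effect {i j : Fin n} (hi : i ∉ R.faulty) (hu : R.Undecided i) {k : ℕ}
    {k3 : ℤ} {v3 : V} {r : KeyRecord V} {s : State n V} (hs : R.state k i = some s)
    (hp : IsPrimary i s.view) (he : R.event k = .recv i j (.suggest k3 v3 r s.view)) :
    ∃ s', R.state (k + 1) i = some s' ∧ s'.view = s.view ∧ ∃ x, s'.suggestFrom j = some x := by
  obtain ⟨s₁, s', hs₁, hs', h⟩ := act_of_recv hi hu he
  rw [hs] at hs₁
  cases hs₁
  refine ⟨s', hs', ?_⟩
  generalize hw : s.view = w at h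
  generalize R.sent k i = o at h
  cases h with
  | stale h =>
    exact ⟨hw, Option.ne_none_iff_exists'.1
      ((h.resolve_left fun h => h hw.symm).resolve_left fun h => h hp)⟩
  | _ => exact ⟨rfl, ((k3, v3), r), by simp⟩

/-! ### Aborts -/

/-- Before step `k`, party `i` has sent to all parties an abort message for view `x` or later. -/
def Aborted (R : Run n V f Δ) (k : ℕ) (i : Fin n) (x : ℕ) : Prop :=
  ∃ k' < k, ∃ y ≥ x, ∀ p, .abort y ∈ R.sent k' i p

theorem Aborted.mono {k k' : ℕ} {i : Fin n} {x : ℕ} (h : R.Aborted k i x) (hk : k ≤ k') :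
    R.Aborted k' i x :=
  let ⟨l, hl, h⟩ := h
  ⟨l, hl.trans_le hk, h⟩

theorem abort_sent_all {i j : Fin n} (hi : i ∉ R.faulty) {k y : ℕ}
    (hm : .abort y ∈ R.sent k i j) : ∀ p, .abort y ∈ R.sent k i p := by
  generalize h : (Msg.abort y : Msg V) = m at hm
  cases sentBy_of_mem hi hm with
  | join hs hj hm => subst h; exact (inView_of_mem hi hs _ hm).elim
  | timeout hs hd hnow ho =>
    cases h
    intro p
    rw [ho]
    exact List.mem_singleton.2 rfl
  | abort hs he hu ho =>
    cases h
    exact ho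
  | _ => cases h

/-- What the abort messages recorded in a state of a nonfaulty party tell. -/
structure AbortInv (R : Run n V f Δ) (i : Fin n) (k : ℕ) (s : State n V) : Prop where
  amplified : ∀ x, f + 1 ≤ (Finset.univ.filter fun l => x ≤ s.highestAbort l).card →
    x ≤ s.highestAbort i
  advanced : ∀ x, n - f ≤ (Finset.univ.filter fun l => x ≤ s.highestAbort l).card → x < s.view
  reason : n - f ≤ (Finset.univ.filter fun l => s.view ≤ s.highestAbort l + 1).card
  aborted : ∀ q x, q ∉ R.faulty → 0 < x → x ≤ s.highestAbort q → R.Aborted k q x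

theorem AbortInv.frame {i : Fin n} {k k' : ℕ} {s s' : State n V} (h : R.AbortInv i k s)
    (hk : k ≤ k') (hv : s'.view = s.view) (ha : s'.highestAbort = s.highestAbort) :
    R.AbortInv i k' s' := by
  constructor
  · rw [ha]; exact h.amplified
  · rw [ha, hv]; exact h.advanced
  · rw [ha, hv]; exact h.reason
  · rw [ha]; exact fun q x hq h0 hx => (h.aborted q x hq h0 hx).mono hk

/-- Each change of the array re-establishes `amplified` by raising the party's own entry, and
`advanced` and `reason` by comparing the view with the `(n - f)`-th largest entry. The raise is
accompanied by a message, so `aborted` holds for the own entry too. An alarm does not touch the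
array: that abort is recorded when it arrives over the channel to oneself. -/
theorem abortInv {i : Fin n} (hi : i ∉ R.faulty) {k : ℕ} {s : State n V}
    (hs : R.state k i = some s) : R.AbortInv i k s := by
  have hf := R.hf
  refine R.invariant hi (R.AbortInv i) ?_ ?_ ?_ ?_ hs
  · exact fun k s h => h.frame k.le_succ rfl rfl
  · intro k _ _
    constructor
    · intro x hx
      by_contra h0
      have h0 : ¬ x ≤ 0 := h0
      replace hx : f + 1 ≤ (Finset.univ.filter fun _ : Fin n => x ≤ 0).card := hx
      rw [Finset.filter_false_of_mem (fun _ _ => h0)] at hx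
      simp at hx
    · intro x hx
      by_contra h0
      have h0 : ¬ x < 1 := h0
      have h1 : ¬ x ≤ 0 := by omega
      replace hx : n - f ≤ (Finset.univ.filter fun _ : Fin n => x ≤ 0).card := hx
      rw [Finset.filter_false_of_mem (fun _ _ => h1)] at hx
      simp at hx
      omega
    · rw [Finset.filter_true_of_mem]
      · simp
      · exact fun _ _ => le_rfl
    · intro q x _ h0 hx
      have hx : x ≤ 0 := hx
      omega
  · intro k j m s s' o he hs hs' ho h ih
    have key : ∀ {v a o'}, R.event k = .recv i j (.abort v) → AbortUpdate f i j v s.highestAbort a o' →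
        (∀ p, ∀ m ∈ o' p, m ∈ R.sent k i p) → ∀ q x, q ∉ R.faulty → 0 < x → x ≤ a q →
        R.Aborted (k + 1) q x := by
      intro v a o' he ha ho q x hq h0 hx
      have h1 : x ≤ Function.update s.highestAbort j v q → R.Aborted (k + 1) q x := by
        intro hx
        rw [Function.update_apply] at hx
        split_ifs at hx with hqj
        · subst hqj
          obtain ⟨l, hl, hm⟩ := R.authentic k i q _ hi hq he
          exact ⟨l, by omega, v, hx, abort_sent_all hq hm⟩
        · exact (ih.aborted q x hq h0 hx).mono k.le_succ
      cases ha with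
      | keep => exact h1 hx
      | raise u hu h =>
        rw [Function.update_apply] at hx
        split_ifs at hx with hqi
        · subst hqi
          exact ⟨k, k.lt_succ_self, u, hx, fun p => ho p _ (List.mem_singleton.2 rfl)⟩
        · exact h1 hx
    have hcard : ∀ {a b : Fin n → ℕ} {x : ℕ}, (∀ l, a l ≤ b l) →
        (Finset.univ.filter fun l => x ≤ a l + 1).card ≤
        (Finset.univ.filter fun l => x ≤ b l + 1).card := by
      intro a b x hab
      refine Finset.card_le_card fun l hl => ?_
      have := hab l
      simp only [Finset.mem_filter, Finset.mem_univ, true_and] at hl ⊢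
      omega
    cases h with
    | abortStay h ha hw =>
      refine ⟨ha.le_self hf, fun x hx => ?_, ih.reason.trans (hcard (ha.le h)), ?_⟩
      · exact ((le_kthLargest_iff (by omega) (by omega) _ _).2 hx).trans_lt hw
      · exact key he ha fun p m hm => by rw [ho]; exact hm
    | @abortEnter _ a _ h ha hw =>
      refine ⟨ha.le_self hf, fun x hx => ?_, ?_, ?_⟩
      · exact Nat.lt_succ_of_le ((le_kthLargest_iff (by omega) (by omega) _ _).2 hx)
      · have := (le_kthLargest_iff (by omega) (by omega) a _).1 (le_refl (kthLargest (n - f) a))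
        simpa [enterView, sendAllUponJoin] using this
      · exact key he ha fun p m hm => by rw [ho]; exact List.mem_append_left _ hm
    | _ => exact ih.frame k.le_succ rfl rfl
  · exact fun k s d _ _ _ _ _ h => h.frame k.le_succ rfl rfl

/-- Every abort message goes back to an alarm of a nonfaulty party. -/
theorem timeout_of_abort {k : ℕ} : ∀ {i p : Fin n} {y : ℕ}, i ∉ R.faulty → 0 < y →
    .abort y ∈ R.sent k i p → ∃ k' ≤ k, ∃ q s d, q ∉ R.faulty ∧ R.state k' q = some s ∧
      s.timer = some d ∧ d ≤ R.clock q (R.time k') ∧ y ≤ s.view := by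
  induction k using Nat.strong_induction_on with
  | _ k ih =>
  intro i p y hi hy hm
  generalize h : (Msg.abort y : Msg V) = m at hm
  cases sentBy_of_mem hi hm with
  | join hs hj hm => subst h; exact (inView_of_mem hi hs _ hm).elim
  | timeout hs hd hnow ho =>
    cases h
    exact ⟨k, le_rfl, i, _, _, hi, hs, hd, hnow, le_rfl⟩
  | @abort s l v u hs he hu ho =>
    cases h
    -- Of the `f + 1` entries that caused the amplification one belongs to a nonfaulty party, which
    -- sent its abort strictly earlier.
    obtain ⟨q, hq', hqf⟩ := R.exists_mem_not_faulty hu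
    have hq := (Finset.mem_filter.1 hq').2
    clear hq'
    have : ∃ k' < k, ∃ y' ≥ y, .abort y' ∈ R.sent k' q i := by
      rw [Function.update_apply] at hq
      split_ifs at hq with hql
      · subst hql
        obtain ⟨k', hk', h⟩ := R.authentic k i q _ hi hqf he
        exact ⟨k', hk', v, hq, h⟩
      · obtain ⟨k', hk', y', hy', h⟩ := (abortInv hi hs).aborted q y hqf hy hq
        exact ⟨k', hk', y', hy', h i⟩
    obtain ⟨k', hk', y', hy', h⟩ := this
    obtain ⟨k'', hk'', q', s', d, h1, h2, h3, h4, h5⟩ := ih k' hk' hqf (hy.trans_le hy') h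
    exact ⟨k'', by omega, q', s', d, h1, h2, h3, h4, by omega⟩
  | _ => cases h

/-- A party enters a view only after `f + 1` nonfaulty parties have aborted the one before. -/
theorem aborted_of_view {i : Fin n} (hi : i ∉ R.faulty) {k : ℕ} {s : State n V}
    (hs : R.state k i = some s) {x : ℕ} (hx : 0 < x) (hv : x + 1 ≤ s.view) :
    ∃ H : Finset (Fin n), f + 1 ≤ H.card ∧ ∀ q ∈ H, q ∉ R.faulty ∧ R.Aborted k q x := by
  have h := abortInv hi hs
  refine ⟨_, R.card_sdiff_faulty h.reason, fun q hq => ?_⟩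
  simp only [Finset.mem_sdiff, Finset.mem_filter, Finset.mem_univ, true_and] at hq
  exact ⟨hq.2, h.aborted q x hq.2 hx (by omega)⟩

theorem abort_reaches {i q : Fin n} (hi : i ∉ R.faulty) (hu : R.Undecided i) (hq : q ∉ R.faulty)
    {k x : ℕ} {T : ℝ} (hk : k ≤ R.upTo T) (hT : R.GST ≤ T) (h : R.Aborted k q x)
    {s : State n V} (hs : R.state (R.upTo (T + Δ)) i = some s) : x ≤ s.highestAbort q := by
  obtain ⟨l, hl, y, hy, h⟩ := h
  obtain ⟨k', -, hk', he⟩ := delivered hq hi (hl.trans_le hk) hT (h i)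
  obtain ⟨s', hs', hle⟩ := abort_effect hi hu he
  exact hy.trans (hle.trans ((R.state_le hi hk' hs' hs).abort q))

/-- Two message delays. Whoever is in view `x + 1` relies on `f + 1` nonfaulty aborts of view `x`;
after `Δ` these have reached all nonfaulty parties, which amplify them, and after another `Δ` all
hold `n - f` entries of at least `x` and move past `x`. -/
theorem view_reaches (hu : ∀ i, i ∉ R.faulty → R.Undecided i) {i : Fin n} (hi : i ∉ R.faulty)
    {k : ℕ} {T : ℝ} (hk : k ≤ R.upTo T) (hT : R.GST ≤ T) {s : State n V}
    (hs : R.state k i = some s) {q : Fin n} (hq : q ∉ R.faulty) {s' : State n V}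
    (hs' : R.state (R.upTo (T + Δ + Δ)) q = some s') : s.view ≤ s'.view := by
  have hΔ := R.hΔ
  have hvpos := view_pos hq hs'
  by_contra hlt
  obtain ⟨x, hx⟩ : ∃ x, s.view = x + 1 := ⟨s.view - 1, by omega⟩
  have hx0 : 0 < x := by omega
  obtain ⟨H, hH, hab⟩ := aborted_of_view hi hs hx0 hx.ge
  have hall : ∀ p, p ∉ R.faulty → R.Aborted (R.upTo (T + Δ)) p x := by
    intro p hp
    obtain ⟨sp, hsp⟩ := started hp (show R.GST ≤ T + Δ by linarith)
    have hinv := abortInv hp hsp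
    refine hinv.aborted p x hp hx0 (hinv.amplified x (hH.trans (Finset.card_le_card ?_)))
    intro p' hp'
    simp only [Finset.mem_filter, Finset.mem_univ, true_and]
    exact abort_reaches hp (hu p hp) (hab p' hp').1 hk hT (hab p' hp').2 hsp
  have := (abortInv hq hs').advanced x (R.card_compl_faulty.trans (Finset.card_le_card ?_))
  · omega
  intro p hp
  rw [Finset.mem_compl] at hp
  simp only [Finset.mem_filter, Finset.mem_univ, true_and]
  exact abort_reaches hq (hu q hq) hp le_rfl (by linarith) (hall p hp) hs'

/-! ### Alarms -/

theorem timer_inv {i : Fin n} (hi : i ∉ R.faulty) {k : ℕ} {s : State n V}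
    (hs : R.state k i = some s) : (∀ d, s.timer = some d → ∃ k' < k, ∃ s',
      R.state (k' + 1) i = some s' ∧ s'.view = s.view ∧ d = R.clock i (R.time k') + 11 * Δ) ∧
      (s.timer = none → R.Aborted k i s.view) := by
  refine R.invariant hi (fun k s => (∀ d, s.timer = some d → ∃ k' < k, ∃ s',
      R.state (k' + 1) i = some s' ∧ s'.view = s.view ∧ d = R.clock i (R.time k') + 11 * Δ) ∧
      (s.timer = none → R.Aborted k i s.view)) ?_ ?_ ?_ ?_ hs
  · intro k s ⟨h1, h2⟩
    refine ⟨fun d hd => ?_, fun h => (h2 h).mono k.le_succ⟩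
    obtain ⟨k', hk', h⟩ := h1 d hd
    exact ⟨k', by omega, h⟩
  · intro k _ hs'
    refine ⟨fun d hd => ?_, fun h => by cases h⟩
    cases hd
    exact ⟨k, k.lt_succ_self, _, hs', rfl, rfl⟩
  · intro k j m s s' o _ _ hs' _ h ⟨h1, h2⟩
    have ih : (∀ d, s.timer = some d → ∃ k' < k + 1, ∃ s',
        R.state (k' + 1) i = some s' ∧ s'.view = s.view ∧ d = R.clock i (R.time k') + 11 * Δ) ∧
        (s.timer = none → R.Aborted (k + 1) i s.view) := by
      refine ⟨fun d hd => ?_, fun h => (h2 h).mono k.le_succ⟩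
      obtain ⟨k', hk', h⟩ := h1 d hd
      exact ⟨k', by omega, h⟩
    cases h with
    | abortEnter =>
      refine ⟨fun d hd => ?_, fun h => by cases h⟩
      cases hd
      exact ⟨k, k.lt_succ_self, _, hs', rfl, rfl⟩
    | _ => exact ih
  · intro k s d hs hd _ hs' ho _
    refine ⟨fun d hd => (by cases hd), fun _ => ?_⟩
    refine ⟨k, k.lt_succ_self, s.view, le_rfl, fun p => ?_⟩
    rw [ho]
    exact List.mem_singleton.2 rfl

theorem timer_succ {i : Fin n} (hi : i ∉ R.faulty) {k : ℕ} {s s' : State n V}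
    (hs : R.state k i = some s) (hs' : R.state (k + 1) i = some s') {d : ℝ}
    (hd : s.timer = some d) : s'.timer = some d ∨ s'.timer = none ∨ s.view < s'.view := by
  have h := R.step k i hi
  rw [hs, hs'] at h
  generalize R.event k = e at h
  generalize R.sent k i = o at h
  cases h with
  | recv _ h =>
    cases h with
    | abortEnter h ha hw => exact .inr (.inr (Nat.lt_succ_of_le hw))
    | _ => exact .inl hd
  | timeout => exact .inr (.inl rfl)
  | terminated => exact .inl hd
  | other => exact .inl hd

/-- In every view, an undecided party eventually leaves the view or aborts it. -/
theorem aborts_or_leaves {i : Fin n} (hi : i ∉ R.faulty) (hu : R.Undecided i) {k : ℕ}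
    {s : State n V} (hs : R.state k i = some s) :
    ∃ k', R.Aborted k' i s.view ∨ ∃ s', R.state k' i = some s' ∧ s.view < s'.view := by
  by_contra! hno
  have hview : ∀ k' s', k ≤ k' → R.state k' i = some s' → s'.view = s.view := by
    intro k' s' hk hs'
    exact le_antisymm ((hno k').2 s' hs') (R.state_le hi hk hs hs').view
  have hnone : ∀ k' s', k ≤ k' → R.state k' i = some s' → s'.timer ≠ none := by
    intro k' s' hk hs' h
    have := (timer_inv hi hs').2 h
    rw [hview k' s' hk hs'] at this
    exact (hno k').1 this
  obtain ⟨d, hd⟩ := Option.ne_none_iff_exists'.1 (hnone k s le_rfl hs)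
  have hconst : ∀ k', k ≤ k' → ∃ s', R.state k' i = some s' ∧ s'.timer = some d := by
    intro k' hk
    induction hk with
    | refl => exact ⟨s, hs, hd⟩
    | @step k' hk ih =>
      replace hk : k ≤ k' := hk
      obtain ⟨s', hs', hd'⟩ := ih
      obtain ⟨s'', hs'', -⟩ := R.state_succ hi hs'
      refine ⟨s'', hs'', ?_⟩
      rcases timer_succ hi hs' hs'' hd' with h | h | h
      · exact h
      · exact absurd h (hnone _ s'' (by omega) hs'')
      · rw [hview k' s' hk hs', hview (k' + 1) s'' (by omega) hs''] at h
        exact absurd h (lt_irrefl _)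
  -- The reading at `T₀` is arbitrary, but from then on the clock runs in step with real time and so
  -- reaches `d` by time `T`.
  set T₀ := max R.GST (R.time k)
  set T := T₀ + |d - R.clock i T₀|
  have hT : T₀ ≤ T := le_add_of_nonneg_right (abs_nonneg _)
  have hclock : d ≤ R.clock i T := by
    have h1 := R.clock_sync i T₀ T (le_max_left _ _) hT
    have h2 := le_abs_self (d - R.clock i T₀)
    have h3 : T - T₀ = |d - R.clock i T₀| := add_sub_cancel_left _ _
    linarith
  have hk : k < R.upTo T := lt_upTo.2 ((le_max_right _ _).trans hT)
  -- Step `k'` is the last one up to time `T`. The alarm is still pending after it, so at time `T`,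
  -- before the next step, it is overdue.
  obtain ⟨k', hk'⟩ : ∃ k', R.upTo T = k' + 1 := ⟨R.upTo T - 1, by omega⟩
  obtain ⟨s', hs', hd'⟩ := hconst (k' + 1) (by omega)
  have := R.punctual k' i s' d hi hs' (hu _ _ hs') hd' T (lt_upTo.1 (by omega))
    (not_le.1 fun h => by have := lt_upTo.2 h; omega)
  linarith

/-- As long as nobody decides, new views are entered. -/
theorem exists_view_ge (hu : ∀ i, i ∉ R.faulty → R.Undecided i) (v : ℕ) :
    ∃ k i s, i ∉ R.faulty ∧ R.state k i = some s ∧ v ≤ s.view := by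
  have hf := R.hf
  have hΔ := R.hΔ
  induction v with
  | zero =>
    obtain ⟨i, -, hi⟩ := R.exists_mem_not_faulty (S := Finset.univ) (by simp; omega)
    obtain ⟨s, hs⟩ := started hi le_rfl
    exact ⟨_, i, s, hi, hs, Nat.zero_le _⟩
  | succ v ih =>
    obtain ⟨k, i, s, hi, hs, hv⟩ := ih
    by_contra! hno
    obtain ⟨T, hT, hk⟩ := R.exists_le_upTo k
    -- If no view beyond `v` is ever entered, all nonfaulty parties end up in view `v` exactly and,
    -- unable to leave it, abort it.
    have hview : ∀ q, q ∉ R.faulty → ∃ k', R.Aborted k' q v := by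
      intro q hq
      obtain ⟨sq, hsq⟩ := started hq (show R.GST ≤ T + Δ + Δ by linarith)
      have h1 := view_reaches hu hi hk hT hs hq hsq
      have h2 := hno _ _ _ hq hsq
      obtain ⟨k', h | ⟨s', hs', h⟩⟩ := aborts_or_leaves hq (hu q hq) hsq
      · obtain rfl : sq.view = v := by omega
        exact ⟨k', h⟩
      · have := hno _ _ _ hq hs'
        omega
    -- There are finitely many parties, so one step bounds all these aborts.
    have : ∃ K, ∀ q, q ∉ R.faulty → R.Aborted K q v := by
      choose! F hF using hview
      refine ⟨Finset.univ.sup F, fun q hq => (hF q hq).mono (Finset.le_sup (Finset.mem_univ q))⟩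
    obtain ⟨K, hK⟩ := this
    obtain ⟨T', hT', hK'⟩ := R.exists_le_upTo K
    obtain ⟨si, hsi⟩ := started hi (show R.GST ≤ T' + Δ by linarith)
    have h1 := (abortInv hi hsi).advanced v
      (R.card_compl_faulty.trans (Finset.card_le_card fun q hq => by
        rw [Finset.mem_compl] at hq
        simp only [Finset.mem_filter, Finset.mem_univ, true_and]
        exact abort_reaches hi (hu i hi) hq hK' hT' (hK q hq) hsi))
    have h2 := hno _ _ _ hi hsi
    omega

end Run

namespace Run

variable {f : ℕ} {Δ : ℝ} {R : Run n V f Δ}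

/-! ### Joining a view -/

/-- What has been sent to which parties in the present view. -/
structure JoinInv (R : Run n V f Δ) (i : Fin n) (k : ℕ) (s : State n V) : Prop where
  request : ∀ j, R.Sent k i j (.request s.view)
  join : ∀ m ∈ s.joinMsgs, ∀ j, s.highestRequest j = s.view → R.Sent k i j m
  suggest : ∀ j, s.highestRequest j = s.view → IsPrimary j s.view →
    ∃ k3 v3 r, R.Sent k i j (.suggest k3 v3 r s.view)
  received : ∀ j, 0 < s.highestRequest j → R.Received k i j (.request (s.highestRequest j))

theorem JoinInv.frame {i : Fin n} {k k' : ℕ} {s s' : State n V} (h : R.JoinInv i k s)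
    (hk : k ≤ k') (hv : s'.view = s.view) (hr : s'.highestRequest = s.highestRequest)
    (hj : ∀ m ∈ s'.joinMsgs, m ∈ s.joinMsgs ∨
      ∀ j, s.highestRequest j = s.view → R.Sent k' i j m) : R.JoinInv i k' s' := by
  constructor
  · rw [hv]
    exact fun j => (h.request j).mono hk
  · rw [hv, hr]
    exact fun m hm j he => (hj m hm).elim (fun hm => (h.join m hm j he).mono hk) fun h => h j he
  · rw [hv, hr]
    intro j he hp
    obtain ⟨k3, v3, r, h⟩ := h.suggest j he hp
    exact ⟨k3, v3, r, h.mono hk⟩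
  · rw [hr]
    exact fun j h0 => (h.received j h0).mono hk

theorem JoinInv.of_enterView {i : Fin n} {k : ℕ} {now : ℝ} {v : ℕ} {s : State n V}
    (hsent : ∀ j, ∀ m ∈ (enterView Δ now v s).2 j, m ∈ R.sent k i j)
    (hr : ∀ j, 0 < s.highestRequest j → R.Received (k + 1) i j (.request (s.highestRequest j))) :
    R.JoinInv i (k + 1) (enterView Δ now v s).1 := by
  constructor
  · exact fun j => ⟨k, k.lt_succ_self, hsent j _ List.mem_cons_self⟩
  · intro m hm j hj
    cases List.mem_singleton.1 hm
    replace hj : s.highestRequest j = v := hj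
    refine ⟨k, k.lt_succ_self, hsent j _ ?_⟩
    simp [enterView, sendAllUponJoin, hj]
  · intro j hj hp
    replace hj : s.highestRequest j = v := hj
    replace hp : IsPrimary j v := hp
    refine ⟨s.key3, s.key3Val, s.key2, k, k.lt_succ_self, hsent j _ ?_⟩
    simp [enterView, sendAllUponJoin, suggestMsg, hj, hp]
  · exact hr

/-- Whichever comes first, the request of `j` or the call that sends `m` upon join, `m` is sent to
`j` when the second of them happens. This is the liveness counterpart of `sentBy_of_mem`. -/
theorem joinInv {i : Fin n} (hi : i ∉ R.faulty) {k : ℕ} {s : State n V}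
    (hs : R.state k i = some s) : R.JoinInv i k s := by
  refine R.invariant hi (R.JoinInv i) ?_ ?_ ?_ ?_ hs
  · exact fun k s h => h.frame k.le_succ rfl rfl fun m hm => .inl hm
  · intro k ho _
    refine .of_enterView (fun j m hm => by rw [ho]; exact hm) fun j h0 => ?_
    exact absurd h0 (lt_irrefl _)
  · intro k j m s s' o he hs hs' ho h ih
    have hjoin : ∀ m₀, R.sent k i = sendJoined s m₀ → ∀ m ∈ s.joinMsgs ++ [m₀],
        m ∈ s.joinMsgs ∨ ∀ j, s.highestRequest j = s.view → R.Sent (k + 1) i j m := by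
      intro m₀ ho m hm
      refine (List.mem_append.1 hm).imp_right fun hm j hj => ?_
      cases List.mem_singleton.1 hm
      refine ⟨k, k.lt_succ_self, ?_⟩
      rw [ho, sendJoined, if_pos hj]
      exact List.mem_singleton.2 rfl
    cases h with
    | @request v h =>
      have hself : ∀ l, Function.update s.highestRequest j v l = s.view →
          s.highestRequest l = s.view ∨ (l = j ∧ v = s.view) := by
        intro l hl
        rw [Function.update_apply] at hl
        split_ifs at hl with h
        · exact .inr ⟨h, hl⟩
        · exact .inl hl
      constructor
      · exact fun l => (ih.request l).mono k.le_succ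
      · intro m hm l hl
        rcases hself l hl with hl | hl
        · exact (ih.join m hm l hl).mono k.le_succ
        · refine ⟨k, k.lt_succ_self, ?_⟩
          rw [ho]
          simp only [if_pos hl]
          exact List.mem_append_right _ hm
      · intro l hl hp
        rcases hself l hl with hl | hl
        · obtain ⟨k3, v3, r, h⟩ := ih.suggest l hl hp
          exact ⟨k3, v3, r, h.mono k.le_succ⟩
        · refine ⟨s.key3, s.key3Val, s.key2, k, k.lt_succ_self, ?_⟩
          replace hp : IsPrimary l s.view := hp
          rw [ho]
          simp only [if_pos hl]
          rw [← hl.1, hl.2, if_pos hp]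
          exact List.mem_append_left _ (List.mem_singleton.2 rfl)
      · intro l hl
        simp only [Function.update_apply] at hl ⊢
        split_ifs with h
        · subst h
          exact ⟨k, k.lt_succ_self, he⟩
        · rw [if_neg h] at hl
          exact (ih.received l hl).mono k.le_succ
    | abortEnter h ha hw =>
      refine .of_enterView (fun l m hm => by rw [ho]; exact List.mem_append_right _ hm) ?_
      exact fun l hl => (ih.received l hl).mono k.le_succ
    | _ => first
      | exact ih.frame k.le_succ rfl rfl fun m hm => .inl hm
      | exact ih.frame k.le_succ rfl rfl (hjoin _ ho)
  · exact fun k s d _ _ _ _ _ h => h.frame k.le_succ rfl rfl fun m hm => .inl hm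

/-- If a party has recorded that `j` joined view `v`, then `j` is in view `v` or later. -/
theorem view_of_request {i j : Fin n} (hi : i ∉ R.faulty) (hj : j ∉ R.faulty) {k : ℕ}
    {s : State n V} (hs : R.state k i = some s) (h0 : 0 < s.highestRequest j) :
    ∃ k' < k, ∃ s', R.state k' j = some s' ∧ s'.view = s.highestRequest j := by
  obtain ⟨k', hk', l, hl, h⟩ := ((joinInv hi hs).received j h0).sent hi hj
  obtain ⟨u, hu, hv⟩ := request_of_sent hj h
  exact ⟨l + 1, by omega, u, hu, hv⟩

/-! ### A view that starts after stabilization -/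

/-- View `v ≥ 2` is entered for the first time by a nonfaulty party at time `t₀ ≥ GST`. -/
structure Entered (R : Run n V f Δ) (v : ℕ) (t₀ : ℝ) : Prop where
  two_le : 2 ≤ v
  gst : R.GST ≤ t₀
  reached : ∃ i s, i ∉ R.faulty ∧ R.state (R.upTo t₀) i = some s ∧ v ≤ s.view
  first : ∀ k i s, i ∉ R.faulty → R.state (k + 1) i = some s → v ≤ s.view → t₀ ≤ R.time k

/-- Take a view of primary `p` beyond all views held by nonfaulty parties at `GST`; the step that
first reaches it or a later view then falls after `GST`. That no party skips the view follows from
`Entered.view_le`. -/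
theorem exists_entered (hu : ∀ i, i ∉ R.faulty → R.Undecided i) {p : Fin n} :
    ∃ v t₀, IsPrimary p v ∧ R.Entered v t₀ := by
  classical
  have hf := R.hf
  have hmax : ∃ B, ∀ i s, i ∉ R.faulty → R.state (R.upTo R.GST) i = some s → s.view ≤ B := by
    refine ⟨Finset.univ.sup fun i => (R.state (R.upTo R.GST) i).elim 0 State.view, fun i s _ hs => ?_⟩
    have := Finset.le_sup (f := fun i => (R.state (R.upTo R.GST) i).elim 0 State.view)
      (Finset.mem_univ i)
    simpa [hs] using this
  obtain ⟨B, hB⟩ := hmax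
  have hv : ∃ v, B < v ∧ 2 ≤ v ∧ IsPrimary p v := by
    -- A multiple of `n` keeps the primary, and the factor `B + 2` makes the view exceed `B` and be
    -- at least `2`.
    refine ⟨p + n * (B + 2), ?_, ?_, ?_⟩
    · have : 1 * (B + 2) ≤ n * (B + 2) := Nat.mul_le_mul_right _ (by omega)
      omega
    · have : 1 * (B + 2) ≤ n * (B + 2) := Nat.mul_le_mul_right _ (by omega)
      omega
    · rw [IsPrimary, Nat.add_mul_mod_self_left, Nat.mod_eq_of_lt p.2]
  obtain ⟨v, hvB, hv2, hp⟩ := hv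
  have hex := exists_view_ge hu v
  obtain ⟨i, s, hi, hs, hvs⟩ := Nat.find_spec hex
  have hpos : Nat.find hex ≠ 0 := by
    intro h0
    rw [h0, R.state_zero i hi] at hs
    cases hs
  -- State `e + 1` is the result of step `e`, so `R.time e` is the moment of entry.
  obtain ⟨e, he⟩ := Nat.exists_eq_succ_of_ne_zero hpos
  refine ⟨v, R.time e, hp, hv2, ?_, ?_, ?_⟩
  · by_contra hlt
    rw [he] at hs
    have hle : e + 1 ≤ R.upTo R.GST := lt_upTo.2 (not_le.1 hlt).le
    obtain ⟨s', hs', hle⟩ := R.state_later hi hle hs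
    have := hB i s' hi hs'
    have := hle.view
    omega
  · rw [he] at hs
    have hle : e + 1 ≤ R.upTo (R.time e) := lt_upTo.2 le_rfl
    obtain ⟨s', hs', hle⟩ := R.state_later hi hle hs
    exact ⟨i, s', hi, hs', hvs.trans hle.view⟩
  · intro k i s hi hs hv
    have := Nat.find_min' hex ⟨i, s, hi, hs, hv⟩
    exact R.time_mono (by omega)

namespace Entered

variable {v : ℕ} {t₀ : ℝ}

/-- The abort goes back to an alarm of a nonfaulty party in view `v` or later. That alarm was set no
earlier than `t₀`, and after `GST` local clocks measure the `11 * Δ` correctly. -/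
theorem abort_late (h : R.Entered v t₀) {k : ℕ} {q p : Fin n} (hq : q ∉ R.faulty) {y : ℕ}
    (hy : v ≤ y) (hm : .abort y ∈ R.sent k q p) : t₀ + 11 * Δ ≤ R.time k := by
  have h2 := h.two_le
  obtain ⟨k', hk', q', s, d, hq', hs, hd, hnow, hv⟩ := timeout_of_abort hq (by omega) hm
  obtain ⟨k'', hk'', s', hs', hv', rfl⟩ := (timer_inv hq' hs).1 d hd
  have h0 := h.first k'' q' s' hq' hs' (by omega)
  have h1 := R.clock_sync q' (R.time k'') (R.time k') (h.gst.trans h0) (R.time_mono hk''.le)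
  have h3 := R.time_mono hk'
  linarith

/-- Moving past `v` takes an abort of view `v` or later from a nonfaulty party, for which it is too
early. -/
theorem view_le (h : R.Entered v t₀) {T : ℝ} (hT : T < t₀ + 11 * Δ) {k : ℕ} (hk : k ≤ R.upTo T)
    {i : Fin n} (hi : i ∉ R.faulty) {s : State n V} (hs : R.state k i = some s) : s.view ≤ v := by
  have h2 := h.two_le
  by_contra hlt
  obtain ⟨H, hH, hab⟩ := aborted_of_view hi hs (x := v) (by omega) (by omega)
  obtain ⟨q, hq⟩ := Finset.card_pos.1 (by omega : 0 < H.card)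
  obtain ⟨hqf, k', hk', y, hy, hm⟩ := hab q hq
  have h3 := h.abort_late hqf hy (hm q)
  have h4 := lt_upTo.1 (hk'.trans_le hk)
  linarith

end Entered

end Run

theorem IsPrimary.unique {p p' : Fin n} {v : ℕ} (h : IsPrimary p v) (h' : IsPrimary p' v) :
    p = p' :=
  Fin.ext (h.trans h'.symm)

namespace Run

variable {f : ℕ} {Δ : ℝ} {R : Run n V f Δ}

theorem exists_proof_mem {i : Fin n} (hi : i ∉ R.faulty) {k : ℕ} {s : State n V}
    (hs : R.state k i = some s) : ∃ r : KeyRecord V, (.proof r s.view : Msg V) ∈ s.joinMsgs := by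
  refine R.invariant hi (fun _ s => ∃ r : KeyRecord V, (.proof r s.view : Msg V) ∈ s.joinMsgs) (fun _ _ h => h) ?_ ?_
    (fun _ _ _ _ _ _ _ _ h => h) hs
  · exact fun k _ _ => ⟨_, List.mem_singleton.2 rfl⟩
  · intro k j m s s' o _ _ _ _ h ih
    obtain ⟨r, hr⟩ := ih
    cases h with
    | abortEnter => exact ⟨_, List.mem_singleton.2 rfl⟩
    | _ => exact ⟨r, by first | exact hr | exact List.mem_append_left _ hr⟩

/-! ### A view with a nonfaulty primary after stabilization -/

/-- Nobody decides, and view `v`, with the nonfaulty primary `p`, starts at time `t₀ ≥ GST`. -/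
structure Good (R : Run n V f Δ) (v : ℕ) (t₀ : ℝ) (p : Fin n) : Prop extends R.Entered v t₀ where
  undecided : ∀ i, i ∉ R.faulty → R.Undecided i
  nonfaulty : p ∉ R.faulty
  primary : IsPrimary p v

namespace Good

variable {v : ℕ} {t₀ : ℝ} {p : Fin n}

/-- The `2 * Δ` are the two delays of `view_reaches`, and `view_le` excludes later views. -/
theorem view_eq (h : R.Good v t₀ p) {T : ℝ} (hT : t₀ + 2 * Δ ≤ T) (hT' : T < t₀ + 11 * Δ)
    {i : Fin n} (hi : i ∉ R.faulty) : ∃ s, R.state (R.upTo T) i = some s ∧ s.view = v := by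
  have hΔ := R.hΔ
  obtain ⟨i₀, s₀, hi₀, hs₀, hv₀⟩ := h.reached
  obtain ⟨s, hs⟩ := started hi (show R.GST ≤ t₀ + Δ + Δ by linarith [h.gst])
  have h1 := view_reaches h.undecided hi₀ le_rfl h.gst hs₀ hi hs
  obtain ⟨s', hs', hle⟩ := R.state_later hi (upTo_mono (show t₀ + Δ + Δ ≤ T by linarith)) hs
  refine ⟨s', hs', le_antisymm (h.view_le hT' le_rfl hi hs') ?_⟩
  have := hle.view
  omega

/-- One more delay delivers the request for `v`; none for a later view exists yet. -/
theorem request_eq (h : R.Good v t₀ p) {T : ℝ} (hT : t₀ + 3 * Δ ≤ T) (hT' : T < t₀ + 11 * Δ)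
    {i q : Fin n} (hi : i ∉ R.faulty) (hq : q ∉ R.faulty) {s : State n V}
    (hs : R.state (R.upTo T) i = some s) : s.highestRequest q = v := by
  have hΔ := R.hΔ
  have h2 := h.two_le
  have hge : v ≤ s.highestRequest q := by
    obtain ⟨sq, hsq, hv⟩ := h.view_eq le_rfl (by linarith) hq
    obtain ⟨l, hl, hm⟩ := (joinInv hq hsq).request i
    obtain ⟨k', -, hk', he⟩ := delivered hq hi hl (by linarith [h.gst]) hm
    obtain ⟨s', hs', hle⟩ := request_effect hi (h.undecided i hi) he
    have hk : k' + 1 ≤ R.upTo T :=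
      Nat.succ_le_of_lt (hk'.trans_le (upTo_mono (by linarith)))
    have := (R.state_le hi hk hs' hs).request q
    omega
  refine le_antisymm ?_ hge
  obtain ⟨k', hk', s', hs', hv'⟩ := view_of_request hi hq hs (by omega)
  rw [← hv']
  exact h.view_le hT' hk'.le hq hs'

/-- Messages sent upon join reach parties in the view. -/
theorem sent_delivered (h : R.Good v t₀ p) {T : ℝ} (hT : t₀ ≤ T) (hT' : T + Δ < t₀ + 11 * Δ)
    {i j : Fin n} (hi : i ∉ R.faulty) (hj : j ∉ R.faulty) {l : ℕ} (hl : l < R.upTo T) {m : Msg V}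
    (hm : m ∈ R.sent l i j) {s : State n V} (hs : R.state (l + 1) i = some s)
    (hr : s.highestRequest j = v) : ∃ k < R.upTo (T + Δ), ∃ s',
      R.event k = .recv j i m ∧ R.state k j = some s' ∧ s'.view = v := by
  have h2 := h.two_le
  obtain ⟨k, hk, hkT, he⟩ := delivered hi hj hl (h.gst.trans hT) hm
  -- The sender had `j`'s request for `v`, so `j` was in view `v` before the message was sent and
  -- cannot be in an earlier view at its arrival.
  obtain ⟨k', hk', s', hs', hv'⟩ := view_of_request hi hj hs (by omega)
  obtain ⟨s'', hs'', hle⟩ := R.state_later hj (by omega : k' ≤ k) hs'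
  refine ⟨k, hkT, s'', he, hs'', le_antisymm (h.view_le hT' hkT.le hj hs'') ?_⟩
  have := hle.view
  omega

/-- From `t₀ + 3 * Δ` on all nonfaulty parties are known to have joined, so sending upon join
amounts to sending to all of them. -/
theorem join_delivered (h : R.Good v t₀ p) {T : ℝ} (hT : t₀ + 3 * Δ ≤ T)
    (hT' : T + Δ < t₀ + 11 * Δ) {i j : Fin n} (hi : i ∉ R.faulty) (hj : j ∉ R.faulty)
    {s : State n V} (hs : R.state (R.upTo T) i = some s) {m : Msg V} (hm : m ∈ s.joinMsgs) :
    ∃ k < R.upTo (T + Δ), ∃ s', R.event k = .recv j i m ∧ R.state k j = some s' ∧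
      s'.view = v := by
  have hΔ := R.hΔ
  obtain ⟨s₁, hs₁, hv⟩ := h.view_eq (T := T) (by linarith) (by linarith) hi
  rw [hs] at hs₁
  cases hs₁
  have hr := h.request_eq hT (by linarith) hi hj hs
  obtain ⟨l, hl, hsent⟩ := (joinInv hi hs).join m hm j (hr.trans hv.symm)
  have hin := inView_of_mem hi hs _ hm
  rw [hv] at hin
  obtain ⟨s', hs', -, hr', -⟩ := join_of_sent hi hsent hin
  exact h.sent_delivered (by linarith) hT' hi hj hl hsent hs' hr'

theorem votes_delivered (h : R.Good v t₀ p) {T : ℝ} (hT : t₀ + 3 * Δ ≤ T)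
    (hT' : T + Δ < t₀ + 11 * Δ) {ph : Phase} {val : V}
    (hvote : ∀ i s, i ∉ R.faulty → R.state (R.upTo T) i = some s → .vote ph val v ∈ s.joinMsgs)
    {j : Fin n} (hj : j ∉ R.faulty) {s : State n V} (hs : R.state (R.upTo (T + Δ)) j = some s) :
    n - f ≤ (s.voteFrom ph val).card := by
  have hΔ := R.hΔ
  refine R.card_compl_faulty.trans (Finset.card_le_card fun i hi => ?_)
  rw [Finset.mem_compl] at hi
  obtain ⟨si, hsi, -⟩ := h.view_eq (T := T) (by linarith) (by linarith) hi
  obtain ⟨k, hk, s', he, hs', rfl⟩ := h.join_delivered hT hT' hi hj hsi (hvote i si hi hsi)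
  obtain ⟨s'', hs'', hv'', hmem⟩ := vote_effect hj (h.undecided j hj) hs' he
  obtain ⟨s₁, hs₁, hv⟩ := h.view_eq (T := T + Δ) (by linarith) (by linarith) hj
  rw [hs] at hs₁
  cases hs₁
  exact (R.state_le hj hk hs'' hs).vote (by omega) ph val hmem

/-- Each voting phase costs one delay: the votes of all nonfaulty parties alone make up a quorum. -/
theorem next_vote (h : R.Good v t₀ p) {T : ℝ} (hT : t₀ + 3 * Δ ≤ T)
    (hT' : T + Δ < t₀ + 11 * Δ) {ph ph' : Phase} (hn : ph.Next ph') {val : V}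
    (hvote : ∀ i s, i ∉ R.faulty → R.state (R.upTo T) i = some s → .vote ph val v ∈ s.joinMsgs) :
    ∀ i s, i ∉ R.faulty → R.state (R.upTo (T + Δ)) i = some s → .vote ph' val v ∈ s.joinMsgs := by
  intro j s hj hs
  have hΔ := R.hΔ
  obtain ⟨s₁, hs₁, rfl⟩ := h.view_eq (T := T + Δ) (by linarith) (by linarith) hj
  rw [hs] at hs₁
  cases hs₁
  exact (vote_mem_iff hj hs ph ph' val hn).2 (h.votes_delivered hT hT' hvote hj hs)

/-- The bound `5 * Δ` is not sharp; it matches the time by which the proposal has arrived. -/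
theorem proof_delivered (h : R.Good v t₀ p) {i j : Fin n} (hi : i ∉ R.faulty) (hj : j ∉ R.faulty)
    {s : State n V} (hs : R.state (R.upTo (t₀ + 5 * Δ)) j = some s) :
    ∃ r, s.proofFrom i = some r := by
  have hΔ := R.hΔ
  obtain ⟨si, hsi, hvi⟩ := h.view_eq (T := t₀ + 4 * Δ) (by linarith) (by linarith) hi
  obtain ⟨r, hr⟩ := exists_proof_mem hi hsi
  rw [hvi] at hr
  obtain ⟨k, hk, s', he, hs', rfl⟩ := h.join_delivered (by linarith) (by linarith) hi hj hsi hr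
  obtain ⟨s'', hs'', hv'', r', hr'⟩ := proof_effect hj (h.undecided j hj) hs' he
  obtain ⟨s₁, hs₁, hv⟩ := h.view_eq (T := t₀ + 5 * Δ) (by linarith) (by linarith) hj
  rw [hs] at hs₁
  cases hs₁
  have hk' : k + 1 ≤ R.upTo (t₀ + 5 * Δ) :=
    Nat.succ_le_of_lt (hk.trans_le (upTo_mono (by linarith)))
  exact ⟨r', (R.state_le hj hk' hs'' hs).proof (by omega) i r' hr'⟩

theorem suggest_delivered (h : R.Good v t₀ p) {i : Fin n} (hi : i ∉ R.faulty)
    {s : State n V} (hs : R.state (R.upTo (t₀ + 4 * Δ)) p = some s) :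
    ∃ x, s.suggestFrom i = some x := by
  have hΔ := R.hΔ
  obtain ⟨si, hsi, hvi⟩ := h.view_eq (T := t₀ + 3 * Δ) (by linarith) (by linarith) hi
  have hr := h.request_eq le_rfl (by linarith) hi h.nonfaulty hsi
  obtain ⟨k3, v3, r, l, hl, hsent⟩ :=
    (joinInv hi hsi).suggest p (hr.trans hvi.symm) (hvi ▸ h.primary)
  rw [hvi] at hsent
  obtain ⟨s', hs', -, hr', -⟩ := suggest_of_sent hi hsent
  obtain ⟨k, hk, s', he, hs', hv'⟩ :=
    h.sent_delivered (by linarith) (by linarith) hi h.nonfaulty hl hsent hs' hr'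
  obtain ⟨s'', hs'', hv'', x, hx⟩ := suggest_effect h.nonfaulty (h.undecided p h.nonfaulty) hs'
    (hv' ▸ h.primary) (hv' ▸ he)
  obtain ⟨s₁, hs₁, hv⟩ := h.view_eq (T := t₀ + 4 * Δ) (by linarith) (by linarith) h.nonfaulty
  rw [hs] at hs₁
  cases hs₁
  have hk' : k + 1 ≤ R.upTo (t₀ + 4 * Δ) :=
    Nat.succ_le_of_lt (hk.trans_le (upTo_mono (by linarith)))
  exact ⟨x, (R.state_le h.nonfaulty hk' hs'' hs).suggest (by omega) i x hx⟩

end Good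

/-! ### Acceptable suggestions and locks that can be opened -/

/-- The proposal behind an echo, if the primary is nonfaulty. -/
theorem cast_propose_of_echo {p : Fin n} {v : ℕ} (hp : p ∉ R.faulty) (hpv : IsPrimary p v)
    {i : Fin n} (hi : i ∉ R.faulty) {k : ℕ} {val : V} (h : R.Cast k i (.vote .echo val v)) :
    ∃ k' < k, ∃ key, R.Cast k' p (.propose key val v) := by
  obtain ⟨p', key, hp', hr⟩ := propose_of_echo hi h
  obtain rfl := hpv.unique hp'
  obtain ⟨k', hk', hc⟩ := cast_of_received hi hp hr (v := v) rfl
  exact ⟨k', hk', key, hc⟩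

/-- Nobody votes before a nonfaulty primary has made a proposal. -/
theorem cast_propose_of_vote {p : Fin n} {v : ℕ} (hp : p ∉ R.faulty) (hpv : IsPrimary p v)
    {i : Fin n} (hi : i ∉ R.faulty) {k : ℕ} {ph : Phase} {val : V}
    (h : R.Cast k i (.vote ph val v)) : ∃ k' < k, ∃ key, R.Cast k' p (.propose key val v) := by
  have key : ∀ {ph'}, Phase.Next ph' ph → ∃ k' < k, ∃ key, R.Cast k' p (.propose key val v) := by
    intro ph' hn
    obtain ⟨j, hj, l, hl, hc⟩ := (quorum_of_cast hi h hn).echo.exists_voter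
    obtain ⟨k', hk', key, hc⟩ := cast_propose_of_echo hp hpv hj hc
    exact ⟨k', hk'.trans hl, key, hc⟩
  cases ph
  · exact cast_propose_of_echo hp hpv hi h
  · exact key (ph' := .echo) trivial
  · exact key (ph' := .key1) trivial
  · exact key (ph' := .key2) trivial
  · exact key (ph' := .key3) trivial

/-- All suggestions of nonfaulty parties that reach a nonfaulty primary before it makes a proposal
are accepted once the primary has heard from all nonfaulty parties. -/
theorem suggestion_accepted {p : Fin n} (hp : p ∉ R.faulty) {k : ℕ} {s : State n V}
    (hs : R.state k p = some s) (hpv : IsPrimary p s.view) (hprop : s.proposed = false)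
    (hall : ∀ i, i ∉ R.faulty → ∃ x, s.suggestFrom i = some x) {i : Fin n} (hi : i ∉ R.faulty) :
    (suggestions f s i).isSome := by
  have hinv := proposeInv hp hs
  -- Before the primary proposes there are no votes in this view, so every key reported by a
  -- nonfaulty party was set in an earlier view.
  have hno : ∀ k' ≤ k, ∀ j ph val, j ∉ R.faulty → ¬ R.Cast k' j (.vote ph val s.view) := by
    intro k' hk' j ph val hj hc
    obtain ⟨k'', hk'', key, hc⟩ := cast_propose_of_vote hp hpv hj hc
    have := hinv.proposed.1 ⟨key, val, cast_mem hp hc (by omega) hs rfl⟩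
    exact Bool.false_ne_true (hprop.symm.trans this)
  have hsug : ∀ j, j ∉ R.faulty → ∃ k3 v3 r, s.suggestFrom j = some ((k3, v3), r) ∧
      ∃ k' < k, ∃ sj, R.state k' j = some sj ∧ sj.view = s.view ∧ sj.key3 = k3 ∧
        sj.key3Val = v3 ∧ sj.key2 = r := by
    intro j hj
    obtain ⟨⟨⟨k3, v3⟩, r⟩, hx⟩ := hall j hj
    exact ⟨k3, v3, r, hx, suggest_of_received hp hj (hinv.received j k3 v3 r hx)⟩
  -- The records of nonfaulty parties pass the primary's test `prev < key < view`.
  have hkey2 : ∀ j r kv, j ∉ R.faulty → s.suggestFrom j = some (kv, r) →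
      key2Proofs s j = some r := by
    intro j r kv hj hx
    obtain ⟨k3, v3, r', hx', k', hk', sj, hsj, hvj, -, -, rfl⟩ := hsug j hj
    rw [hx] at hx'
    cases hx'
    have hk := (keysInv hj hsj).key2
    refine key2Proofs_eq_some.2 ⟨_, hx, hk.lt, lt_of_le_of_ne (hvj ▸ hk.le) fun he => ?_⟩
    have hpos := view_pos hp hs
    obtain ⟨w, hw, hc⟩ := hk.key (by omega)
    obtain rfl : w = s.view := by omega
    exact hno k' hk'.le j _ _ hj hc
  obtain ⟨k3, v3, r, hx, k', hk', si, hsi, hvi, h3, hv3, hr⟩ := hsug i hi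
  rw [Option.isSome_iff_exists]
  refine ⟨(k3, v3), suggestions_eq_some.2 ⟨⟨r, hx⟩, ?_⟩⟩
  rcases (keysInv hi hsi).key3 with ⟨h, -⟩ | ⟨w, -, hwle, hw, hc⟩
  · exact .inl (h3.symm.trans h)
  · rw [hv3] at hc
    have hlt : w < s.view := by
      refine lt_of_le_of_ne (hvi ▸ hwle) fun he => ?_
      subst he
      exact hno k' hk'.le i _ _ hi hc
    refine .inr ⟨by omega, ?_⟩
    -- The key was set upon a `key2` quorum in view `w`; the `key2` records of its `f + 1` nonfaulty
    -- members still dominate that vote, which is what `acceptKey` asks for.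
    obtain ⟨H, hH, hvote⟩ := (quorum_of_cast hi hc (ph := .key2) trivial).exists_voters
    refine hH.trans (Finset.card_le_card fun j hj => ?_)
    obtain ⟨hjf, l, hl, hcj⟩ := hvote j hj
    obtain ⟨k3', v3', r', hx', kj, hkj, sj, hsj, hvj, -, -, rfl⟩ := hsug j hjf
    simp only [Finset.mem_filter, Finset.mem_univ, true_and]
    refine ⟨sj.key2, hkey2 j _ _ hjf hx', ?_⟩
    obtain ⟨l', hl', hcj⟩ := hcj.of_view_lt hjf (v := w) rfl hsj (by omega)
    obtain ⟨h1, h2⟩ := (votesInv hjf hsj).key2 _ _ (hcj.mono hl'.le)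
    rcases h2 with h2 | h2
    · exact .inr ⟨by omega, h2.symm⟩
    · exact .inl (by omega)

/-- A proposal of a nonfaulty primary has a key at least as high as any lock held by a nonfaulty
party, and if it contradicts the lock then the proofs of `f + 1` nonfaulty parties open it. -/
theorem lock_openable {p : Fin n} {v : ℕ} (hp : p ∉ R.faulty) (hpv : IsPrimary p v) {i : Fin n}
    (hi : i ∉ R.faulty) {k : ℕ} {key : ℤ} {val : V} {l : ℤ} {lv : V}
    (hcon : R.Considered k i v key val l lv) (hl : l ≠ 0) (hval : val ≠ lv) :
    l ≤ key ∧ key < v ∧ ∃ H : Finset (Fin n), f + 1 ≤ H.card ∧ ∀ j ∈ H, j ∉ R.faulty ∧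
      ∀ k' r, R.Received k' i j (.proof r v) →
        r.prev < r.key ∧ r.key < v ∧ (l ≤ r.prev ∨ (l ≤ r.key ∧ r.val ≠ lv)) := by
  obtain ⟨k₀, hk₀, s₀, p', hs₀, hv₀, rfl, rfl, hp', hrec⟩ := hcon
  obtain rfl := hpv.unique hp'
  obtain ⟨k₁, hk₁, hc₁⟩ := cast_of_received hi hp hrec (v := v) rfl
  obtain ⟨s₁, hs₁⟩ := proposal_of_cast hp hc₁
  obtain ⟨w, hw0, hwle, hw, hc⟩ := (keysInv hi hs₀).lock.resolve_left hl
  have hquorum := quorum_of_cast hi hc (ph := .key3) trivial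
  -- A lock set in view `v` itself would be for a value proposed by `p` in `v`, hence for `val`.
  have hwv : w < v := by
    refine lt_of_le_of_ne (hv₀ ▸ hwle) fun he => hval ?_
    subst he
    obtain ⟨j, hj, l, hl, hcj⟩ := hquorum.echo.exists_voter
    obtain ⟨k', hk', key', hc'⟩ := cast_propose_of_echo hp hpv hj hcj
    exact (propose_unique hp hc₁ hc').2
  -- Among the `n - f` accepted suggestions is that of a nonfaulty party that voted `key3` in the
  -- lock's view. Its key is at least `w`, and `key` is maximal.
  have hle : s₀.lock ≤ key := by
    obtain ⟨H, hH, hvote⟩ := hquorum.exists_voters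
    have hne : ((Finset.univ.filter fun l => (suggestions f s₁ l).isSome) ∩ H).Nonempty := by
      rw [← Finset.card_pos]
      have h1 := Finset.card_union_add_card_inter
        (Finset.univ.filter fun l => (suggestions f s₁ l).isSome) H
      have h2 : ((Finset.univ.filter fun l => (suggestions f s₁ l).isSome) ∪ H).card ≤ n :=
        (Finset.card_le_univ _).trans_eq (Fintype.card_fin n)
      have h3 := hs₁.card
      omega
    obtain ⟨j, hj⟩ := hne
    simp only [Finset.mem_inter, Finset.mem_filter, Finset.mem_univ, true_and,
      Option.isSome_iff_exists] at hj
    obtain ⟨⟨⟨k3, v3⟩, hsug⟩, hjH⟩ := hj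
    obtain ⟨hjf, l, -, hcj⟩ := hvote j hjH
    obtain ⟨⟨r, hr⟩, -⟩ := suggestions_eq_some.1 hsug
    obtain ⟨kj, -, sj, hsj, hvj, h3, -⟩ := suggest_of_received hp hjf (hs₁.received j k3 v3 r hr)
    obtain ⟨l', hl', hcj⟩ := hcj.of_view_lt hjf (v := w) rfl hsj (by omega)
    have h4 := (votesInv hjf hsj).key3 _ _ (hcj.mono hl'.le)
    have h5 : k3 ≤ key := hs₁.le j _ hsug
    omega
  obtain ⟨l, hl'⟩ := hs₁.mem
  obtain ⟨-, hacc⟩ := suggestions_eq_some.1 hl'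
  rw [hs₁.view] at hacc
  obtain ⟨hkv, hacc⟩ := hacc.resolve_left (by omega)
  refine ⟨hle, hkv, ?_⟩
  -- As `key` is positive, it was accepted upon `f + 1` records, one of them from a nonfaulty party.
  obtain ⟨j, hj, hjf⟩ := R.exists_mem_not_faulty hacc
  obtain ⟨r, hr, hor⟩ := (Finset.mem_filter.1 hj).2
  obtain ⟨⟨k3, v3⟩, hx, hlt, hrv⟩ := key2Proofs_eq_some.1 hr
  rw [hs₁.view] at hrv
  obtain ⟨kj, -, sj, hsj, hvj, -, -, rfl⟩ := suggest_of_received hp hjf (hs₁.received j k3 v3 _ hx)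
  have hkey := (keysInv hjf hsj).key2
  -- This party voted `key2` for a value other than the locked one in some view from `key` on. If
  -- its record matches by value, that value is `val`; if by `prev`, the record shows two different
  -- values from `key` on, and one of them is not the locked one.
  have hother : ∃ w' : ℕ, ∃ val', key ≤ w' ∧ w' < v ∧ val' ≠ s₀.lockVal ∧
      R.Cast kj j (.vote .key2 val' w') := by
    obtain ⟨w₂, hw₂, hc₂⟩ := hkey.key (by omega)
    rcases hor with hor | ⟨hor, he⟩
    · obtain ⟨w₁, hw₁, val₁, hne, hc₁⟩ := hkey.prev (by omega)
      by_cases hcase : sj.key2.val = s₀.lockVal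
      · exact ⟨w₁, val₁, by omega, by omega, hcase ▸ hne, hc₁⟩
      · exact ⟨w₂, _, by omega, by omega, hcase, hc₂⟩
    · exact ⟨w₂, _, by omega, by omega, he ▸ hval, hc₂⟩
  obtain ⟨w', val', hkw, hwv', hne, hc'⟩ := hother
  -- Behind that `key2` vote stand `f + 1` nonfaulty `key1` votes. The proofs of these parties
  -- dominate them, and as `w'` is at least the lock, each either shows another value or has a large
  -- enough `prev`.
  obtain ⟨H, hH, hvote⟩ := (quorum_of_cast hjf hc' (ph := .key1) trivial).exists_voters
  refine ⟨H, hH, fun q hq => ⟨(hvote q hq).1, fun k' r hr => ?_⟩⟩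
  obtain ⟨hqf, l, -, hcq⟩ := hvote q hq
  obtain ⟨h1, h2, h3⟩ := proof_of_received hi hqf hr
  obtain ⟨h4, h5⟩ := h3 l val' w' hwv' hcq
  refine ⟨h1.lt, h2, ?_⟩
  rcases h5 with h5 | h5
  · exact .inr ⟨by omega, h5 ▸ hne⟩
  · exact .inl (by omega)

/-! ### The timetable of a good view -/

namespace Good

variable {v : ℕ} {t₀ : ℝ} {p : Fin n}

/-- By `4 * Δ` all nonfaulty suggestions have arrived. If there were no proposal yet, all of them
would be accepted, which is enough for one. -/
theorem proposes (h : R.Good v t₀ p) {s : State n V}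
    (hs : R.state (R.upTo (t₀ + 4 * Δ)) p = some s) :
    ∃ key val, .propose key val v ∈ s.joinMsgs := by
  have hΔ := R.hΔ
  obtain ⟨s₁, hs₁, rfl⟩ := h.view_eq (T := t₀ + 4 * Δ) (by linarith) (by linarith) h.nonfaulty
  rw [hs] at hs₁
  cases hs₁
  have hinv := proposeInv h.nonfaulty hs
  rw [hinv.proposed]
  by_contra hprop
  rw [Bool.not_eq_true] at hprop
  refine absurd (hinv.waiting hprop) (not_lt.2 (R.card_compl_faulty.trans
    (Finset.card_le_card fun i hi => ?_)))
  rw [Finset.mem_compl] at hi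
  simp only [Finset.mem_filter, Finset.mem_univ, true_and]
  exact suggestion_accepted h.nonfaulty hs h.primary hprop
    (fun i hi => h.suggest_delivered hi hs) hi

/-- Once the proposal has been processed, `EchoInv.answered` leaves three cases. An echo is for the
only value that the nonfaulty primary proposed; a pending proposal would have been opened by the
proofs received by `5 * Δ`; a rejection contradicts the bounds of `lock_openable`. -/
theorem echoes (h : R.Good v t₀ p) : ∃ val, ∀ i s, i ∉ R.faulty →
    R.state (R.upTo (t₀ + 5 * Δ)) i = some s → .vote .echo val v ∈ s.joinMsgs := by
  have hΔ := R.hΔ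
  obtain ⟨sp, hsp, hvp⟩ := h.view_eq (T := t₀ + 4 * Δ) (by linarith) (by linarith) h.nonfaulty
  obtain ⟨key, val, hprop⟩ := h.proposes hsp
  refine ⟨val, fun i s hi hs => ?_⟩
  obtain ⟨k, hk, s', he, hs', hv'⟩ :=
    h.join_delivered (by linarith) (by linarith) h.nonfaulty hi hsp hprop
  obtain ⟨s'', hs'', hv'', hseen⟩ := propose_effect hi (h.undecided i hi) hs'
    (hv' ▸ h.primary) (hv' ▸ he)
  obtain ⟨s₁, hs₁, hv⟩ := h.view_eq (T := t₀ + 5 * Δ) (by linarith) (by linarith) hi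
  rw [hs] at hs₁
  cases hs₁
  have hk' : k + 1 ≤ R.upTo (t₀ + 5 * Δ) :=
    Nat.succ_le_of_lt (hk.trans_le (upTo_mono (by linarith)))
  have hseen' := (R.state_le hi hk' hs'' hs).proposalSeen (by omega) hseen
  have hinv := echoInv hi hs
  have hpv : IsPrimary p s.view := hv ▸ h.primary
  rcases hinv.answered hseen' with ⟨val', hm⟩ | ⟨val', l, lv, hpend⟩ |
      ⟨key', val', l, lv, hcon, hl, hne, hrej⟩
  · have hm' : R.Cast _ i (.vote .echo val' s.view) := ⟨_, le_rfl, s, hs, hm⟩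
    obtain ⟨k', -, key', hc⟩ := cast_propose_of_echo h.nonfaulty hpv hi hm'
    rw [hv] at hc hm
    obtain ⟨-, rfl⟩ := propose_unique h.nonfaulty ⟨_, le_rfl, sp, hsp, hprop⟩ hc
    exact hm
  · exfalso
    obtain ⟨-, hopen, key', hcon, hl, hne, -⟩ := hinv.waiting val' l lv hpend
    obtain ⟨-, -, H, hH, hproofs⟩ := lock_openable h.nonfaulty hpv hi hcon hl hne
    refine hopen (hH.trans (Finset.card_le_card fun j hj => ?_))
    obtain ⟨hjf, hj⟩ := hproofs j hj
    obtain ⟨r, hr⟩ := h.proof_delivered hjf hi hs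
    obtain ⟨h1, h2, h3⟩ := hj _ r (hinv.received j r hr)
    simp only [Finset.mem_filter, Finset.mem_univ, true_and]
    exact ⟨r, proofs_eq_some.2 ⟨hr, h1, h2⟩, h3⟩
  · exfalso
    obtain ⟨h1, h2, -⟩ := lock_openable h.nonfaulty hpv hi hcon hl hne
    exact hrej ⟨h1, h2⟩

theorem done_sent (h : R.Good v t₀ p) {i : Fin n} (hi : i ∉ R.faulty) :
    ∃ k s, R.state k i = some s ∧ s.doneSent = true := by
  have hΔ := R.hΔ
  obtain ⟨val, hecho⟩ := h.echoes
  have h1 := h.next_vote (by linarith) (by linarith) (show Phase.Next .echo .key1 from trivial)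
    hecho
  have h2 := h.next_vote (by linarith) (by linarith) (show Phase.Next .key1 .key2 from trivial) h1
  have h3 := h.next_vote (by linarith) (by linarith) (show Phase.Next .key2 .key3 from trivial) h2
  have h4 := h.next_vote (by linarith) (by linarith) (show Phase.Next .key3 .lock from trivial) h3
  -- Echoes at `5 * Δ`, four further phases and a last delivery add up to `10 * Δ`, before any
  -- nonfaulty alarm of the view.
  obtain ⟨s, hs, -⟩ := h.view_eq (T := t₀ + 5 * Δ + Δ + Δ + Δ + Δ + Δ) (by linarith) (by linarith) hi
  exact ⟨_, s, hs, (doneInv hi hs).lock val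
    (h.votes_delivered (by linarith) (by linarith) h4 hi hs)⟩

end Good

/-! ### Termination -/

theorem done_sent_all {i j : Fin n} (hi : i ∉ R.faulty) {k : ℕ} {val : V}
    (hm : .done val ∈ R.sent k i j) : ∀ p, .done val ∈ R.sent k i p := by
  generalize h : Msg.done val = m at hm
  cases sentBy_of_mem hi hm with
  | join hs hj hm => subst h; exact (inView_of_mem hi hs _ hm).elim
  | lock hs hc ho =>
    cases h
    exact ho
  | done hs hc ho =>
    cases h
    exact ho
  | _ => cases h

theorem sent_of_doneSent {i : Fin n} (hi : i ∉ R.faulty) {k : ℕ} {s : State n V}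
    (hs : R.state k i = some s) : s.doneSent = true → ∃ val, ∀ j, R.Sent k i j (.done val) := by
  refine R.invariant hi (fun k s => s.doneSent = true → ∃ val, ∀ j, R.Sent k i j (.done val))
    ?_ ?_ ?_ ?_ hs
  · intro k s ih h
    obtain ⟨val, h⟩ := ih h
    exact ⟨val, fun j => (h j).mono k.le_succ⟩
  · intro k _ _ h
    cases h
  · intro k j m s s' o _ _ _ ho h ih
    have ih' : s.doneSent = true → ∃ val, ∀ j, R.Sent (k + 1) i j (.done val) := fun h => by
      obtain ⟨val, h⟩ := ih h
      exact ⟨val, fun j => (h j).mono k.le_succ⟩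
    have hnew : ∀ val, R.sent k i = sendAll (.done val) →
        ∃ val, ∀ j, R.Sent (k + 1) i j (.done val) := fun val ho =>
      ⟨val, fun j => ⟨k, k.lt_succ_self, by rw [ho]; exact List.mem_singleton.2 rfl⟩⟩
    cases h with
    | done h hd ho' =>
      intro hb
      rcases ho' with ⟨-, -, -, rfl⟩ | ⟨-, he, -⟩
      · exact hnew _ ho
      · exact ih' (he.symm.trans hb)
    | quorumLock h hc ho' =>
      intro _
      rcases ho' with ⟨-, rfl⟩ | ⟨he, -⟩
      · exact hnew _ ho
      · exact ih' he
    | _ => exact ih'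
  · intro k s d _ _ _ _ _ ih h
    obtain ⟨val, h⟩ := ih h
    exact ⟨val, fun j => (h j).mono k.le_succ⟩

theorem done_reaches {i q : Fin n} (hi : i ∉ R.faulty) (hu : R.Undecided i) (hq : q ∉ R.faulty)
    {k : ℕ} {val : V} {T : ℝ} (hk : k ≤ R.upTo T) (hT : R.GST ≤ T) (h : R.Sent k q i (.done val))
    {s : State n V} (hs : R.state (R.upTo (T + Δ)) i = some s) : q ∈ s.doneFrom val := by
  obtain ⟨l, hl, h⟩ := h
  obtain ⟨k', -, hk', he⟩ := delivered hq hi (hl.trans_le hk) hT h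
  obtain ⟨s', hs', hle⟩ := done_effect hi hu he
  exact (R.state_le hi hk' hs' hs).doneFrom val hle

/-- If all nonfaulty parties send `done`, they all decide. -/
theorem not_undecided_of_done
    (h : ∀ i, i ∉ R.faulty → ∃ k s, R.state k i = some s ∧ s.doneSent = true) {q : Fin n}
    (hq : q ∉ R.faulty) : ¬ R.Undecided q := by
  intro hu
  have hΔ := R.hΔ
  have hsent : ∀ i, i ∉ R.faulty → ∃ k val, ∀ j, R.Sent k i j (.done val) := by
    intro i hi
    obtain ⟨k, s, hs, hd⟩ := h i hi
    exact ⟨k, sent_of_doneSent hi hs hd⟩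
  obtain ⟨_, val, hval⟩ := hsent q hq
  obtain ⟨l₀, -, hval⟩ := hval q
  obtain ⟨_, _, hquorum⟩ := quorum_of_done hq hval
  have hsent' : ∀ i, i ∉ R.faulty → ∃ k, R.Sent k i q (.done val) := by
    intro i hi
    obtain ⟨k, val', hval'⟩ := hsent i hi
    obtain ⟨l, hl, hm⟩ := hval' q
    obtain ⟨_, _, hquorum'⟩ := quorum_of_done hi hm
    -- Both `done` messages go back to lock quorums, so they carry the same value and can be counted
    -- together.
    obtain rfl := lock_quorum_unique hquorum hquorum'
    exact ⟨k, l, hl, hm⟩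
  choose! F hF using hsent'
  obtain ⟨T, hT, hk⟩ := R.exists_le_upTo (Finset.univ.sup F)
  obtain ⟨s, hs⟩ := started hq (show R.GST ≤ T + Δ by linarith)
  refine (doneInv hq hs).decide val (R.card_compl_faulty.trans (Finset.card_le_card ?_)) (hu _ s hs)
  intro i hi
  rw [Finset.mem_compl] at hi
  exact done_reaches hq hu hi ((Finset.le_sup (Finset.mem_univ i)).trans hk) hT (hF i hi) hs

/-- If some nonfaulty party decides, then all do. -/
theorem not_undecided_of_decided {i : Fin n} (hi : i ∉ R.faulty) {k : ℕ} {s : State n V}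
    (hs : R.state k i = some s) {val : V} (hd : s.decided = some val) {q : Fin n}
    (hq : q ∉ R.faulty) : ¬ R.Undecided q := by
  have hf := R.hf
  have hΔ := R.hΔ
  refine not_undecided_of_done (fun p hp => ?_) hq
  by_cases hu : R.Undecided p
  -- At least `f + 1` of the `done` messages counted by `i` are from nonfaulty parties, which sent
  -- them to `p` as well.
  · obtain ⟨T, hT, hk⟩ := R.exists_le_upTo k
    obtain ⟨sp, hsp⟩ := started hp (show R.GST ≤ T + Δ by linarith)
    refine ⟨_, sp, hsp, (doneInv hp hsp).amplify val
      ((R.card_sdiff_faulty ((doneInv hi hs).decided val hd)).trans (Finset.card_le_card ?_))⟩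
    intro j hj
    rw [Finset.mem_sdiff] at hj
    obtain ⟨k', hk', l, hl, hm⟩ := (received_of_mem_doneFrom hi hs j val hj.1).sent hi hj.2
    exact done_reaches hp hu hj.2 hk hT ⟨l, by omega, done_sent_all hj.2 hm p⟩ hsp
  · unfold Undecided at hu
    push Not at hu
    obtain ⟨k', s', hs', hne⟩ := hu
    obtain ⟨val', hval'⟩ := Option.ne_none_iff_exists'.1 hne
    have hinv := doneInv hp hs'
    have := hinv.decided val' hval'
    exact ⟨k', s', hs', hinv.amplify val' (by omega)⟩

/-- Either no nonfaulty party ever decides, and a good view, with `q` itself as primary, makes all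
send `done`; or one does, and its decision spreads. Both contradict that `q` is undecided. -/
theorem exists_decided (R : Run n V f Δ) {q : Fin n} (hq : q ∉ R.faulty) :
    ∃ val k s, R.state k q = some s ∧ s.decided = some val := by
  by_contra! hno
  have hu : R.Undecided q := by
    intro k s hs
    by_contra hne
    obtain ⟨val, hval⟩ := Option.ne_none_iff_exists'.1 hne
    exact hno val k s hs hval
  by_cases hall : ∀ i, i ∉ R.faulty → R.Undecided i
  · obtain ⟨v, t₀, hp, hv⟩ := exists_entered hall (p := q)
    exact not_undecided_of_done
      (fun i hi => Good.done_sent ⟨hv, hall, hq, hp⟩ hi) hq hu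
  · unfold Undecided at hall
    push Not at hall
    obtain ⟨i, hi, k, s, hs, hne⟩ := hall
    obtain ⟨val, hval⟩ := Option.ne_none_iff_exists'.1 hne
    exact not_undecided_of_decided hi hs hval hq hu

end Run

end ITHS

/-! ### The main theorem -/

theorem mainTheorem1 {V : Type*} [DecidableEq V] (n f : ℕ) (hf : 3 * f < n) (Δ : ℝ) (hΔ : 0 < Δ) :
    PartialSync.IsByzantineAgreement (ITHS.protocol n f Δ V) f Δ := by
  intro faulty hfaulty input E
  let R := ITHS.Run.ofExecution hf hΔ hfaulty E
  refine ⟨fun i hi => ?_, fun i j v w hi hj hv hw => ?_, fun h0 v hin i w hw => ?_⟩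
  · obtain ⟨val, k, s, hs, hd⟩ := R.exists_decided (q := i) hi
    exact ⟨val, k, s, hs, hd⟩
  · obtain ⟨k, s, hs, hd⟩ := hv
    obtain ⟨k', s', hs', hd'⟩ := hw
    obtain ⟨_, _, hq⟩ := ITHS.Run.quorum_of_decided (R := R) hi hs hd
    obtain ⟨_, _, hq'⟩ := ITHS.Run.quorum_of_decided (R := R) hj hs' hd'
    exact ITHS.Run.lock_quorum_unique hq hq'
  · obtain ⟨k, s, hs, hd⟩ := hw
    exact ITHS.Run.decided_eq (R := R) h0 hin hs hd
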